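/- Let $c_1>0$, $L\ge 1$ and $Q>0$. There exist constants $C,c>0$, depending only on $c_1$, $L$ and $Q$, such that the following holds for all positive integers $n,p$ with $c_1 n\le p\le n$. Let $\xi$ be a real random variable with $\mathbb E\,\xi=0$, $\mathbb E\,\xi^2=1$, $\mathbb E\,\xi^4<\infty$, which is subgaussian with subgaussian moment $Q$, i.e. $$\mathbb P(|\xi|>t)\le \tfrac1Q e^{-Qt^2}\qquad\text{for all } t>0 .$$ Let $M$ be an $n\times p$ random matrix whose entries are independent copies of $\xi$, and let $\Sigma$ be a deterministic (symmetric) positive definite $n\times n$ real matrix with $\|\Sigma\|\le L^2$ and $\|\Sigma^{-1}\|\le L^2$, where $\|\cdot\|$ is the spectral norm. Then, with probability at least $1-C\exp(-n^{c})$, the $p$ singular values of $\Sigma^{1/2}M$ (the square roots of the $p$ eigenvalues of $M^{\mathsf T}\Sigma M$, listed with multiplicity) are pairwise distinct. -/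

import Mathlib

open MeasureTheory ProbabilityTheory
open scoped MatrixOrder

/-- The spectral norm `sup_{‖x‖ = 1} ‖A x‖` of a real square matrix, where vectors carry the
Euclidean norm. -/
noncomputable def specNorm {n : ℕ} (A : Matrix (Fin n) (Fin n) ℝ) : ℝ :=
  ‖Matrix.toEuclideanCLM (n := Fin n) (𝕜 := ℝ) A‖

/-- The `p` singular values, in decreasing order and with multiplicity, of an `n × p` real matrix
(the square roots of the `p` eigenvalues of `Aᵀ A`); the index starts at `0`. -/
noncomputable def singVal {n p : ℕ} (A : Matrix (Fin n) (Fin p) ℝ) (i : Fin p) : ℝ :=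
  (Matrix.toEuclideanLin A).singularValues i

/-- A real random variable is subgaussian with subgaussian moment `Q` if
`ℙ(|ξ| > t) ≤ Q⁻¹ exp(-Q t²)` for all `t > 0`. -/
def IsSubgaussian {Ω : Type*} [MeasurableSpace Ω] (Q : ℝ) (ξ : Ω → ℝ) (μ : Measure Ω) : Prop :=
  0 < Q ∧ ∀ t : ℝ, 0 < t → μ.real {ω | t < |ξ ω|} ≤ 1 / Q * Real.exp (-Q * t ^ 2)

/-- The random variable `ξ` has mean zero, unit variance and a finite fourth moment. -/
structure IsAtomVariable {Ω : Type*} [MeasurableSpace Ω] (ξ : Ω → ℝ) (μ : Measure Ω) : Prop where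
  memLp_four : MemLp ξ 4 μ
  mean_zero : ∫ ω, ξ ω ∂μ = 0
  unit_variance : variance ξ μ = 1

/-- `M` is an `n × p` random matrix with aspect ratio `p / n ∈ [c₁, 1]`, whose entries are
independent copies of `ξ`. -/
structure IsIIDMatrix {Ω Ω' : Type*} [MeasurableSpace Ω] [MeasurableSpace Ω'] (c₁ : ℝ) {n p : ℕ}
    (M : Ω → Matrix (Fin n) (Fin p) ℝ) (P : Measure Ω) (ξ : Ω' → ℝ) (P' : Measure Ω') :
    Prop where
  aspect_lower : c₁ * (n : ℝ) ≤ (p : ℝ)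
  aspect_upper : p ≤ n
  indep : iIndepFun (fun (ij : Fin n × Fin p) (ω : Ω) => M ω ij.1 ij.2) P
  identDistrib : ∀ i j, IdentDistrib (fun ω => M ω i j) ξ P P'

/-- `S` is positive definite (in particular symmetric), with `‖S‖, ‖S⁻¹‖ ≤ L²`. -/
structure IsBoundedPosDef (L : ℝ) {n : ℕ} (S : Matrix (Fin n) (Fin n) ℝ) : Prop where
  posDef : S.PosDef
  norm_le : specNorm S ≤ L ^ 2
  norm_inv_le : specNorm S⁻¹ ≤ L ^ 2

/-!
The singular values of `Σ ^ (1 / 2) M` are pairwise distinct as soon as `W = Mᵀ Σ M` has no multiple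
eigenvalue, so the spectrum of `W` has to be shown simple outside an event of probability
`exp (-n ^ c)`. Only the spectral bounds on `Σ` and two features of the entry law enter: a
subgaussian moment generating function, and the spread of the symmetrised law (`SpreadLaw`,
`exists_spreadLaw`).

*Reduction to eigenvectors of a smaller matrix.* Removing row `i` of `M` turns `W` into
`W₀ + s g gᵀ`, where `W₀` is built from the remaining rows and the Schur complement of `Σ`, and `g`
is row `i` shifted by a combination of the other rows (`rowGram_mulVec_eq_add`). If `W` has a
multiple eigenvalue, then for some row `i` the vector `g` is resonant: it lies in the range of
`W₀ - λ` for an eigenvalue `λ` of `W₀` (`exists_isResonant`). It is then orthogonal to the whole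
eigenspace of `λ`, hence to some member of an eigenbasis of `W₀`, which is independent of row `i`
(`exists_eigenvectors_dotProduct_eq_zero`, `measure_isResonant_le`). Therefore it is enough that,
with overwhelming probability, every unit eigenvector `v` of `W₀` gives a linear form `∑ x j * v j`
all of whose atoms are at most `exp (-q)`, where `q` is of order `n ^ (1 / 18)`
(`exists_measure_eigenvector_atom_le`). The margin in this power of `n` is what absorbs all factors
that are polynomial in `q`.

*Eigenvectors are unstructured.* By an Esseen-type inequality (`integral_exp_neg_sq_le`) a linear
form has small atoms unless `θ v` is close to an integer vector for some moderate `θ`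
(`small_ball_of_unstructured`). The coordinates are divided into `q ^ 2` blocks, and `v` is called
structured up to scale `D` if every block has such a dilate with `θ ≤ D`; it has to be excluded
that an eigenvector is structured up to the scale `4 ^ q * (√n / (2 * q))`. Eigenvectors carried by
few large coordinates are excluded by a net of sparse vectors
(`exists_measure_compressible_le`). The other ones are not structured at the bottom scale
(`Regime.not_isStructured_bot`), so a structured one belongs, for some dyadic `D`, to the class of
vectors structured up to `D` but not up to `D / 2`.

Each such class is treated by a union bound (`exists_measure_structuredClass_le`). It has a net at
scale `q ^ 2 / D` with about `(D q / √n) ^ p` points, because the dilated coordinates are near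
integers and the errors fill only cross-polytopes of the right size (`exists_structured_net`). For a
fixed point `v`, the failure of structure at scale `D / 2` concerns only two blocks: one with mass
and one witnessing the failure. The rows of `X` outside these blocks, `d` in number, see the two
blocks only through one random vector `w ᵥ* A`, whose entries have a small-ball bound proportional
to the scale, down to scales of order `q / D`; as these rows span a large volume
(`measure_det_lt_le`), the `d` corresponding coordinates of the eigenvector equation hold
approximately with probability at most about `(q ^ 7 / D) ^ d` (`integral_exp_neg_quadratic_le`,
`measure_near_eigenvector_le`). The two blocks contain few coordinates, so `d` is nearly `p`, the
powers of `D` nearly cancel, and the factor `√n ^ (-p)` wins (`net_card_mul_prob_le`).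
-/

/-! ### Consequences of subgaussianity -/

/-- The two features of the entry law that the argument uses: a subgaussian moment generating
function, and the fact that the symmetrisation `x - y` lies in a fixed compact subset of
`ℝ \ {0}` with probability bounded below. -/
structure SpreadLaw (σ q₀ K₀ : ℝ) (μ : Measure ℝ) : Prop where
  mgf_integrable : ∀ t : ℝ, Integrable (fun x => Real.exp (t * x)) μ
  mgf_le : ∀ t : ℝ, ∫ x, Real.exp (t * x) ∂μ ≤ Real.exp (σ * t ^ 2)
  spread : q₀ ≤ (μ.prod μ).real {z | 1 / 2 ≤ |z.1 - z.2| ∧ |z.1 - z.2| ≤ K₀}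

lemma exp_le_add_exp_sq (x : ℝ) : Real.exp x ≤ x + Real.exp (x ^ 2) := by
  rcases le_or_gt |x| 1 with h | h
  · have h1 := (abs_le.1 (Real.abs_exp_sub_one_sub_id_le h)).2
    have h2 := Real.add_one_le_exp (x ^ 2)
    linarith
  · rcases lt_abs.1 h with h | h
    · have : Real.exp x ≤ Real.exp (x ^ 2) := Real.exp_le_exp.2 (by nlinarith)
      linarith
    · have h1 : Real.exp x ≤ 1 := Real.exp_le_one_iff.2 (by linarith)
      have h2 := Real.add_one_le_exp (x ^ 2)
      nlinarith

/-- Layer-cake bound for the exponential square moment of a law with subgaussian tails. -/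
lemma integrable_exp_sq_of_tail {Q : ℝ} (hQ : 0 < Q) (μ : Measure ℝ) [IsProbabilityMeasure μ]
    (htail : ∀ t : ℝ, 0 < t → μ.real {x | t < |x|} ≤ 1 / Q * Real.exp (-Q * t ^ 2)) :
    Integrable (fun x => Real.exp (Q / 2 * x ^ 2)) μ ∧
      ∫ x, Real.exp (Q / 2 * x ^ 2) ∂μ ≤ 1 + 1 / Q := by
  have hnn : ∀ x : ℝ, 0 ≤ Real.exp (Q / 2 * x ^ 2) - 1 := fun x => by
    have := Real.add_one_le_exp (Q / 2 * x ^ 2)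
    have : 0 ≤ Q / 2 * x ^ 2 := by positivity
    linarith
  have hmeas : Measurable fun x : ℝ => Real.exp (Q / 2 * x ^ 2) - 1 := by fun_prop
  have key : ∫⁻ x, ENNReal.ofReal (Real.exp (Q / 2 * x ^ 2) - 1) ∂μ ≤ ENNReal.ofReal (1 / Q) := by
    rw [lintegral_eq_lintegral_meas_lt μ (Filter.Eventually.of_forall hnn) hmeas.aemeasurable]
    have hb : ∀ t ∈ Set.Ioi (0 : ℝ), μ {x | t < Real.exp (Q / 2 * x ^ 2) - 1} ≤
        ENNReal.ofReal (1 / Q * (1 / (1 + t) ^ 2)) := by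
      intro t ht
      have ht : 0 < t := ht
      have hl : 0 < Real.log (1 + t) := Real.log_pos (by linarith)
      have hs : 0 < √(2 / Q * Real.log (1 + t)) := Real.sqrt_pos.2 (by positivity)
      have h1 := htail _ hs
      have hsub : {x : ℝ | t < Real.exp (Q / 2 * x ^ 2) - 1} ⊆
          {x | √(2 / Q * Real.log (1 + t)) < |x|} := by
        intro x hx
        have hx : t < Real.exp (Q / 2 * x ^ 2) - 1 := hx
        have h2 : Real.log (1 + t) < Q / 2 * x ^ 2 := by
          rw [Real.log_lt_iff_lt_exp (by linarith)]; linarith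
        change √(2 / Q * Real.log (1 + t)) < |x|
        have h3 : 0 < |x| := by
          rw [abs_pos]; rintro rfl; simp at h2; linarith
        rw [Real.sqrt_lt' h3, sq_abs]
        rw [div_mul_eq_mul_div, div_lt_iff₀ hQ]; linarith
      refine (measure_mono hsub).trans ?_
      rw [← ENNReal.ofReal_toReal (measure_ne_top μ _)]
      apply ENNReal.ofReal_le_ofReal
      refine h1.trans (le_of_eq ?_)
      congr 1
      rw [Real.sq_sqrt (by positivity)]
      have : -Q * (2 / Q * Real.log (1 + t)) = Real.log (1 + t) * (-2 : ℝ) := by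
        field_simp
      rw [this, ← Real.rpow_def_of_pos (by linarith), Real.rpow_neg (by linarith)]
      norm_num
    refine (setLIntegral_mono' measurableSet_Ioi hb).trans ?_
    have hd : ∀ x ∈ Set.Ioi (0 : ℝ),
        HasDerivAt (fun t : ℝ => -(1 / Q) * (1 / (1 + t))) (1 / Q * (1 / (1 + x) ^ 2)) x := by
      intro x hx
      have hx : 0 < x := hx
      have h1 : HasDerivAt (fun t : ℝ => 1 + t) 1 x := by simpa using (hasDerivAt_id x).const_add 1
      have h2 := (h1.fun_inv (by positivity)).const_mul (-(1 / Q))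
      simp only [one_div] at h2 ⊢
      have h3 : -Q⁻¹ * (-1 / (1 + x) ^ 2) = Q⁻¹ * ((1 + x) ^ 2)⁻¹ := by ring
      rw [h3] at h2
      exact h2
    have hc : ContinuousWithinAt (fun t : ℝ => -(1 / Q) * (1 / (1 + t))) (Set.Ici 0) 0 := by
      apply ContinuousAt.continuousWithinAt
      fun_prop (disch := norm_num)
    have htt : Filter.Tendsto (fun t : ℝ => -(1 / Q) * (1 / (1 + t))) Filter.atTop (nhds 0) := by
      have : Filter.Tendsto (fun t : ℝ => (1 + t)⁻¹) Filter.atTop (nhds 0) :=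
        tendsto_inv_atTop_zero.comp (Filter.tendsto_atTop_add_const_left _ _ Filter.tendsto_id)
      simpa using this.const_mul (-(1 / Q))
    have hpos : ∀ x ∈ Set.Ioi (0 : ℝ), 0 ≤ 1 / Q * (1 / (1 + x) ^ 2) := fun x _ => by positivity
    have hint := integrableOn_Ioi_deriv_of_nonneg hc hd hpos htt
    have hval := integral_Ioi_of_hasDerivAt_of_tendsto hc hd hint htt
    rw [← ofReal_integral_eq_lintegral_ofReal hint
      ((ae_restrict_iff' measurableSet_Ioi).2 (Filter.Eventually.of_forall hpos)), hval]
    apply ENNReal.ofReal_le_ofReal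
    simp
  have hint : Integrable (fun x => Real.exp (Q / 2 * x ^ 2) - 1) μ := by
    refine ⟨hmeas.aestronglyMeasurable, ?_⟩
    rw [hasFiniteIntegral_iff_ofReal (Filter.Eventually.of_forall hnn)]
    exact key.trans_lt ENNReal.ofReal_lt_top
  have hint2 : Integrable (fun x => Real.exp (Q / 2 * x ^ 2)) μ := by
    have h : Integrable (fun x => Real.exp (Q / 2 * x ^ 2) - 1 + 1) μ :=
      hint.add (integrable_const (1 : ℝ))
    simpa using h
  refine ⟨hint2, ?_⟩
  have h3 : ∫ x, (Real.exp (Q / 2 * x ^ 2) - 1) ∂μ ≤ 1 / Q := by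
    rw [integral_eq_lintegral_of_nonneg_ae (Filter.Eventually.of_forall hnn)
      hmeas.aestronglyMeasurable]
    exact ENNReal.toReal_le_of_le_ofReal (by positivity) key
  rw [integral_sub hint2 (integrable_const _)] at h3
  simp at h3 ⊢
  linarith

/-- For `t² ≤ a` the centred moment generating function is compared with a power of the
exponential square moment; for larger `t` completing the square is enough. -/
lemma mgf_le_of_exp_sq {a m : ℝ} (ha : 0 < a) (μ : Measure ℝ) [IsProbabilityMeasure μ]
    (hmean : ∫ x, x ∂μ = 0) (hid : Integrable (fun x : ℝ => x) μ)
    (hint : Integrable (fun x => Real.exp (a * x ^ 2)) μ)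
    (hm : ∫ x, Real.exp (a * x ^ 2) ∂μ ≤ m) (t : ℝ) :
    Integrable (fun x => Real.exp (t * x)) μ ∧
      ∫ x, Real.exp (t * x) ∂μ ≤ Real.exp ((1 / (4 * a) + Real.log m / a) * t ^ 2) := by
  have hm1 : 1 ≤ m := by
    refine le_trans ?_ hm
    have : ∫ x : ℝ, (1 : ℝ) ∂μ ≤ ∫ x, Real.exp (a * x ^ 2) ∂μ :=
      integral_mono (integrable_const _) hint fun x => Real.one_le_exp (by positivity)
    simpa using this
  have hlog : 0 ≤ Real.log m := Real.log_nonneg hm1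
  have hpt : ∀ x : ℝ, Real.exp (t * x) ≤ Real.exp (t ^ 2 / (4 * a)) * Real.exp (a * x ^ 2) := by
    intro x
    rw [← Real.exp_add]
    apply Real.exp_le_exp.2
    have h : t ^ 2 / (4 * a) + a * x ^ 2 - t * x = (t - 2 * a * x) ^ 2 / (4 * a) := by
      field_simp; ring
    have : 0 ≤ (t - 2 * a * x) ^ 2 / (4 * a) := by positivity
    linarith
  have hI : Integrable (fun x => Real.exp (t * x)) μ := by
    refine (hint.const_mul (Real.exp (t ^ 2 / (4 * a)))).mono' (by fun_prop)
      (Filter.Eventually.of_forall fun x => ?_)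
    rw [Real.norm_eq_abs, abs_of_pos (Real.exp_pos _)]
    exact hpt x
  refine ⟨hI, ?_⟩
  rcases le_or_gt (t ^ 2) a with h | h
  · set p := t ^ 2 / a with hp
    have hp0 : 0 ≤ p := by positivity
    have hp1 : p ≤ 1 := (div_le_one ha).2 h
    have hpt2 : ∀ x : ℝ, Real.exp (t * x) ≤
        t * x + m ^ p * (1 - p + p / m * Real.exp (a * x ^ 2)) := by
      intro x
      have h1 := exp_le_add_exp_sq (t * x)
      have h2 : Real.exp ((t * x) ^ 2) = m ^ p * (Real.exp (a * x ^ 2) / m) ^ p := by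
        rw [Real.div_rpow (Real.exp_pos _).le (by linarith), mul_div_cancel₀ _ (by positivity),
          ← Real.exp_mul]
        congr 1
        rw [hp]; field_simp
      have h3 := rpow_one_add_le_one_add_mul_self
        (s := Real.exp (a * x ^ 2) / m - 1) (by
          have : 0 < Real.exp (a * x ^ 2) / m := by positivity
          linarith) hp0 hp1
      rw [add_sub_cancel] at h3
      have h4 : Real.exp ((t * x) ^ 2) ≤ m ^ p * (1 - p + p / m * Real.exp (a * x ^ 2)) := by
        rw [h2]
        apply mul_le_mul_of_nonneg_left _ (by positivity)
        refine h3.trans (le_of_eq ?_)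
        ring
      linarith
    calc ∫ x, Real.exp (t * x) ∂μ
        ≤ ∫ x, (t * x + m ^ p * (1 - p + p / m * Real.exp (a * x ^ 2))) ∂μ :=
          integral_mono hI ((hid.const_mul t).add
            (((integrable_const _).add (hint.const_mul _)).const_mul _)) hpt2
      _ = m ^ p * (1 - p + p / m * ∫ x, Real.exp (a * x ^ 2) ∂μ) := by
          have h5 : Integrable (fun x => 1 - p + p / m * Real.exp (a * x ^ 2)) μ :=
            (integrable_const _).add (hint.const_mul _)
          rw [integral_add (hid.const_mul t) (h5.const_mul _), integral_const_mul,
            integral_const_mul, integral_add (integrable_const _) (hint.const_mul _),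
            integral_const_mul, hmean]
          simp
      _ ≤ m ^ p * 1 := by
          apply mul_le_mul_of_nonneg_left _ (by positivity)
          have : p / m * ∫ x, Real.exp (a * x ^ 2) ∂μ ≤ p / m * m :=
            mul_le_mul_of_nonneg_left hm (by positivity)
          rw [div_mul_cancel₀ _ (by positivity)] at this
          linarith
      _ ≤ _ := by
          rw [mul_one, Real.rpow_def_of_pos (by linarith)]
          apply Real.exp_le_exp.2
          have : 0 ≤ 1 / (4 * a) * t ^ 2 := by positivity
          have h2 : Real.log m * p = Real.log m / a * t ^ 2 := by rw [hp]; ring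
          rw [add_mul]; linarith
  · calc ∫ x, Real.exp (t * x) ∂μ
        ≤ ∫ x, Real.exp (t ^ 2 / (4 * a)) * Real.exp (a * x ^ 2) ∂μ :=
          integral_mono hI (hint.const_mul _) hpt
      _ ≤ Real.exp (t ^ 2 / (4 * a)) * m := by
          rw [integral_const_mul]
          exact mul_le_mul_of_nonneg_left hm (Real.exp_pos _).le
      _ ≤ _ := by
          nth_rewrite 1 [← Real.exp_log (show 0 < m by linarith)]
          rw [← Real.exp_add]
          apply Real.exp_le_exp.2
          have h1 : t ^ 2 / (4 * a) = 1 / (4 * a) * t ^ 2 := by ring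
          have h2 : Real.log m ≤ Real.log m / a * t ^ 2 := by
            rw [div_mul_eq_mul_div, le_div_iff₀ ha]
            exact mul_le_mul_of_nonneg_left h.le hlog
          rw [add_mul]; linarith

/-- The symmetrisation `x - y` has second moment `2`. Values below `1 / 2` contribute little to it,
and the fourth moment controls the contribution of values above `K`. -/
lemma spread_of_moments {F K : ℝ} (hK : 1 ≤ K) (hFK : F ≤ K ^ 2) (μ : Measure ℝ)
    [IsProbabilityMeasure μ] (hmean : ∫ x, x ∂μ = 0) (hsq : ∫ x, x ^ 2 ∂μ = 1)
    (hid : Integrable (fun x : ℝ => x) μ) (h2 : Integrable (fun x : ℝ => x ^ 2) μ)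
    (h4 : Integrable (fun x : ℝ => x ^ 4) μ) (hF : 16 * ∫ x, x ^ 4 ∂μ ≤ F) :
    3 / (4 * K ^ 2) ≤ (μ.prod μ).real {z | 1 / 2 ≤ |z.1 - z.2| ∧ |z.1 - z.2| ≤ K} := by
  set G : Set (ℝ × ℝ) := {z | 1 / 2 ≤ |z.1 - z.2| ∧ |z.1 - z.2| ≤ K} with hG
  have hGm : MeasurableSet G := by
    have hm : Measurable fun z : ℝ × ℝ => |z.1 - z.2| :=
      continuous_abs.measurable.comp (measurable_fst.sub measurable_snd)
    exact (measurableSet_le measurable_const hm).inter (measurableSet_le hm measurable_const)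
  have e1 : Integrable (fun z : ℝ × ℝ => z.1 ^ 2) (μ.prod μ) := h2.comp_fst μ
  have e2 : Integrable (fun z : ℝ × ℝ => z.2 ^ 2) (μ.prod μ) := h2.comp_snd μ
  have e3 : Integrable (fun z : ℝ × ℝ => z.1 * z.2) (μ.prod μ) := hid.mul_prod hid
  have e4 : Integrable (fun z : ℝ × ℝ => z.1 ^ 4) (μ.prod μ) := h4.comp_fst μ
  have e5 : Integrable (fun z : ℝ × ℝ => z.2 ^ 4) (μ.prod μ) := h4.comp_snd μ
  have e12 : Integrable (fun z : ℝ × ℝ => z.1 ^ 2 + z.2 ^ 2) (μ.prod μ) := e1.add e2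
  have e45 : Integrable (fun z : ℝ × ℝ => z.1 ^ 4 + z.2 ^ 4) (μ.prod μ) := e4.add e5
  have eG : Integrable (fun z : ℝ × ℝ => G.indicator (fun _ => (1 : ℝ)) z) (μ.prod μ) :=
    (integrable_const _).indicator hGm
  have hv : ∫ z : ℝ × ℝ, (z.1 ^ 2 + z.2 ^ 2 - 2 * (z.1 * z.2)) ∂(μ.prod μ) = 2 := by
    rw [integral_sub e12 (e3.const_mul 2), integral_add e1 e2, integral_const_mul,
      integral_prod_mul (fun x : ℝ => x) (fun x : ℝ => x),
      integral_fun_fst (fun x : ℝ => x ^ 2), integral_fun_snd (fun x : ℝ => x ^ 2), hmean, hsq]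
    simp; norm_num
  have hK2 : 0 < K ^ 2 := by positivity
  have hpt : ∀ z : ℝ × ℝ, z.1 ^ 2 + z.2 ^ 2 - 2 * (z.1 * z.2) ≤
      1 / 4 + (K ^ 2 * G.indicator (fun _ => (1 : ℝ)) z + 8 / K ^ 2 * (z.1 ^ 4 + z.2 ^ 4)) := by
    intro z
    have hz : z.1 ^ 2 + z.2 ^ 2 - 2 * (z.1 * z.2) = |z.1 - z.2| ^ 2 := by rw [sq_abs]; ring
    have h8 : |z.1 - z.2| ^ 4 ≤ 8 * (z.1 ^ 4 + z.2 ^ 4) := by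
      have : |z.1 - z.2| ^ 4 = (z.1 - z.2) ^ 4 := by
        rw [show (4 : ℕ) = 2 * 2 from rfl, pow_mul, sq_abs, ← pow_mul]
      rw [this]
      nlinarith [sq_nonneg (z.1 ^ 2 - z.2 ^ 2), sq_nonneg (z.1 + z.2), sq_nonneg (z.1 - z.2),
        sq_nonneg ((z.1 + z.2) ^ 2), sq_nonneg (z.1 * (z.1 + z.2)), sq_nonneg (z.2 * (z.1 + z.2))]
    have hnn : 0 ≤ 8 / K ^ 2 * (z.1 ^ 4 + z.2 ^ 4) := by positivity
    rw [hz]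
    by_cases hzG : z ∈ G
    · rw [Set.indicator_of_mem hzG]
      have : |z.1 - z.2| ^ 2 ≤ K ^ 2 := by gcongr; exact hzG.2
      linarith
    · rw [Set.indicator_of_notMem hzG]
      rcases lt_or_ge |z.1 - z.2| (1 / 2) with h | h
      · have : |z.1 - z.2| ^ 2 ≤ (1 / 2) ^ 2 := by gcongr
        norm_num at this ⊢; linarith
      · have h' : K < |z.1 - z.2| := by
          by_contra hcon
          exact hzG ⟨h, not_lt.1 hcon⟩
        have h5 : K ^ 2 ≤ |z.1 - z.2| ^ 2 := by gcongr
        have h6 : |z.1 - z.2| ^ 2 ≤ 8 / K ^ 2 * (z.1 ^ 4 + z.2 ^ 4) := by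
          rw [div_mul_eq_mul_div, le_div_iff₀ hK2]
          refine le_trans ?_ h8
          nlinarith [sq_nonneg |z.1 - z.2|]
        linarith
  have hle := integral_mono ((e1.add e2).sub (e3.const_mul 2))
    ((integrable_const (1 / 4 : ℝ)).add ((eG.const_mul (K ^ 2)).add
      ((e4.add e5).const_mul (8 / K ^ 2)))) hpt
  have hR : ∫ z : ℝ × ℝ, (1 / 4 + (K ^ 2 * G.indicator (fun _ => (1 : ℝ)) z +
      8 / K ^ 2 * (z.1 ^ 4 + z.2 ^ 4))) ∂(μ.prod μ) =
      1 / 4 + (K ^ 2 * (μ.prod μ).real G + 8 / K ^ 2 * (2 * ∫ x, x ^ 4 ∂μ)) := by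
    have e6 : Integrable (fun z : ℝ × ℝ => K ^ 2 * G.indicator (fun _ => (1 : ℝ)) z +
        8 / K ^ 2 * (z.1 ^ 4 + z.2 ^ 4)) (μ.prod μ) :=
      (eG.const_mul (K ^ 2)).add (e45.const_mul (8 / K ^ 2))
    rw [integral_add (integrable_const _) e6, integral_add (eG.const_mul (K ^ 2))
      (e45.const_mul (8 / K ^ 2)), integral_const_mul, integral_const_mul,
      integral_add e4 e5, integral_indicator_const _ hGm,
      integral_fun_fst (fun x : ℝ => x ^ 4), integral_fun_snd (fun x : ℝ => x ^ 4)]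
    simp
    left
    ring
  have hle2 : (2 : ℝ) ≤ 1 / 4 + (K ^ 2 * (μ.prod μ).real G + 8 / K ^ 2 * (2 * ∫ x, x ^ 4 ∂μ)) := by
    rw [← hR, ← hv]; exact hle
  have h9 : 8 / K ^ 2 * (2 * ∫ x, x ^ 4 ∂μ) ≤ 1 := by
    rw [div_mul_eq_mul_div, div_le_one hK2]; linarith
  rw [div_le_iff₀ (by positivity)]
  nlinarith

/-- A centred law of unit variance with subgaussian tails is a `SpreadLaw`, with constants depending
on the subgaussian moment only. -/
lemma exists_spreadLaw {Q : ℝ} (hQ : 0 < Q) : ∃ σ q₀ K₀ : ℝ, 0 < σ ∧ 0 < q₀ ∧ 1 ≤ K₀ ∧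
    ∀ (μ : Measure ℝ) [IsProbabilityMeasure μ], ∫ x, x ∂μ = 0 → ∫ x, x ^ 2 ∂μ = 1 →
      (∀ t : ℝ, 0 < t → μ.real {x | t < |x|} ≤ 1 / Q * Real.exp (-Q * t ^ 2)) →
      SpreadLaw σ q₀ K₀ μ := by
  set a := Q / 2 with ha
  have hapos : 0 < a := by positivity
  set m := 1 + 1 / Q with hm
  have hm1 : 1 ≤ m := by rw [hm]; have : 0 < 1 / Q := by positivity
                         linarith
  set K := max 1 (16 * (2 / a ^ 2 * m)) with hK
  have hK1 : 1 ≤ K := le_max_left _ _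
  refine ⟨1 / (4 * a) + Real.log m / a, 3 / (4 * K ^ 2), K, ?_, by positivity, hK1, ?_⟩
  · have := Real.log_nonneg hm1
    positivity
  intro μ _ hmean hsq htail
  obtain ⟨hint, hle⟩ := integrable_exp_sq_of_tail hQ μ htail
  have hdom : ∀ f : ℝ → ℝ, Continuous f → ∀ C : ℝ, (∀ x, |f x| ≤ C * Real.exp (a * x ^ 2)) →
      Integrable f μ := fun f hf C h =>
    (hint.const_mul C).mono' hf.aestronglyMeasurable (Filter.Eventually.of_forall h)
  have hexp1 : ∀ x : ℝ, 1 + a * x ^ 2 ≤ Real.exp (a * x ^ 2) := fun x => by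
    have := Real.add_one_le_exp (a * x ^ 2); linarith
  have h2pt : ∀ x : ℝ, |x ^ 2| ≤ 1 / a * Real.exp (a * x ^ 2) := fun x => by
    rw [abs_of_nonneg (sq_nonneg x), div_mul_eq_mul_div, le_div_iff₀ hapos]
    linarith [hexp1 x]
  have h4pt : ∀ x : ℝ, x ^ 4 ≤ 2 / a ^ 2 * Real.exp (a * x ^ 2) := fun x => by
    rw [div_mul_eq_mul_div, le_div_iff₀ (by positivity)]
    have := Real.quadratic_le_exp_of_nonneg (show 0 ≤ a * x ^ 2 by positivity)
    have h0 : 0 ≤ a * x ^ 2 := by positivity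
    nlinarith
  have h4i : Integrable (fun x : ℝ => x ^ 4) μ := hdom _ (by fun_prop) (2 / a ^ 2) fun x => by
    rw [abs_of_nonneg (by positivity)]; exact h4pt x
  have h2i : Integrable (fun x : ℝ => x ^ 2) μ := hdom _ (by fun_prop) (1 / a) h2pt
  have hid : Integrable (fun x : ℝ => x) μ := hdom _ (by fun_prop) (1 + 1 / a) fun x => by
    have h1 : |x| ≤ 1 + x ^ 2 := by
      rw [← sq_abs]; nlinarith [sq_nonneg (|x| - 1), abs_nonneg x]
    have h2 := h2pt x
    rw [abs_of_nonneg (sq_nonneg x)] at h2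
    have h3 := Real.one_le_exp (show 0 ≤ a * x ^ 2 by positivity)
    rw [add_mul]; linarith
  have h4b : 16 * ∫ x, x ^ 4 ∂μ ≤ 16 * (2 / a ^ 2 * m) := by
    have : ∫ x, x ^ 4 ∂μ ≤ ∫ x, 2 / a ^ 2 * Real.exp (a * x ^ 2) ∂μ :=
      integral_mono h4i (hint.const_mul _) h4pt
    rw [integral_const_mul] at this
    have h5 : 2 / a ^ 2 * ∫ x, Real.exp (a * x ^ 2) ∂μ ≤ 2 / a ^ 2 * m :=
      mul_le_mul_of_nonneg_left hle (by positivity)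
    linarith
  have hmgf := mgf_le_of_exp_sq hapos μ hmean hid hint hle
  refine ⟨fun t => (hmgf t).1, fun t => (hmgf t).2, ?_⟩
  refine spread_of_moments hK1 ?_ μ hmean hsq hid h2i h4i h4b
  have h6 : 16 * (2 / a ^ 2 * m) ≤ K := le_max_right _ _
  nlinarith

/-! ### Small balls and cosine sums -/

/-- The modulus of a characteristic function is controlled by the symmetrised law. -/
lemma norm_charFun_le_exp (μ : Measure ℝ) [IsProbabilityMeasure μ] {G : Set (ℝ × ℝ)}
    (u : ℝ) :
    ‖charFun μ u‖ ≤ Real.exp (-(1 / 2) * ∫ z in G, (1 - Real.cos (u * (z.1 - z.2))) ∂(μ.prod μ)) := by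
  have hcosI : Integrable (fun z : ℝ × ℝ => Real.cos (u * (z.1 - z.2))) (μ.prod μ) :=
    Integrable.of_bound (by fun_prop) 1 (Filter.Eventually.of_forall fun z => by
      rw [Real.norm_eq_abs]; exact Real.abs_cos_le_one _)
  have h1 : ‖charFun μ u‖ ^ 2 = ∫ z : ℝ × ℝ, Real.cos (u * (z.1 - z.2)) ∂(μ.prod μ) := by
    have e : (‖charFun μ u‖ ^ 2 : ℂ) =
        ∫ z : ℝ × ℝ, Complex.exp (((u * (z.1 - z.2) : ℝ) : ℂ) * Complex.I) ∂(μ.prod μ) := by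
      rw [← Complex.mul_conj', ← charFun_neg, charFun_apply_real, charFun_apply_real,
        ← integral_prod_mul]
      congr 1
      ext z
      rw [← Complex.exp_add]
      congr 1
      push_cast; ring
    have e2 := congrArg Complex.re e
    have hI : Integrable (fun z : ℝ × ℝ => Complex.exp (((u * (z.1 - z.2) : ℝ) : ℂ) * Complex.I))
        (μ.prod μ) :=
      Integrable.of_bound (by fun_prop) 1 (Filter.Eventually.of_forall fun z => by
        rw [Complex.norm_exp_ofReal_mul_I])
    have e3 := integral_re (𝕜 := ℂ) hI
    simp only [RCLike.re_to_complex, Complex.exp_ofReal_mul_I_re] at e3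
    rw [e3, ← e2]
    norm_cast
  have h2 : ∫ z in G, (1 - Real.cos (u * (z.1 - z.2))) ∂(μ.prod μ) ≤
      1 - ‖charFun μ u‖ ^ 2 := by
    have : 1 - ‖charFun μ u‖ ^ 2 = ∫ z : ℝ × ℝ, (1 - Real.cos (u * (z.1 - z.2))) ∂(μ.prod μ) := by
      rw [integral_sub (integrable_const _) hcosI, h1]; simp
    rw [this]
    exact setIntegral_le_integral ((integrable_const _).sub hcosI)
      (Filter.Eventually.of_forall fun z => by
        have := Real.cos_le_one (u * (z.1 - z.2))
        simpa using this)
  have h3 : ‖charFun μ u‖ ^ 2 ≤ Real.exp (-(1 / 2) *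
      ∫ z in G, (1 - Real.cos (u * (z.1 - z.2))) ∂(μ.prod μ)) ^ 2 := by
    rw [← Real.exp_nat_mul]
    have := Real.add_one_le_exp (‖charFun μ u‖ ^ 2 - 1)
    refine (by linarith : ‖charFun μ u‖ ^ 2 ≤ Real.exp (‖charFun μ u‖ ^ 2 - 1)).trans ?_
    apply Real.exp_le_exp.2
    push_cast
    linarith
  exact le_of_sq_le_sq h3 (Real.exp_pos _).le

/-- A Gaussian average of the exponential represents `exp (-s y²)`. -/
lemma exp_neg_sq_eq_integral_gaussian {s : ℝ} (hs : 0 ≤ s) (y : ℝ) :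
    ((Real.exp (-s * y ^ 2) : ℝ) : ℂ) =
      ∫ θ : ℝ, Complex.exp (((θ * (√(2 * s) * y) : ℝ) : ℂ) * Complex.I) ∂(gaussianReal 0 1) := by
  have h := charFun_gaussianReal (μ := 0) (v := 1) (√(2 * s) * y)
  rw [charFun_apply_real] at h
  have h2 : (√(2 * s) * y) ^ 2 = 2 * s * y ^ 2 := by
    rw [mul_pow, Real.sq_sqrt (by positivity)]
  calc ((Real.exp (-s * y ^ 2) : ℝ) : ℂ) =
      Complex.exp (((√(2 * s) * y : ℝ) : ℂ) * ((0 : ℝ) : ℂ) * Complex.I -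
        ((1 : NNReal) : ℂ) * ((√(2 * s) * y : ℝ) : ℂ) ^ 2 / 2) := by
        rw [← Complex.ofReal_pow, h2, Complex.ofReal_exp]
        congr 1
        push_cast; ring
    _ = _ := by
        rw [← h]
        congr 1
        ext θ
        congr 1
        push_cast; ring

/-- The function `exp (-s y²)` is the characteristic function of a Gaussian, so its expectation at a
linear form is a Gaussian average of characteristic functions, which factor by independence. -/
lemma integral_exp_neg_sq_le_prod_charFun {ι : Type*} [Fintype ι] (μ : Measure ℝ)
    [IsProbabilityMeasure μ] (v : ι → ℝ) {s : ℝ} (hs : 0 ≤ s) (b : ℝ) :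
    ∫ x : ι → ℝ, Real.exp (-s * (∑ j, x j * v j - b) ^ 2) ∂(Measure.pi fun _ => μ) ≤
      ∫ θ : ℝ, ∏ j, ‖charFun μ (√(2 * s) * θ * v j)‖ ∂(gaussianReal 0 1) := by
  set P := Measure.pi fun _ : ι => μ with hP
  set γ := gaussianReal 0 1
  have hF : Integrable (fun z : (ι → ℝ) × ℝ =>
      Complex.exp (((z.2 * (√(2 * s) * (∑ j, z.1 j * v j - b)) : ℝ) : ℂ) * Complex.I))
      (P.prod γ) :=
    Integrable.of_bound (by fun_prop) 1 (Filter.Eventually.of_forall fun z => by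
      rw [Complex.norm_exp_ofReal_mul_I])
  have h1 : ((∫ x : ι → ℝ, Real.exp (-s * (∑ j, x j * v j - b) ^ 2) ∂P : ℝ) : ℂ) =
      ∫ θ : ℝ, ∫ x : ι → ℝ,
        Complex.exp (((θ * (√(2 * s) * (∑ j, x j * v j - b)) : ℝ) : ℂ) * Complex.I) ∂P ∂γ := by
    rw [← integral_complex_ofReal, ← integral_integral_swap hF]
    congr 1
    ext x
    exact exp_neg_sq_eq_integral_gaussian hs _
  have h2 : ∀ θ : ℝ, ‖∫ x : ι → ℝ,
      Complex.exp (((θ * (√(2 * s) * (∑ j, x j * v j - b)) : ℝ) : ℂ) * Complex.I) ∂P‖ =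
      ∏ j, ‖charFun μ (√(2 * s) * θ * v j)‖ := by
    intro θ
    have e : ∀ x : ι → ℝ,
        Complex.exp (((θ * (√(2 * s) * (∑ j, x j * v j - b)) : ℝ) : ℂ) * Complex.I) =
        Complex.exp (((-(θ * (√(2 * s) * b)) : ℝ) : ℂ) * Complex.I) *
          ∏ j, Complex.exp (((√(2 * s) * θ * v j : ℝ) : ℂ) * (x j : ℂ) * Complex.I) := by
      intro x
      rw [← Complex.exp_sum, ← Complex.exp_add, ← Finset.sum_mul, ← add_mul]
      congr 2
      push_cast
      rw [mul_sub, mul_sub, Finset.mul_sum, Finset.mul_sum, sub_eq_neg_add]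
      congr 1
      exact Finset.sum_congr rfl fun j _ => by ring
    simp_rw [e]
    rw [integral_const_mul, norm_mul, Complex.norm_exp_ofReal_mul_I, one_mul, hP,
      integral_fintype_prod_eq_prod
        (f := fun j (x : ℝ) => Complex.exp (((√(2 * s) * θ * v j : ℝ) : ℂ) * (x : ℂ) * Complex.I)),
      norm_prod]
    simp_rw [charFun_apply_real]
  have h0 : 0 ≤ ∫ x : ι → ℝ, Real.exp (-s * (∑ j, x j * v j - b) ^ 2) ∂P :=
    integral_nonneg fun x => (Real.exp_pos _).le
  calc ∫ x : ι → ℝ, Real.exp (-s * (∑ j, x j * v j - b) ^ 2) ∂P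
      = ‖((∫ x : ι → ℝ, Real.exp (-s * (∑ j, x j * v j - b) ^ 2) ∂P : ℝ) : ℂ)‖ := by
        rw [Complex.norm_real, Real.norm_eq_abs, abs_of_nonneg h0]
    _ ≤ _ := by
        rw [h1]
        refine (norm_integral_le_integral_norm _).trans (le_of_eq ?_)
        simp_rw [h2]

/-- Esseen-type bound: the concentration of `∑ x j * v j` at scale `s ^ (-1/2)` is at most the
worst Gaussian average of `exp (-c ∑ (1 - cos (t z v j)))` over the scales `z` that the symmetrised
entry law charges. Jensen's inequality moves the average over the law out of the exponential. -/
theorem integral_exp_neg_sq_le {ι : Type*} [Fintype ι] {σ q₀ K₀ : ℝ} (hq₀ : 0 < q₀)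
    {μ : Measure ℝ} [IsProbabilityMeasure μ] (hμ : SpreadLaw σ q₀ K₀ μ) (v : ι → ℝ) {s : ℝ}
    (hs : 0 ≤ s) (b : ℝ) {B : ℝ}
    (hB : ∀ z : ℝ, 1 / 2 ≤ |z| → |z| ≤ K₀ →
      ∫ θ : ℝ, Real.exp (-(q₀ / 2) * ∑ j, (1 - Real.cos (√(2 * s) * θ * v j * z)))
        ∂(gaussianReal 0 1) ≤ B) :
    ∫ x : ι → ℝ, Real.exp (-s * (∑ j, x j * v j - b) ^ 2) ∂(Measure.pi fun _ => μ) ≤ B := by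
  refine (integral_exp_neg_sq_le_prod_charFun μ v hs b).trans ?_
  set γ := gaussianReal 0 1
  set G : Set (ℝ × ℝ) := {z | 1 / 2 ≤ |z.1 - z.2| ∧ |z.1 - z.2| ≤ K₀} with hG
  have hGm : MeasurableSet G := by
    have hm : Measurable fun z : ℝ × ℝ => |z.1 - z.2| :=
      continuous_abs.measurable.comp (measurable_fst.sub measurable_snd)
    exact (measurableSet_le measurable_const hm).inter (measurableSet_le hm measurable_const)
  have hGq : q₀ ≤ (μ.prod μ).real G := hμ.spread
  have hG0 : (μ.prod μ) G ≠ 0 := by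
    intro h
    rw [measureReal_def, h] at hGq
    simp at hGq; linarith
  set ν := (μ.prod μ).restrict G with hν
  have : NeZero ν := ⟨by rw [hν]; exact fun h => hG0 (Measure.restrict_eq_zero.1 h)⟩
  have hm : ν.real Set.univ = (μ.prod μ).real G := by
    rw [hν, measureReal_restrict_apply_univ]
  have hm0 : 0 < ν.real Set.univ := by rw [hm]; linarith
  set f : ℝ → ℝ × ℝ → ℝ := fun θ z =>
    ∑ j, (1 - Real.cos (√(2 * s) * θ * v j * (z.1 - z.2))) with hf
  have hf0 : ∀ θ z, 0 ≤ f θ z := fun θ z => Finset.sum_nonneg fun j _ => by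
    have := Real.cos_le_one (√(2 * s) * θ * v j * (z.1 - z.2))
    linarith
  have hcosI : ∀ u : ℝ, Integrable (fun z : ℝ × ℝ => 1 - Real.cos (u * (z.1 - z.2))) ν :=
    fun u => (integrable_const _).sub (Integrable.of_bound (by fun_prop) 1
      (Filter.Eventually.of_forall fun z => by
        rw [Real.norm_eq_abs]; exact Real.abs_cos_le_one _))
  have hfI : ∀ θ, Integrable (f θ) ν := fun θ => integrable_finsetSum _ fun j _ => hcosI _
  have hexpI : ∀ c : ℝ, 0 ≤ c → ∀ θ, Integrable (fun z => Real.exp (-c * f θ z)) ν :=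
    fun c hc θ => Integrable.of_bound (by simp only [hf]; fun_prop) 1
      (Filter.Eventually.of_forall fun z => by
        rw [Real.norm_eq_abs, abs_of_pos (Real.exp_pos _)]
        apply Real.exp_le_one_iff.2
        have := mul_nonneg hc (hf0 θ z)
        linarith)
  have hpt : ∀ θ : ℝ, ∏ j, ‖charFun μ (√(2 * s) * θ * v j)‖ ≤
      ⨍ z, Real.exp (-(q₀ / 2) * f θ z) ∂ν := by
    intro θ
    have h1 : ∏ j, ‖charFun μ (√(2 * s) * θ * v j)‖ ≤ Real.exp (-(1 / 2) * ∫ z, f θ z ∂ν) := by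
      refine (Finset.prod_le_prod (fun j _ => norm_nonneg _)
        fun j _ => norm_charFun_le_exp μ (G := G) _).trans (le_of_eq ?_)
      rw [← Real.exp_sum, ← Finset.mul_sum, hf, integral_finsetSum _ fun j _ => hcosI _]
    have h2 : -(1 / 2) * ∫ z, f θ z ∂ν = ⨍ z, -(1 / 2 * ν.real Set.univ) * f θ z ∂ν := by
      rw [average_eq, integral_const_mul, smul_eq_mul]
      field_simp
    rw [h2] at h1
    refine h1.trans ?_
    have h3 := convexOn_exp.map_average_le (μ := ν)
      (f := fun z => -(1 / 2 * ν.real Set.univ) * f θ z) Real.continuous_exp.continuousOn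
      isClosed_univ (Filter.Eventually.of_forall fun _ => Set.mem_univ _)
      ((hfI θ).const_mul _) (hexpI _ (by positivity) θ)
    refine h3.trans ?_
    rw [average_eq, average_eq]
    apply smul_le_smul_of_nonneg_left _ (by positivity)
    apply integral_mono (hexpI _ (by positivity) θ) (hexpI _ (by positivity) θ)
    intro z
    apply Real.exp_le_exp.2
    have := mul_le_mul_of_nonneg_right (hm ▸ hGq : q₀ ≤ ν.real Set.univ) (hf0 θ z)
    nlinarith
  have hjoint : Integrable (fun p : ℝ × (ℝ × ℝ) => Real.exp (-(q₀ / 2) * f p.1 p.2)) (γ.prod ν) :=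
    Integrable.of_bound (by simp only [hf]; fun_prop) 1
      (Filter.Eventually.of_forall fun p => by
        rw [Real.norm_eq_abs, abs_of_pos (Real.exp_pos _)]
        apply Real.exp_le_one_iff.2
        have := mul_nonneg hq₀.le (hf0 p.1 p.2)
        linarith)
  calc ∫ θ, ∏ j, ‖charFun μ (√(2 * s) * θ * v j)‖ ∂γ
      ≤ ∫ θ, ⨍ z, Real.exp (-(q₀ / 2) * f θ z) ∂ν ∂γ := by
        apply integral_mono_of_nonneg
        · exact Filter.Eventually.of_forall fun θ => Finset.prod_nonneg fun j _ => norm_nonneg _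
        · simp_rw [average_eq]
          exact Integrable.smul (ν.real Set.univ)⁻¹ hjoint.integral_prod_left
        · exact Filter.Eventually.of_forall hpt
    _ = ⨍ z, ∫ θ, Real.exp (-(q₀ / 2) * f θ z) ∂γ ∂ν := by
        simp_rw [average_eq]
        rw [integral_smul, integral_integral_swap hjoint]
    _ ≤ B := by
        rw [average_eq, smul_eq_mul, inv_mul_le_iff₀ hm0]
        have h5 : ∀ᵐ z ∂ν, ∫ θ, Real.exp (-(q₀ / 2) * f θ z) ∂γ ≤ B := by
          rw [hν, ae_restrict_iff' hGm]
          exact Filter.Eventually.of_forall fun z hz => hB (z.1 - z.2) hz.1 hz.2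
        refine (integral_mono_ae hjoint.integral_prod_right (integrable_const B) h5).trans ?_
        rw [integral_const, smul_eq_mul]

/-! ### Anticoncentration of linear forms -/

lemma integral_exp_neg_mul_sq_gaussian {β : ℝ} (hβ : -(1 / 2) < β) :
    Integrable (fun θ : ℝ => Real.exp (-β * θ ^ 2)) (gaussianReal 0 1) ∧
      ∫ θ : ℝ, Real.exp (-β * θ ^ 2) ∂(gaussianReal 0 1) = 1 / √(1 + 2 * β) := by
  have e : ∀ x : ℝ, gaussianPDFReal 0 1 x • Real.exp (-β * x ^ 2) =
      (√(2 * Real.pi))⁻¹ * Real.exp (-(1 / 2 + β) * x ^ 2) := by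
    intro x
    rw [gaussianPDFReal, smul_eq_mul, mul_assoc, ← Real.exp_add]
    congr 2
    · simp
    · simp; ring
  have hval : ∫ θ : ℝ, Real.exp (-β * θ ^ 2) ∂(gaussianReal 0 1) = 1 / √(1 + 2 * β) := by
    rw [integral_gaussianReal_eq_integral_smul (by norm_num)]
    simp_rw [e]
    rw [integral_const_mul, integral_gaussian, ← Real.sqrt_inv, ← Real.sqrt_mul (by positivity),
      one_div √(1 + 2 * β), ← Real.sqrt_inv]
    congr 1
    have : (1 / 2 + β) ≠ 0 := by linarith
    have : 1 + 2 * β ≠ 0 := by linarith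
    have := Real.pi_ne_zero
    field_simp
  refine ⟨?_, hval⟩
  by_contra h
  rw [integral_undef h] at hval
  have : 0 < 1 / √(1 + 2 * β) := by
    have : 0 < √(1 + 2 * β) := Real.sqrt_pos.2 (by linarith)
    positivity
  linarith

lemma exp_neg_sum_one_sub_cos_le_one {ι : Type*} (A : Finset ι) {c : ℝ} (hc : 0 ≤ c) (u : ι → ℝ) :
    Real.exp (-c * ∑ j ∈ A, (1 - Real.cos (u j))) ≤ 1 := by
  apply Real.exp_le_one_iff.2
  have : 0 ≤ ∑ j ∈ A, (1 - Real.cos (u j)) := Finset.sum_nonneg fun j _ => by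
    have := Real.cos_le_one (u j); linarith
  have := mul_nonneg hc this
  linarith

lemma integrable_exp_neg_sum_one_sub_cos {ι : Type*} [Fintype ι] {c : ℝ} (hc : 0 ≤ c) (u : ι → ℝ) :
    Integrable (fun θ : ℝ => Real.exp (-c * ∑ j, (1 - Real.cos (θ * u j)))) (gaussianReal 0 1) :=
  Integrable.of_bound (by fun_prop) 1 (Filter.Eventually.of_forall fun θ => by
    rw [Real.norm_eq_abs, abs_of_pos (Real.exp_pos _)]
    exact exp_neg_sum_one_sub_cos_le_one _ hc _)

/-- Linear forms with coefficient vector of norm at least one are uniformly not concentrated at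
a point. -/
lemma exists_anticoncentration {q₀ K₀ : ℝ} (hq₀ : 0 < q₀) (hK₀ : 1 ≤ K₀) :
    ∃ c : ℝ, 0 < c ∧ c ≤ 1 ∧ ∀ (σ : ℝ) (μ : Measure ℝ) [IsProbabilityMeasure μ],
      SpreadLaw σ q₀ K₀ μ →
      ∀ (ι : Type) [Fintype ι] (v : ι → ℝ), 1 ≤ ∑ j, v j ^ 2 → ∀ s : ℝ, 1 ≤ s → ∀ b : ℝ,
        ∫ x : ι → ℝ, Real.exp (-s * (∑ j, x j * v j - b) ^ 2) ∂(Measure.pi fun _ => μ) ≤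
          Real.exp (-c) := by
  set γ := gaussianReal 0 1 with hγ
  -- With this `s₀` and a coefficient vector of norm one, all the arguments of the cosine that occur
  -- for `|θ| ≤ 1` lie in `[-π, π]`, where `1 - cos` is bounded below by a multiple of the square.
  set s₀ := 1 / K₀ ^ 2 with hs₀
  have hs₀pos : 0 < s₀ := by positivity
  have hs₀1 : s₀ ≤ 1 := by
    rw [hs₀, div_le_one (by positivity)]; nlinarith
  set β := q₀ * s₀ / (2 * Real.pi ^ 2) with hβ
  have hβpos : 0 < β := by have := Real.pi_pos; positivity
  set I : Set ℝ := Set.Icc (1 / 2) 1 with hI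
  have hIm : MeasurableSet I := measurableSet_Icc
  have hm : 0 < γ.real I := by
    rw [measureReal_def, ENNReal.toReal_pos_iff]
    refine ⟨pos_iff_ne_zero.2 fun h => ?_, measure_lt_top _ _⟩
    have := gaussianReal_absolutelyContinuous' 0 (v := 1) (by norm_num) h
    rw [hI, Real.volume_Icc] at this
    norm_num at this
  have hm1 : γ.real I ≤ 1 := measureReal_le_one
  have hexp : Real.exp (-(β / 4)) < 1 := Real.exp_lt_one_iff.2 (by linarith)
  refine ⟨(1 - Real.exp (-(β / 4))) * γ.real I, by nlinarith, ?_, ?_⟩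
  · have := Real.exp_pos (-(β / 4)); nlinarith
  intro σ μ _ hμ ι _ v hv s hs b
  -- Rescaling to norm one, and decreasing `s` to `s₀`, only increases the integral.
  set w := √(∑ j, v j ^ 2) with hw
  have hw1 : 1 ≤ w := Real.one_le_sqrt.2 hv
  have hw2 : w ^ 2 = ∑ j, v j ^ 2 := Real.sq_sqrt (by linarith)
  have hunit : ∑ j, (v j / w) ^ 2 = 1 := by
    simp_rw [div_pow]
    rw [← Finset.sum_div, hw2, div_self (by linarith)]
  have key : ∫ x : ι → ℝ, Real.exp (-s₀ * (∑ j, x j * (v j / w) - b / w) ^ 2)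
      ∂(Measure.pi fun _ => μ) ≤ Real.exp (-((1 - Real.exp (-(β / 4))) * γ.real I)) := by
    apply integral_exp_neg_sq_le hq₀ hμ _ hs₀pos.le
    intro z hz1 hz2
    have hpt : ∀ θ : ℝ, Real.exp (-(q₀ / 2) * ∑ j,
        (1 - Real.cos (√(2 * s₀) * θ * (v j / w) * z))) ≤
        1 - (1 - Real.exp (-(β / 4))) * I.indicator (fun _ => (1 : ℝ)) θ := by
      intro θ
      by_cases hθ : θ ∈ I
      · rw [Set.indicator_of_mem hθ]
        have hθ1 : |θ| ≤ 1 := by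
          rw [abs_le]; constructor <;> linarith [hθ.1, hθ.2]
        have hsum : β / 2 * (1 / q₀) ≤
            ∑ j, (1 - Real.cos (√(2 * s₀) * θ * (v j / w) * z)) := by
          have h1 : ∀ j, 2 / Real.pi ^ 2 * ((2 * s₀ * θ ^ 2 * z ^ 2) * (v j / w) ^ 2) ≤
              1 - Real.cos (√(2 * s₀) * θ * (v j / w) * z) := by
            intro j
            have hvj : |v j / w| ≤ 1 := by
              rw [← sq_le_one_iff_abs_le_one, ← hunit]
              exact Finset.single_le_sum (f := fun j => (v j / w) ^ 2)
                (fun j _ => sq_nonneg _) (Finset.mem_univ j)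
            have hb : |√(2 * s₀) * θ * (v j / w) * z| ≤ Real.pi := by
              rw [abs_mul, abs_mul, abs_mul, abs_of_nonneg (Real.sqrt_nonneg _)]
              have e1 : √(2 * s₀) * K₀ ≤ Real.pi := by
                have : √(2 * s₀) * K₀ = √2 := by
                  rw [Real.sqrt_mul (by norm_num), hs₀, Real.sqrt_div (by norm_num),
                    Real.sqrt_sq (by linarith), Real.sqrt_one]
                  field_simp
                rw [this]
                have := Real.pi_gt_three
                have : √2 ≤ 3 := by rw [Real.sqrt_le_left (by norm_num)]; norm_num
                linarith
              calc √(2 * s₀) * |θ| * |v j / w| * |z| ≤ √(2 * s₀) * 1 * 1 * K₀ := by gcongr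
                _ ≤ Real.pi := by linarith
            have := Real.cos_le_one_sub_mul_cos_sq hb
            have e2 : (√(2 * s₀) * θ * (v j / w) * z) ^ 2 =
                (2 * s₀ * θ ^ 2 * z ^ 2) * (v j / w) ^ 2 := by
              rw [mul_pow, mul_pow, mul_pow, Real.sq_sqrt (by positivity)]; ring
            rw [e2] at this
            linarith
          refine le_trans ?_ (Finset.sum_le_sum fun j _ => h1 j)
          rw [← Finset.mul_sum, ← Finset.mul_sum, hunit, mul_one]
          have hθ2 : 1 / 4 ≤ θ ^ 2 := by nlinarith [hθ.1]
          have hz3 : 1 / 4 ≤ z ^ 2 := by rw [← sq_abs]; nlinarith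
          have : β / 2 * (1 / q₀) = 2 / Real.pi ^ 2 * (2 * s₀ * (1 / 4) * (1 / 4)) := by
            rw [hβ]; field_simp; norm_num
          rw [this]
          gcongr
        have : Real.exp (-(q₀ / 2) * ∑ j, (1 - Real.cos (√(2 * s₀) * θ * (v j / w) * z))) ≤
            Real.exp (-(β / 4)) := by
          apply Real.exp_le_exp.2
          have h3 := mul_le_mul_of_nonneg_left hsum (show 0 ≤ q₀ / 2 by positivity)
          have h4 : q₀ / 2 * (β / 2 * (1 / q₀)) = β / 4 := by field_simp; norm_num
          linarith
        linarith
      · rw [Set.indicator_of_notMem hθ, mul_zero, sub_zero]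
        exact exp_neg_sum_one_sub_cos_le_one _ (by positivity) _
    have hint : Integrable (fun θ : ℝ => Real.exp (-(q₀ / 2) * ∑ j,
        (1 - Real.cos (√(2 * s₀) * θ * (v j / w) * z)))) γ := by
      have := integrable_exp_neg_sum_one_sub_cos (c := q₀ / 2) (by positivity)
        (fun j => √(2 * s₀) * (v j / w) * z)
      refine this.congr (Filter.Eventually.of_forall fun θ => ?_)
      simp only
      congr 2
      refine Finset.sum_congr rfl fun j _ => ?_
      congr 2
      ring
    have hI2 : Integrable (fun θ : ℝ => I.indicator (fun _ => (1 : ℝ)) θ) γ :=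
      (integrable_const _).indicator hIm
    refine (integral_mono hint ((integrable_const _).sub (hI2.const_mul _)) hpt).trans ?_
    have : ∫ θ : ℝ, (1 - (1 - Real.exp (-(β / 4))) * I.indicator (fun _ => (1 : ℝ)) θ) ∂γ =
        1 - (1 - Real.exp (-(β / 4))) * γ.real I := by
      rw [integral_sub (integrable_const _) (hI2.const_mul _), integral_const_mul,
        integral_indicator_const _ hIm]
      simp
    refine this.le.trans ?_
    have := Real.add_one_le_exp (-((1 - Real.exp (-(β / 4))) * γ.real I))
    linarith
  refine le_trans ?_ key
  apply integral_mono_of_nonneg (Filter.Eventually.of_forall fun x => (Real.exp_pos _).le)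
  · exact Integrable.of_bound (by
      apply Continuous.aestronglyMeasurable; fun_prop) 1 (Filter.Eventually.of_forall fun x => by
      rw [Real.norm_eq_abs, abs_of_pos (Real.exp_pos _)]
      apply Real.exp_le_one_iff.2
      have := mul_nonneg hs₀pos.le (sq_nonneg (∑ j, x j * (v j / w) - b / w))
      linarith)
  · refine Filter.Eventually.of_forall fun x => ?_
    apply Real.exp_le_exp.2
    have e : ∑ j, x j * (v j / w) - b / w = (∑ j, x j * v j - b) / w := by
      rw [sub_div, Finset.sum_div]
      congr 1
      exact Finset.sum_congr rfl fun j _ => by ring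
    rw [e, div_pow]
    have h5 : (∑ j, x j * v j - b) ^ 2 / w ^ 2 ≤ (∑ j, x j * v j - b) ^ 2 :=
      div_le_self (sq_nonneg _) (by nlinarith)
    have h6 : 0 ≤ (∑ j, x j * v j - b) ^ 2 / w ^ 2 := by positivity
    nlinarith [sq_nonneg (∑ j, x j * v j - b)]

/-- Small-ball estimate for a coefficient vector without arithmetic structure up to scale `D`.
Below `θ₁` the coordinates in `A` do not wrap around the circle and give Gaussian decay; between
`θ₁` and `D` the coordinates in `B` stay away from the integers. -/
lemma small_ball_of_unstructured {ι : Type*} [Fintype ι] {σ q₀ K₀ : ℝ} (hq₀ : 0 < q₀)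
    {μ : Measure ℝ} [IsProbabilityMeasure μ] (hμ : SpreadLaw σ q₀ K₀ μ) (v : ι → ℝ)
    (A B : Finset ι) {θ₁ D ρ H s R : ℝ} (hθ₁ : 0 < θ₁) (hρ : 0 < ρ) (hs : 0 < s) (hR : 0 < R)
    (hA : ∀ j ∈ A, |v j| ≤ 1 / (2 * θ₁)) (hAρ : ρ ^ 2 ≤ ∑ j ∈ A, v j ^ 2)
    (hB : ∀ θ : ℝ, θ₁ ≤ θ → θ ≤ D → H ≤ ∑ j ∈ B, (1 - Real.cos (2 * Real.pi * θ * v j)))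
    (hsR : √(2 * s) * R * K₀ ≤ 2 * Real.pi * D) (b : ℝ) :
    ∫ x : ι → ℝ, Real.exp (-s * (∑ j, x j * v j - b) ^ 2) ∂(Measure.pi fun _ => μ) ≤
      Real.pi / (ρ * √(q₀ * s)) + Real.exp (-(q₀ * H / 2)) + √2 * Real.exp (-(R ^ 2 / 4)) := by
  apply integral_exp_neg_sq_le hq₀ hμ _ hs.le
  intro z hz1 hz2
  have hpi := Real.pi_pos
  set β := q₀ * s * ρ ^ 2 / (2 * Real.pi ^ 2) with hβ
  have hβpos : 0 < β := by positivity
  have hsub : ∀ (S : Finset ι) (u : ι → ℝ),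
      ∑ j ∈ S, (1 - Real.cos (u j)) ≤ ∑ j, (1 - Real.cos (u j)) := fun S u =>
    Finset.sum_le_univ_sum_of_nonneg fun j => by have := Real.cos_le_one (u j); linarith
  have hpt : ∀ θ : ℝ, Real.exp (-(q₀ / 2) * ∑ j, (1 - Real.cos (√(2 * s) * θ * v j * z))) ≤
      Real.exp (-β * θ ^ 2) + Real.exp (-(q₀ * H / 2)) +
        Real.exp (-(R ^ 2 / 4)) * Real.exp (-(-(1 / 4)) * θ ^ 2) := by
    intro θ
    have p1 := Real.exp_pos (-β * θ ^ 2)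
    have p2 := Real.exp_pos (-(q₀ * H / 2))
    have p3 : 0 < Real.exp (-(R ^ 2 / 4)) * Real.exp (-(-(1 / 4)) * θ ^ 2) := by positivity
    -- Large `θ` are paid for by the Gaussian tail, the middle range by `B` and the small ones by
    -- `A`.
    rcases lt_or_ge R |θ| with hθ | hθ
    · have h1 : 1 ≤ Real.exp (-(R ^ 2 / 4)) * Real.exp (-(-(1 / 4)) * θ ^ 2) := by
        rw [← Real.exp_add]
        apply Real.one_le_exp
        have : R ^ 2 ≤ θ ^ 2 := by rw [← sq_abs θ]; gcongr
        linarith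
      have := exp_neg_sum_one_sub_cos_le_one Finset.univ (c := q₀ / 2) (by positivity)
        (fun j => √(2 * s) * θ * v j * z)
      linarith
    · set t := √(2 * s) * |θ| * |z| / (2 * Real.pi) with ht
      have htD : t ≤ D := by
        rw [ht, div_le_iff₀ (by positivity)]
        calc √(2 * s) * |θ| * |z| ≤ √(2 * s) * R * K₀ := by gcongr
          _ ≤ D * (2 * Real.pi) := by linarith
      have hcos : ∀ j, Real.cos (√(2 * s) * θ * v j * z) = Real.cos (2 * Real.pi * t * v j) := by
        intro j
        have e : 2 * Real.pi * t * v j = √(2 * s) * |θ * z| * v j := by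
          rw [ht, abs_mul]; field_simp
        rw [e]
        rcases abs_choice (θ * z) with h | h <;> rw [h]
        · congr 1; ring
        · rw [← Real.cos_neg]; congr 1; ring
      simp_rw [hcos]
      rcases le_or_gt θ₁ t with h1 | h1
      · have h2 := hB t h1 htD
        have h3 := h2.trans (hsub B fun j => 2 * Real.pi * t * v j)
        have : Real.exp (-(q₀ / 2) * ∑ j, (1 - Real.cos (2 * Real.pi * t * v j))) ≤
            Real.exp (-(q₀ * H / 2)) := by
          apply Real.exp_le_exp.2
          have := mul_le_mul_of_nonneg_left h3 (show 0 ≤ q₀ / 2 by positivity)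
          linarith
        linarith
      · have h2 : ∀ j ∈ A, 8 * t ^ 2 * v j ^ 2 ≤ 1 - Real.cos (2 * Real.pi * t * v j) := by
          intro j hj
          have ht0 : 0 ≤ t := by positivity
          have hb : |2 * Real.pi * t * v j| ≤ Real.pi := by
            rw [abs_mul, abs_of_nonneg (by positivity)]
            calc 2 * Real.pi * t * |v j| ≤ 2 * Real.pi * θ₁ * (1 / (2 * θ₁)) := by
                  gcongr; exact hA j hj
              _ = Real.pi := by field_simp
          have := Real.cos_le_one_sub_mul_cos_sq hb
          have e : 2 / Real.pi ^ 2 * (2 * Real.pi * t * v j) ^ 2 = 8 * t ^ 2 * v j ^ 2 := by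
            field_simp; ring
          linarith
        have h3 : 8 * t ^ 2 * ρ ^ 2 ≤ ∑ j, (1 - Real.cos (2 * Real.pi * t * v j)) := by
          refine le_trans ?_ (hsub A _)
          refine le_trans ?_ (Finset.sum_le_sum h2)
          rw [← Finset.mul_sum]
          gcongr
        have h4 : β * θ ^ 2 ≤ q₀ / 2 * (8 * t ^ 2 * ρ ^ 2) := by
          have e : q₀ / 2 * (8 * t ^ 2 * ρ ^ 2) =
              2 * q₀ * s * ρ ^ 2 / Real.pi ^ 2 * θ ^ 2 * z ^ 2 := by
            rw [ht, div_pow, mul_pow, mul_pow, Real.sq_sqrt (by positivity), sq_abs, sq_abs]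
            field_simp; norm_num
          have hz3 : 1 / 4 ≤ z ^ 2 := by rw [← sq_abs]; nlinarith
          rw [e, hβ]
          calc q₀ * s * ρ ^ 2 / (2 * Real.pi ^ 2) * θ ^ 2 =
              2 * q₀ * s * ρ ^ 2 / Real.pi ^ 2 * θ ^ 2 * (1 / 4) := by ring
            _ ≤ _ := by gcongr
        have : Real.exp (-(q₀ / 2) * ∑ j, (1 - Real.cos (2 * Real.pi * t * v j))) ≤
            Real.exp (-β * θ ^ 2) := by
          apply Real.exp_le_exp.2
          have := mul_le_mul_of_nonneg_left h3 (show 0 ≤ q₀ / 2 by positivity)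
          linarith
        linarith
  obtain ⟨i1, v1⟩ := integral_exp_neg_mul_sq_gaussian (β := β) (by linarith)
  obtain ⟨i2, v2⟩ := integral_exp_neg_mul_sq_gaussian (β := -(1 / 4)) (by norm_num)
  have hint : Integrable (fun θ : ℝ => Real.exp (-(q₀ / 2) * ∑ j,
      (1 - Real.cos (√(2 * s) * θ * v j * z)))) (gaussianReal 0 1) := by
    have := integrable_exp_neg_sum_one_sub_cos (c := q₀ / 2) (by positivity)
      (fun j => √(2 * s) * v j * z)
    refine this.congr (Filter.Eventually.of_forall fun θ => ?_)
    simp only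
    congr 2
    refine Finset.sum_congr rfl fun j _ => ?_
    congr 2
    ring
  have i12 : Integrable (fun θ : ℝ => Real.exp (-β * θ ^ 2) + Real.exp (-(q₀ * H / 2)))
      (gaussianReal 0 1) := i1.add (integrable_const _)
  refine (integral_mono hint (i12.add (i2.const_mul _)) hpt).trans ?_
  have : ∫ θ : ℝ, (Real.exp (-β * θ ^ 2) + Real.exp (-(q₀ * H / 2)) +
        Real.exp (-(R ^ 2 / 4)) * Real.exp (-(-(1 / 4)) * θ ^ 2)) ∂(gaussianReal 0 1) =
      1 / √(1 + 2 * β) + Real.exp (-(q₀ * H / 2)) + Real.exp (-(R ^ 2 / 4)) * √2 := by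
    rw [integral_add i12 (i2.const_mul _), integral_add i1 (integrable_const _),
      integral_const_mul, v1, v2]
    have : 1 / √(1 + 2 * (-(1 / 4) : ℝ)) = √2 := by
      rw [one_div, ← Real.sqrt_inv]; norm_num
    rw [this]
    simp
  refine this.le.trans ?_
  have h5 : 1 / √(1 + 2 * β) ≤ Real.pi / (ρ * √(q₀ * s)) := by
    have e : Real.pi / (ρ * √(q₀ * s)) = 1 / √(2 * β) := by
      have : 2 * β = (ρ * √(q₀ * s) / Real.pi) ^ 2 := by
        rw [div_pow, mul_pow, Real.sq_sqrt (by positivity), hβ]; field_simp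
      rw [this, Real.sqrt_sq (by positivity), one_div, inv_div]
    rw [e]
    gcongr
    linarith
  linarith

/-! ### Quadratic forms in independent variables -/

open Matrix in
/-- Completing the square in the first variable. -/
lemma dotProduct_mulVec_cons {d : ℕ} (A : Matrix (Fin (d + 1)) (Fin (d + 1)) ℝ)
    (hA : A.IsHermitian) (ha : A 0 0 ≠ 0) (t : ℝ) (y : Fin d → ℝ) :
    (Fin.cons t y : Fin (d + 1) → ℝ) ⬝ᵥ A *ᵥ (Fin.cons t y : Fin (d + 1) → ℝ) =
      A 0 0 * (t + (∑ i, A 0 (Fin.succ i) * y i) / A 0 0) ^ 2 +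
        y ⬝ᵥ (A.submatrix Fin.succ Fin.succ -
          (A 0 0)⁻¹ • vecMulVec (fun i => A 0 (Fin.succ i)) (fun i => A 0 (Fin.succ i))) *ᵥ y := by
  have hsym : ∀ i, A (Fin.succ i) 0 = A 0 (Fin.succ i) := fun i => by
    have := hA.apply 0 (Fin.succ i); simpa using this
  set c : Fin d → ℝ := fun i => A 0 (Fin.succ i) with hc
  have h1 : (Fin.cons t y : Fin (d + 1) → ℝ) ⬝ᵥ A *ᵥ (Fin.cons t y : Fin (d + 1) → ℝ) =
      A 0 0 * t ^ 2 + 2 * t * (c ⬝ᵥ y) + y ⬝ᵥ A.submatrix Fin.succ Fin.succ *ᵥ y := by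
    simp only [dotProduct, mulVec, Fin.sum_univ_succ, Fin.cons_zero, Fin.cons_succ, hsym,
      submatrix_apply, mul_add, Finset.sum_add_distrib]
    have : ∑ i, y i * (A 0 (Fin.succ i) * t) = t * ∑ i, A 0 (Fin.succ i) * y i := by
      rw [Finset.mul_sum]; exact Finset.sum_congr rfl fun i _ => by ring
    rw [this]; simp only [hc]; ring
  have h2 : y ⬝ᵥ vecMulVec c c *ᵥ y = (c ⬝ᵥ y) ^ 2 := by
    rw [vecMulVec_mulVec]
    simp only [dotProduct, Pi.smul_apply, MulOpposite.smul_eq_mul_unop, MulOpposite.unop_op]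
    rw [sq, Finset.sum_mul]
    exact Finset.sum_congr rfl fun i _ => by ring
  rw [h1, sub_mulVec, dotProduct_sub, smul_mulVec, dotProduct_smul, h2, smul_eq_mul]
  change _ = A 0 0 * (t + (c ⬝ᵥ y) / A 0 0) ^ 2 + _
  field_simp
  ring

open Matrix in
/-- The determinant formula for the Schur complement of the first diagonal entry. -/
lemma det_eq_mul_det_schur {d : ℕ} (A : Matrix (Fin (d + 1)) (Fin (d + 1)) ℝ) (ha : A 0 0 ≠ 0) :
    A.det = A 0 0 * (A.submatrix Fin.succ Fin.succ -
      (A 0 0)⁻¹ • vecMulVec (fun i => A (Fin.succ i) 0) (fun i => A 0 (Fin.succ i))).det := by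
  let e : Fin d ⊕ Unit ≃ Fin (d + 1) :=
    ((finSuccEquiv d).trans (Equiv.optionEquivSumPUnit (Fin d))).symm
  have hel : ∀ i, e (Sum.inl i) = Fin.succ i := fun i => by simp [e]
  have her : ∀ i, e (Sum.inr i) = 0 := fun i => by simp [e]
  let D : Matrix Unit Unit ℝ := of fun _ _ => A 0 0
  have hD : D.det = A 0 0 := by simp [D]
  have : Invertible D := D.invertibleOfIsUnitDet (by rw [hD]; exact isUnit_iff_ne_zero.2 ha)
  have h := det_fromBlocks₂₂ (A.submatrix Fin.succ Fin.succ)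
    (of fun i (_ : Unit) => A (Fin.succ i) 0) (of fun (_ : Unit) j => A 0 (Fin.succ j)) D
  rw [← det_submatrix_equiv_self e A]
  have h1 : A.submatrix e e = fromBlocks (A.submatrix Fin.succ Fin.succ)
      (of fun i (_ : Unit) => A (Fin.succ i) 0) (of fun (_ : Unit) j => A 0 (Fin.succ j)) D := by
    ext i j
    rcases i with i | i <;> rcases j with j | j <;> simp [hel, her, D]
  rw [h1, h, hD]
  congr 2
  ext i j
  have hi : (⅟D) () () = (A 0 0)⁻¹ := by
    rw [invOf_eq_nonsing_inv, inv_def, hD]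
    simp [adjugate_subsingleton]
  simp only [Matrix.sub_apply, mul_apply, of_apply, Finset.univ_unique, Finset.sum_singleton,
    Matrix.smul_apply,
    vecMulVec_apply, smul_eq_mul]
  rw [show (default : Unit) = () from rfl, hi]
  ring

open Matrix in
/-- Expectation of the exponential of minus a positive definite quadratic form of independent
variables. If each variable satisfies `sup_b E exp (-a (x - b)²) ≤ Γ a ^ (-κ)` up to the largest
diagonal entry, the expectation is at most `Γ ^ d * (det A) ^ (-κ)`: integrate the variables one at
a time, completing squares; the pivots multiply to the determinant. -/
theorem integral_exp_neg_quadratic_le (ν : Measure ℝ) [IsProbabilityMeasure ν] {Γ κ amax : ℝ}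
    (hΓ : 0 ≤ Γ)
    (h : ∀ a b : ℝ, 0 < a → a ≤ amax → ∫ x, Real.exp (-a * (x - b) ^ 2) ∂ν ≤ Γ * a ^ (-κ)) :
    ∀ (d : ℕ) (A : Matrix (Fin d) (Fin d) ℝ), A.PosDef → (∀ i, A i i ≤ amax) → ∀ b : Fin d → ℝ,
      ∫ x : Fin d → ℝ, Real.exp (-((x - b) ⬝ᵥ A *ᵥ (x - b))) ∂(Measure.pi fun _ => ν) ≤
        Γ ^ d * A.det ^ (-κ) := by
  intro d
  induction d with
  | zero =>
    intro A _ _ b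
    simp
  | succ d ih =>
    intro A hA hdiag b
    have ha : 0 < A 0 0 := hA.diag_pos
    set c : Fin d → ℝ := fun i => A 0 (Fin.succ i) with hc
    set S := A.submatrix Fin.succ Fin.succ - (A 0 0)⁻¹ • vecMulVec c c with hS
    have hsym : ∀ i, A (Fin.succ i) 0 = c i := fun i => by
      have := hA.isHermitian.apply 0 (Fin.succ i); simpa using this
    have hdet : A.det = A 0 0 * S.det := by
      rw [det_eq_mul_det_schur A ha.ne', hS]
      simp_rw [hsym]
      rfl
    have hSP : S.PosDef := by
      apply PosDef.of_dotProduct_mulVec_pos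
      · ext i j
        have := hA.isHermitian.apply (Fin.succ i) (Fin.succ j)
        simp only [star_trivial] at this
        simp [hS, this, vecMulVec_apply, mul_comm]
      · intro y hy
        have h1 := dotProduct_mulVec_cons A hA.isHermitian ha.ne'
          (-((∑ i, A 0 (Fin.succ i) * y i) / A 0 0)) y
        have h2 : (Fin.cons (-((∑ i, A 0 (Fin.succ i) * y i) / A 0 0)) y : Fin (d + 1) → ℝ) ≠ 0 :=
          by
          intro h0
          apply hy
          ext i
          have := congrFun h0 (Fin.succ i)
          simpa using this
        have h3 := hA.dotProduct_mulVec_pos h2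
        simp only [star_trivial] at h3 ⊢
        rw [h1] at h3
        simpa using h3
    have hSd : ∀ i, S i i ≤ amax := fun i => by
      have h1 := hdiag (Fin.succ i)
      have h2 : 0 ≤ (A 0 0)⁻¹ * (c i * c i) := mul_nonneg (by positivity) (mul_self_nonneg _)
      simp only [hS, Matrix.sub_apply, submatrix_apply, Matrix.smul_apply, vecMulVec_apply,
        smul_eq_mul]
      linarith
    have hmp := (measurePreserving_piFinSuccAbove (fun _ : Fin (d + 1) => ν) 0).symm
    have hnn : ∀ x : Fin (d + 1) → ℝ, 0 ≤ x ⬝ᵥ A *ᵥ x := fun x => by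
      have := hA.posSemidef.dotProduct_mulVec_nonneg x
      simpa using this
    have hcont : Continuous fun x : Fin (d + 1) → ℝ => Real.exp (-((x - b) ⬝ᵥ A *ᵥ (x - b))) := by
      simp only [dotProduct, mulVec]; fun_prop
    have hexp : ∀ t y, Real.exp (-((Fin.cons t y - b : Fin (d + 1) → ℝ) ⬝ᵥ A *ᵥ
        (Fin.cons t y - b : Fin (d + 1) → ℝ))) =
        Real.exp (-A 0 0 * (t - (b 0 - (∑ i, A 0 (Fin.succ i) * (y i - b (Fin.succ i))) / A 0 0)) ^ 2)
          * Real.exp (-((y - fun i => b (Fin.succ i)) ⬝ᵥ S *ᵥ (y - fun i => b (Fin.succ i)))) := by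
      intro t y
      have e : (Fin.cons t y - b : Fin (d + 1) → ℝ) =
          Fin.cons (t - b 0) (y - fun i => b (Fin.succ i)) := by
        ext i; refine Fin.cases ?_ (fun i => ?_) i <;> simp
      rw [e, dotProduct_mulVec_cons A hA.isHermitian ha.ne', ← Real.exp_add]
      congr 1
      simp only [hS, hc, Pi.sub_apply]
      ring
    have hI : Integrable (fun z : ℝ × (Fin d → ℝ) =>
        Real.exp (-((Fin.cons z.1 z.2 - b : Fin (d + 1) → ℝ) ⬝ᵥ A *ᵥ
        (Fin.cons z.1 z.2 - b : Fin (d + 1) → ℝ)))) (ν.prod (Measure.pi fun _ => ν)) := by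
      refine Integrable.of_bound ?_ 1 (Filter.Eventually.of_forall fun z => ?_)
      · exact (hcont.comp (by fun_prop :
          Continuous fun z : ℝ × (Fin d → ℝ) => (Fin.cons z.1 z.2 : Fin (d + 1) → ℝ))).aestronglyMeasurable
      · rw [Real.norm_eq_abs, abs_of_pos (Real.exp_pos _)]
        apply Real.exp_le_one_iff.2
        have := hnn (Fin.cons z.1 z.2 - b)
        linarith
    have hconv : ∫ x : Fin (d + 1) → ℝ, Real.exp (-((x - b) ⬝ᵥ A *ᵥ (x - b)))
        ∂(Measure.pi fun _ => ν) = ∫ z : ℝ × (Fin d → ℝ),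
        Real.exp (-((Fin.cons z.1 z.2 - b : Fin (d + 1) → ℝ) ⬝ᵥ A *ᵥ
        (Fin.cons z.1 z.2 - b : Fin (d + 1) → ℝ))) ∂(ν.prod (Measure.pi fun _ => ν)) := by
      rw [← hmp.integral_comp']
      congr 1
      ext z
      congr 3 <;> simp [MeasurableEquiv.piFinSuccAbove, Fin.insertNthEquiv]
    rw [hconv, integral_prod_symm _ hI]
    have hinner : ∀ y : Fin d → ℝ, ∫ t, Real.exp (-((Fin.cons t y - b : Fin (d + 1) → ℝ) ⬝ᵥ A *ᵥ
        (Fin.cons t y - b : Fin (d + 1) → ℝ))) ∂ν ≤ Γ * (A 0 0) ^ (-κ) *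
        Real.exp (-((y - fun i => b (Fin.succ i)) ⬝ᵥ S *ᵥ (y - fun i => b (Fin.succ i)))) := by
      intro y
      simp_rw [hexp]
      rw [integral_mul_const]
      exact mul_le_mul_of_nonneg_right (h _ _ ha (hdiag 0)) (Real.exp_pos _).le
    have hI2 : Integrable (fun y : Fin d → ℝ =>
        Real.exp (-((y - fun i => b (Fin.succ i)) ⬝ᵥ S *ᵥ (y - fun i => b (Fin.succ i)))))
        (Measure.pi fun _ => ν) := by
      refine Integrable.of_bound ?_ 1 (Filter.Eventually.of_forall fun z => ?_)
      · apply Continuous.aestronglyMeasurable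
        simp only [dotProduct, mulVec]; fun_prop
      · rw [Real.norm_eq_abs, abs_of_pos (Real.exp_pos _)]
        apply Real.exp_le_one_iff.2
        have := hSP.posSemidef.dotProduct_mulVec_nonneg (z - fun i => b (Fin.succ i))
        simp only [star_trivial] at this
        linarith
    refine (integral_mono hI.integral_prod_right (hI2.const_mul _) hinner).trans ?_
    rw [integral_const_mul, hdet, Real.mul_rpow ha.le hSP.det_pos.le]
    have := ih S hSP hSd fun i => b (Fin.succ i)
    calc _ ≤ Γ * A 0 0 ^ (-κ) * (Γ ^ d * S.det ^ (-κ)) :=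
          mul_le_mul_of_nonneg_left this (by positivity)
      _ = _ := by ring

/-- The Gram matrix of the rows of `T` restricted to the columns in `K`. -/
def partialGram {δ ρ : Type*} (T : Matrix δ ρ ℝ) (K : Finset ρ) : Matrix δ δ ℝ :=
  Matrix.of fun i k => ∑ j ∈ K, T i j * T k j

open Matrix in
lemma partialGram_posSemidef {δ ρ : Type*} [Fintype δ] (T : Matrix δ ρ ℝ) (K : Finset ρ) :
    (partialGram T K).PosSemidef := by
  apply PosSemidef.of_dotProduct_mulVec_nonneg
  · ext i j; simp [partialGram, mul_comm]
  · intro x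
    have : star x ⬝ᵥ partialGram T K *ᵥ x = ∑ j ∈ K, (∑ i, T i j * x i) ^ 2 := by
      simp only [star_trivial, dotProduct, mulVec, partialGram, of_apply, Finset.sum_mul,
        Finset.mul_sum]
      simp_rw [sq, Finset.sum_mul, Finset.mul_sum]
      rw [Finset.sum_comm' (t' := Finset.univ) (s' := fun _ => Finset.univ) (by simp)]
      rw [Finset.sum_comm]
      simp_rw [Finset.sum_comm (t := K)]
      refine Finset.sum_congr rfl fun i _ => Finset.sum_congr rfl fun j _ =>
        Finset.sum_congr rfl fun k _ => by ring
    rw [this]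
    positivity

open Matrix in
/-- Some `d` columns carry at least the average share of the Gram determinant (a weak form of the
Cauchy–Binet formula): columns are removed one at a time, and by the matrix determinant lemma the
average relative loss is explicit. -/
lemma exists_columns_det {d : ℕ} {ρ : Type*} [DecidableEq ρ] (T : Matrix (Fin d) ρ ℝ) :
    ∀ (n : ℕ) (K : Finset ρ), K.card = n → d ≤ n → ∃ K' ⊆ K, K'.card = d ∧
      (partialGram T K).det ≤ (n.choose d) * (partialGram T K').det := by
  intro n
  induction n with
  | zero =>
    intro K hK hd
    exact ⟨K, subset_rfl, by omega, by simp [show d = 0 by omega]⟩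
  | succ n ih =>
    intro K hK hd
    rcases hd.eq_or_lt with hd | hd
    · exact ⟨K, subset_rfl, by omega, by simp [hd]⟩
    have hdn : d ≤ n := by omega
    set A := partialGram T K with hA
    rcases (partialGram_posSemidef T K).det_nonneg.eq_or_lt with h0 | hpos
    · obtain ⟨K', hK', hc⟩ := Finset.exists_subset_card_eq (s := K) (n := d) (by omega)
      refine ⟨K', hK', hc, ?_⟩
      rw [hA, ← h0]
      exact mul_nonneg (Nat.cast_nonneg _) (partialGram_posSemidef T K').det_nonneg
    have hrem : ∀ j ∈ K, (partialGram T (K.erase j)).det =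
        A.det * (1 - (fun i => T i j) ⬝ᵥ A⁻¹ *ᵥ (fun i => T i j)) := by
      intro j hj
      have e : partialGram T (K.erase j) = A + replicateCol Unit (fun i => -T i j) *
          replicateRow Unit (fun i => T i j) := by
        ext i k
        simp only [partialGram, hA, of_apply, Matrix.add_apply, mul_apply, replicateCol_apply,
          replicateRow_apply,
          Finset.univ_unique, Finset.sum_singleton]
        rw [← Finset.add_sum_erase K (fun j => T i j * T k j) hj]; ring
      rw [e, det_add_replicateCol_mul_replicateRow (isUnit_iff_ne_zero.2 hpos.ne')]
      congr 1
      rw [det_unique, Matrix.mul_assoc]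
      have : A⁻¹ * replicateCol Unit (fun i => -T i j) =
          replicateCol Unit (A⁻¹ *ᵥ (fun i => -T i j)) := by
        rw [replicateCol_mulVec]
      rw [this, Matrix.add_apply, replicateRow_mul_replicateCol_apply, one_apply_eq,
        show (fun i => -T i j) = -(fun i => T i j) from rfl, mulVec_neg, dotProduct_neg,
        sub_eq_add_neg]
    have htr : ∑ j ∈ K, ((fun i => T i j) ⬝ᵥ A⁻¹ *ᵥ (fun i => T i j)) = d := by
      have h1 : (A⁻¹ * A).trace = d := by
        rw [nonsing_inv_mul _ (isUnit_iff_ne_zero.2 hpos.ne')]; simp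
      rw [← h1]
      simp only [trace, diag, mul_apply, dotProduct, mulVec]
      have hAe : ∀ i k, A i k = ∑ j ∈ K, T i j * T k j := fun _ _ => rfl
      simp_rw [hAe, Finset.mul_sum]
      rw [Finset.sum_comm]
      refine Finset.sum_congr rfl fun i _ => ?_
      rw [Finset.sum_comm]
      refine Finset.sum_congr rfl fun k _ => Finset.sum_congr rfl fun j _ => by ring
    have hsum : ∑ j ∈ K, (partialGram T (K.erase j)).det = ∑ j ∈ K, (1 - d / (n + 1 : ℝ)) * A.det := by
      rw [Finset.sum_congr rfl hrem, ← Finset.mul_sum, Finset.sum_sub_distrib, htr]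
      simp only [Finset.sum_const, hK, nsmul_eq_mul]
      push_cast
      field_simp
    have hKne : K.Nonempty := Finset.card_pos.1 (by omega)
    obtain ⟨j, hj, hle⟩ := Finset.exists_le_of_sum_le hKne hsum.ge
    obtain ⟨K', hK', hc, hle'⟩ := ih (K.erase j) (by rw [Finset.card_erase_of_mem hj]; omega) hdn
    refine ⟨K', hK'.trans (Finset.erase_subset _ _), hc, ?_⟩
    have hch : ((n + 1).choose d : ℝ) * (n + 1 - d) = n.choose d * (n + 1) := by
      have := Nat.choose_mul_succ_eq n d
      rw [← Nat.cast_inj (R := ℝ)] at this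
      push_cast [Nat.cast_sub (show d ≤ n + 1 by omega)] at this
      linarith
    have hnd : (0 : ℝ) < n + 1 - d := by
      have : (d : ℝ) < n + 1 := by exact_mod_cast hd
      linarith
    have h2 : A.det * (n + 1 - d) ≤ (n + 1) * (n.choose d * (partialGram T K').det) := by
      have h3 := hle.trans hle'
      have h4 : (1 - d / (n + 1 : ℝ)) * A.det * (n + 1) = A.det * (n + 1 - d) := by
        field_simp
      rw [← h4, mul_comm]
      exact mul_le_mul_of_nonneg_left h3 (by positivity)
    rw [← mul_le_mul_iff_left₀ hnd]
    calc A.det * (n + 1 - d) ≤ (n + 1) * (n.choose d * (partialGram T K').det) := h2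
      _ = n.choose d * (n + 1) * (partialGram T K').det := by ring
      _ = _ := by rw [← hch]; ring

/-- Splitting the coordinates of a power measure along a bijection `α ⊕ β ≃ γ`. -/
lemma measurePreserving_split {α β γ E : Type*} [Fintype α] [Fintype β] [Fintype γ]
    [MeasurableSpace E] (m : Measure E) [SigmaFinite m] (e : α ⊕ β ≃ γ) :
    MeasurePreserving (fun X : γ → E => ((fun a => X (e (Sum.inl a))), fun b => X (e (Sum.inr b))))
      (Measure.pi fun _ => m) ((Measure.pi fun _ => m).prod (Measure.pi fun _ => m)) := by
  have h1 := (measurePreserving_piCongrLeft (fun _ : γ => m) e).symm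
  have h2 := measurePreserving_sumPiEquivProdPi (fun _ : α ⊕ β => m)
  have h3 := h2.comp h1
  exact h3

/-! ### Projections of random vectors -/

lemma integral_split {α β γ E : Type*} [Fintype α] [Fintype β] [Fintype γ]
    [MeasurableSpace E] (m : Measure E) [SigmaFinite m] (e : α ⊕ β ≃ γ)
    {F : (α → E) × (β → E) → ℝ}
    (hF : AEStronglyMeasurable F ((Measure.pi fun _ => m).prod (Measure.pi fun _ => m))) :
    ∫ X : γ → E, F ((fun a => X (e (Sum.inl a))), fun b => X (e (Sum.inr b)))
      ∂(Measure.pi fun _ => m) = ∫ z, F z ∂((Measure.pi fun _ => m).prod (Measure.pi fun _ => m)) := by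
  have h := measurePreserving_split m e
  rw [← h.map_eq] at hF ⊢
  rw [integral_map h.measurable.aemeasurable hF]

open Matrix in
/-- Small-ball bound for the image `T x` of a vector with independent coordinates: apply
`integral_exp_neg_quadratic_le` to the coordinates of a well-conditioned set of `d` columns, the
other coordinates being frozen. -/
theorem integral_exp_neg_linear_image_le (ν : Measure ℝ) [IsProbabilityMeasure ν] {Γ κ amax : ℝ}
    (hΓ : 0 ≤ Γ) (hκ : 0 ≤ κ)
    (h : ∀ a b : ℝ, 0 < a → a ≤ amax → ∫ x, Real.exp (-a * (x - b) ^ 2) ∂ν ≤ Γ * a ^ (-κ))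
    {d : ℕ} {ρ : Type*} [Fintype ρ] [DecidableEq ρ] (hd : d ≤ Fintype.card ρ)
    (T : Matrix (Fin d) ρ ℝ) {s : ℝ} (hs : 0 < s)
    (hcol : ∀ r, s * ∑ i, T i r ^ 2 ≤ amax) (hdet : 0 < (T * Tᵀ).det) (y : Fin d → ℝ) :
    ∫ x : ρ → ℝ, Real.exp (-s * ∑ i, ((T *ᵥ x) i - y i) ^ 2) ∂(Measure.pi fun _ => ν) ≤
      Γ ^ d * ((Fintype.card ρ).choose d / (s ^ d * (T * Tᵀ).det)) ^ κ := by
  obtain ⟨K', -, hc, hle⟩ := exists_columns_det T (Fintype.card ρ) Finset.univ rfl hd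
  have hg : partialGram T Finset.univ = T * Tᵀ := by
    ext i k; simp [partialGram, mul_apply]
  rw [hg] at hle
  let e : Fin d ⊕ {j // j ∉ K'} ≃ ρ :=
    (Equiv.sumCongr (K'.equivFinOfCardEq hc).symm (Equiv.refl _)).trans
      (Equiv.sumCompl (· ∈ K'))
  set Q : Matrix (Fin d) (Fin d) ℝ := of fun i k => T i (e (Sum.inl k)) with hQ
  have hQg : partialGram T K' = Q * Qᵀ := by
    ext i k
    simp only [partialGram, of_apply, mul_apply, transpose_apply, hQ]
    rw [← Finset.sum_coe_sort K', ← (K'.equivFinOfCardEq hc).symm.sum_comp]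
    rfl
  have hQdet : 0 < (Q * Qᵀ).det := by
    rw [← hQg]
    by_contra hcon
    have := hle.trans (mul_nonpos_of_nonneg_of_nonpos (Nat.cast_nonneg _) (not_lt.1 hcon))
    linarith
  have hQu : IsUnit Q.det := by
    rw [isUnit_iff_ne_zero]
    intro h0
    rw [det_mul, h0, zero_mul] at hQdet
    exact lt_irrefl _ hQdet
  set A : Matrix (Fin d) (Fin d) ℝ := s • (Qᵀ * Q) with hA
  have hAP : A.PosDef := by
    have h1 : (Qᴴ * Q).PosDef := PosDef.conjTranspose_mul_self Q
      (mulVec_injective_of_isUnit ((isUnit_iff_isUnit_det Q).2 hQu))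
    rw [conjTranspose_eq_transpose_of_trivial] at h1
    exact h1.smul hs
  have hAdet : A.det = s ^ d * (Q * Qᵀ).det := by
    rw [hA, det_smul, Fintype.card_fin, det_mul_comm]
  have hAd : ∀ i, A i i ≤ amax := fun i => by
    refine le_trans (le_of_eq ?_) (hcol (e (Sum.inl i)))
    simp [hA, mul_apply, hQ, sq]
  have hq : ∀ u b : Fin d → ℝ, (u - b) ⬝ᵥ A *ᵥ (u - b) = s * ∑ i, ((Q *ᵥ u) i - (Q *ᵥ b) i) ^ 2 :=
    by
    intro u b
    rw [hA, smul_mulVec, dotProduct_smul, ← mulVec_mulVec, dotProduct_mulVec, vecMul_transpose,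
      mulVec_sub, smul_eq_mul]
    simp [dotProduct, sq]
  set Y : ({j // j ∉ K'} → ℝ) → Fin d → ℝ := fun w i => y i - ∑ b, T i (e (Sum.inr b)) * w b with hY
  have hsplit : ∀ x : ρ → ℝ, ∀ i, (T *ᵥ x) i - y i =
      (Q *ᵥ fun a => x (e (Sum.inl a))) i - Y (fun b => x (e (Sum.inr b))) i := by
    intro x i
    simp only [mulVec, dotProduct, hQ, of_apply, hY]
    rw [← e.sum_comp, Fintype.sum_sum_type]
    ring
  let F : (Fin d → ℝ) × ({j // j ∉ K'} → ℝ) → ℝ := fun z =>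
    Real.exp (-s * ∑ i, ((Q *ᵥ z.1) i - Y z.2 i) ^ 2)
  have hFc : Continuous F := by
    simp only [F, mulVec, dotProduct, hY]; fun_prop
  have hFI : Integrable F ((Measure.pi fun _ => ν).prod (Measure.pi fun _ => ν)) := by
    refine Integrable.of_bound hFc.aestronglyMeasurable 1 (Filter.Eventually.of_forall fun z => ?_)
    rw [Real.norm_eq_abs, abs_of_pos (Real.exp_pos _)]
    apply Real.exp_le_one_iff.2
    have : 0 ≤ s * ∑ i, ((Q *ᵥ z.1) i - Y z.2 i) ^ 2 :=
      mul_nonneg hs.le (Finset.sum_nonneg fun i _ => sq_nonneg _)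
    linarith
  have hconst : Γ ^ d * A.det ^ (-κ) ≤
      Γ ^ d * ((Fintype.card ρ).choose d / (s ^ d * (T * Tᵀ).det)) ^ κ := by
    apply mul_le_mul_of_nonneg_left _ (by positivity)
    rw [Real.rpow_neg hAP.det_pos.le, ← Real.inv_rpow hAP.det_pos.le]
    apply Real.rpow_le_rpow (by have := hAP.det_pos; positivity) _ hκ
    rw [hAdet, le_div_iff₀ (by positivity), inv_mul_le_iff₀ (by positivity), ← hQg]
    calc s ^ d * (T * Tᵀ).det ≤ s ^ d * ((Fintype.card ρ).choose d * (partialGram T K').det) := by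
          gcongr
      _ = _ := by ring
  have hinner : ∀ w, ∫ u, F (u, w) ∂(Measure.pi fun _ => ν) ≤
      Γ ^ d * ((Fintype.card ρ).choose d / (s ^ d * (T * Tᵀ).det)) ^ κ := by
    intro w
    have h1 := integral_exp_neg_quadratic_le ν hΓ h d A hAP hAd (Q⁻¹ *ᵥ Y w)
    refine le_trans (le_of_eq ?_) (h1.trans hconst)
    congr 1
    ext u
    rw [hq, mulVec_mulVec, mul_nonsing_inv _ hQu, one_mulVec, ← neg_mul]
  calc ∫ x : ρ → ℝ, Real.exp (-s * ∑ i, ((T *ᵥ x) i - y i) ^ 2) ∂(Measure.pi fun _ => ν)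
      = ∫ x : ρ → ℝ, F ((fun a => x (e (Sum.inl a))), fun b => x (e (Sum.inr b)))
        ∂(Measure.pi fun _ => ν) := by
        congr 1; ext x; simp only [F]; simp_rw [hsplit x]
    _ = ∫ z, F z ∂((Measure.pi fun _ => ν).prod (Measure.pi fun _ => ν)) :=
        integral_split ν e hFc.aestronglyMeasurable
    _ = ∫ w, ∫ u, F (u, w) ∂(Measure.pi fun _ => ν) ∂(Measure.pi fun _ => ν) :=
        integral_prod_symm _ hFI
    _ ≤ ∫ w, Γ ^ d * ((Fintype.card ρ).choose d / (s ^ d * (T * Tᵀ).det)) ^ κ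
        ∂(Measure.pi fun _ => ν) := integral_mono hFI.integral_prod_right (integrable_const _) hinner
    _ = _ := by simp

/-- The single-variable conclusion of `exists_anticoncentration`. -/
def IsNonConcentrated (c : ℝ) (ν : Measure ℝ) : Prop :=
  ∀ a b : ℝ, 1 ≤ a → ∫ x, Real.exp (-a * (x - b) ^ 2) ∂ν ≤ Real.exp (-c)

lemma integral_exp_neg_sq_le_one (ν : Measure ℝ) [IsProbabilityMeasure ν] {a : ℝ} (ha : 0 ≤ a)
    (b : ℝ) : ∫ x, Real.exp (-a * (x - b) ^ 2) ∂ν ≤ 1 := by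
  have h : ∀ x : ℝ, Real.exp (-a * (x - b) ^ 2) ≤ 1 := fun x => by
    apply Real.exp_le_one_iff.2
    have := mul_nonneg ha (sq_nonneg (x - b))
    linarith
  have hI : Integrable (fun x : ℝ => Real.exp (-a * (x - b) ^ 2)) ν :=
    Integrable.of_bound (by fun_prop) 1 (Filter.Eventually.of_forall fun x => by
      rw [Real.norm_eq_abs, abs_of_pos (Real.exp_pos _)]; exact h x)
  refine (integral_mono hI (integrable_const 1) h).trans ?_
  simp

open Matrix in
/-- The projection of a random vector to a `k`-dimensional subspace is rarely short. The exponent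
`κ` is chosen so that `exp (-c) = (B ^ 2) ^ (-κ)`; it turns the one-step gain `exp (-c)` into a
power bound valid for all pivots. -/
lemma integral_exp_neg_proj_le {c : ℝ} (hc : 0 < c) (ν : Measure ℝ) [IsProbabilityMeasure ν]
    (hν : IsNonConcentrated c ν) {k : ℕ} {ρ : Type*} [Fintype ρ] [DecidableEq ρ]
    (hk : k ≤ Fintype.card ρ) (U : Matrix (Fin k) ρ ℝ) (hU : U * Uᵀ = 1) {B : ℝ} (hB : 1 < B)
    (hch : ((Fintype.card ρ).choose k : ℝ) ≤ B ^ k) (y : Fin k → ℝ) :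
    ∫ x : ρ → ℝ, Real.exp (-B ^ 2 * ∑ i, ((U *ᵥ x) i - y i) ^ 2) ∂(Measure.pi fun _ => ν) ≤
      Real.exp (-(c * k / 2)) := by
  have hlog : 0 < Real.log B := Real.log_pos hB
  have hB0 : 0 < B := by linarith
  set κ := c / (2 * Real.log B) with hκ
  have hκ0 : 0 < κ := by positivity
  have hBκ : B ^ (-κ) = Real.exp (-(c / 2)) := by
    rw [Real.rpow_def_of_pos hB0]; congr 1; rw [hκ]; field_simp
  have hF : ∀ a b : ℝ, 0 < a → a ≤ B ^ 2 → ∫ x, Real.exp (-a * (x - b) ^ 2) ∂ν ≤ 1 * a ^ (-κ) := by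
    intro a b ha haB
    rw [one_mul]
    rcases le_or_gt 1 a with h1 | h1
    · refine (hν a b h1).trans ?_
      have : Real.exp (-c) = (B ^ 2) ^ (-κ) := by
        rw [← Real.rpow_natCast B 2, ← Real.rpow_mul hB0.le, mul_comm, Real.rpow_mul hB0.le, hBκ,
          Real.rpow_natCast, ← Real.exp_nat_mul]
        congr 1; push_cast; ring
      rw [this]
      exact Real.rpow_le_rpow_of_nonpos ha haB (by linarith)
    · exact (integral_exp_neg_sq_le_one ν ha.le b).trans
        (Real.one_le_rpow_of_pos_of_le_one_of_nonpos ha h1.le (by linarith))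
  have hcol : ∀ r, B ^ 2 * ∑ i, U i r ^ 2 ≤ B ^ 2 := by
    intro r
    -- The columns of `U` have norm at most one: `Uᵀ U` is idempotent, so its diagonal is at most
    -- one.
    have hP : (Uᵀ * U) * (Uᵀ * U) = Uᵀ * U := by
      rw [Matrix.mul_assoc, ← Matrix.mul_assoc U, hU, Matrix.one_mul]
    set P := Uᵀ * U with hPdef
    have hPr : P r r = ∑ i, U i r ^ 2 := by simp [hPdef, mul_apply, sq]
    have hsym : ∀ i j, P i j = P j i := fun i j => by simp [hPdef, mul_apply, mul_comm]
    have h1 : P r r ^ 2 ≤ P r r := by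
      conv_rhs => rw [← hP, mul_apply]
      have : P r r ^ 2 = P r r * P r r := sq _
      rw [this]
      exact Finset.single_le_sum (f := fun j => P r j * P j r)
        (fun j _ => by rw [hsym j r]; exact mul_self_nonneg _) (Finset.mem_univ r)
    have h2 : P r r ≤ 1 := by
      by_contra hcon
      nlinarith [not_le.1 hcon]
    rw [← hPr]
    nlinarith [sq_nonneg B]
  have h := integral_exp_neg_linear_image_le ν zero_le_one hκ0.le hF hk U (s := B ^ 2)
    (by positivity) hcol (by rw [hU]; simp) y
  refine h.trans ?_
  rw [hU, det_one, mul_one, one_pow, one_mul]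
  calc (((Fintype.card ρ).choose k : ℝ) / (B ^ 2) ^ k) ^ κ ≤ (B ^ k / (B ^ 2) ^ k) ^ κ := by gcongr
    _ = (B ^ (-κ)) ^ k := by
        rw [← pow_mul, mul_comm 2 k, pow_mul, sq, div_mul_cancel_left₀ (by positivity),
          Real.inv_rpow (by positivity), ← Real.rpow_neg (by positivity), ← Real.rpow_natCast,
          ← Real.rpow_mul hB0.le, mul_comm, Real.rpow_mul hB0.le, Real.rpow_natCast]
    _ = Real.exp (-(c * k / 2)) := by
        rw [hBκ, ← Real.exp_nat_mul]; congr 1; ring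

/-! ### Volume of random rows -/

open Matrix in
/-- If every vector with a unit coordinate has `G`-energy at least `r`, then `det G ≥ r ^ d`; for a
Gram matrix this is the volume bound by the distances to the spans of the other vectors. -/
lemma pow_le_det_of_energy {r : ℝ} (hr : 0 < r) :
    ∀ (d : ℕ) (G : Matrix (Fin d) (Fin d) ℝ), G.IsHermitian →
      (∀ (j : Fin d) (c : Fin d → ℝ), c j = 1 → r ≤ c ⬝ᵥ G *ᵥ c) → r ^ d ≤ G.det := by
  intro d
  induction d with
  | zero => intro G _ _; simp
  | succ d ih =>
    intro G hG h
    have ha : r ≤ G 0 0 := by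
      have := h 0 (Pi.single 0 1) (by simp)
      simpa using this
    have ha0 : 0 < G 0 0 := hr.trans_le ha
    have hsym : ∀ i, G (Fin.succ i) 0 = G 0 (Fin.succ i) := fun i => by
      have := hG.apply 0 (Fin.succ i); simpa using this
    rw [det_eq_mul_det_schur G ha0.ne', pow_succ']
    simp_rw [hsym]
    refine mul_le_mul ha (ih _ ?_ ?_) (by positivity) ha0.le
    · ext i j
      have := hG.apply (Fin.succ i) (Fin.succ j)
      simp only [star_trivial] at this
      simp [this, vecMulVec_apply, mul_comm]
    · intro j y hy
      have h1 := dotProduct_mulVec_cons G hG ha0.ne'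
          (-((∑ i, G 0 (Fin.succ i) * y i) / G 0 0)) y
      have h2 := h (Fin.succ j) (Fin.cons (-((∑ i, G 0 (Fin.succ i) * y i) / G 0 0)) y) (by simpa)
      rw [h1] at h2
      simpa using h2

open Matrix in
/-- If no row of `T` is close to the span of the other ones, then the rows span a large volume. -/
lemma pow_le_det_mul_transpose {d : ℕ} {ρ : Type*} [Fintype ρ] {r : ℝ} (hr : 0 < r)
    (T : Matrix (Fin d) ρ ℝ)
    (h : ∀ (j : Fin d) (c : Fin d → ℝ), c j = 1 → r ≤ ∑ i, (c ᵥ* T) i ^ 2) :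
    r ^ d ≤ (T * Tᵀ).det := by
  apply pow_le_det_of_energy hr
  · simpa [conjTranspose_eq_transpose_of_trivial] using isHermitian_mul_conjTranspose_self T
  · intro j c hc
    refine (h j c hc).trans (le_of_eq ?_)
    rw [← mulVec_mulVec, dotProduct_mulVec, mulVec_transpose]
    simp [dotProduct, sq]

/-- Fewer than `card ρ - k + 1` vectors admit `k` orthonormal vectors orthogonal to all of them. -/
lemma exists_orthonormal_rows {e k : ℕ} {ρ : Type*} [Fintype ρ] [DecidableEq ρ]
    (hk : e + k ≤ Fintype.card ρ) (Y : Fin e → ρ → ℝ) :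
    ∃ U : Matrix (Fin k) ρ ℝ, U * U.transpose = 1 ∧ ∀ i, U.mulVec (Y i) = 0 := by
  let V : Submodule ℝ (EuclideanSpace ℝ ρ) :=
    Submodule.span ℝ (Set.range fun i => WithLp.toLp 2 (Y i))
  have hV : Module.finrank ℝ V ≤ e := by
    have := finrank_range_le_card (R := ℝ) (fun i : Fin e => (WithLp.toLp 2 (Y i) : EuclideanSpace ℝ ρ))
    simpa [Set.finrank] using this
  have hVo : k ≤ Module.finrank ℝ Vᗮ := by
    have := V.finrank_add_finrank_orthogonal
    simp only [finrank_euclideanSpace] at this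
    omega
  let b := stdOrthonormalBasis ℝ Vᗮ
  let u : Fin k → EuclideanSpace ℝ ρ := fun i => b (Fin.castLE hVo i)
  refine ⟨Matrix.of fun i r => u i r, ?_, ?_⟩
  · ext i j
    have h1 : inner ℝ (u i) (u j) = if i = j then (1 : ℝ) else 0 := by
      have := (orthonormal_iff_ite.1 b.orthonormal) (Fin.castLE hVo i) (Fin.castLE hVo j)
      simp only [Submodule.coe_inner] at this
      rw [this]
      simp
    rw [PiLp.inner_apply] at h1
    rw [Matrix.mul_apply, Matrix.one_apply, ← h1]
    refine Finset.sum_congr rfl fun r _ => ?_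
    simp [mul_comm]
  · intro i
    ext l
    have h1 : inner ℝ (WithLp.toLp 2 (Y i) : EuclideanSpace ℝ ρ) (u l) = 0 :=
      (Submodule.mem_orthogonal V _).1 (b (Fin.castLE hVo l)).2 _ (Submodule.subset_span ⟨i, rfl⟩)
    rw [PiLp.inner_apply] at h1
    simp only [Matrix.mulVec, dotProduct, Matrix.of_apply, Pi.zero_apply]
    rw [← h1]
    refine Finset.sum_congr rfl fun r _ => ?_
    simp

/-- The exponential Markov inequality for a lower tail. -/
lemma measure_le_exp_mul_integral {α : Type*} [MeasurableSpace α] (m : Measure α)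
    [IsProbabilityMeasure m] {f : α → ℝ} (hf : Measurable f) (hf0 : ∀ x, 0 ≤ f x)
    (s : ℝ) (hs : 0 ≤ s) (t : ℝ) :
    m.real {x | f x ≤ t} ≤ Real.exp (s * t) * ∫ x, Real.exp (-s * f x) ∂m := by
  have hI : Integrable (fun x => Real.exp (-s * f x)) m :=
    Integrable.of_bound (by fun_prop) 1 (Filter.Eventually.of_forall fun x => by
      rw [Real.norm_eq_abs, abs_of_pos (Real.exp_pos _)]
      apply Real.exp_le_one_iff.2
      have := mul_nonneg hs (hf0 x)
      linarith)
  have h := measure_le_le_exp_mul_mgf (μ := m) (X := f) t (t := -s) (by linarith) hI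
  simpa [mgf] using h

open Matrix in
/-- With high probability no row of a random `d × ρ` matrix is close to the span of the others. -/
theorem measure_exists_short_combination_le {c : ℝ} (hc : 0 < c) (ν : Measure ℝ)
    [IsProbabilityMeasure ν] (hν : IsNonConcentrated c ν) {d k : ℕ} {ρ : Type*} [Fintype ρ]
    [DecidableEq ρ] (hk : d + k ≤ Fintype.card ρ + 1) {B : ℝ} (hB : 1 < B)
    (hch : ((Fintype.card ρ).choose k : ℝ) ≤ B ^ k) {r : ℝ} (hr : B ^ 2 * r ≤ c * k / 4) :
    (Measure.pi fun _ : Fin d => Measure.pi fun _ : ρ => ν).real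
      {X | ∃ (j : Fin d) (a : Fin d → ℝ), a j = 1 ∧ ∑ i, (∑ l, a l * X l i) ^ 2 < r} ≤
        d * Real.exp (-(c * k / 4)) := by
  set m : Measure (ρ → ℝ) := Measure.pi fun _ : ρ => ν with hm
  have hset : {X : Fin d → ρ → ℝ | ∃ (j : Fin d) (a : Fin d → ℝ), a j = 1 ∧
      ∑ i, (∑ l, a l * X l i) ^ 2 < r} = ⋃ j : Fin d, {X | ∃ a : Fin d → ℝ, a j = 1 ∧
      ∑ i, (∑ l, a l * X l i) ^ 2 < r} := by ext; simp
  rw [hset]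
  refine (measureReal_iUnion_fintype_le _).trans ?_
  suffices h : ∀ j : Fin d, (Measure.pi fun _ : Fin d => m).real {X | ∃ a : Fin d → ℝ, a j = 1 ∧
      ∑ i, (∑ l, a l * X l i) ^ 2 < r} ≤ Real.exp (-(c * k / 4)) by
    refine (Finset.sum_le_sum fun j _ => h j).trans ?_
    simp
  intro j
  obtain ⟨e, rfl⟩ : ∃ e, d = e + 1 := ⟨d - 1, by have := j.2; omega⟩
  have hopen : IsOpen {X : Fin (e + 1) → ρ → ℝ | ∃ a : Fin (e + 1) → ℝ, a j = 1 ∧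
      ∑ i, (∑ l, a l * X l i) ^ 2 < r} := by
    have : {X : Fin (e + 1) → ρ → ℝ | ∃ a : Fin (e + 1) → ℝ, a j = 1 ∧
      ∑ i, (∑ l, a l * X l i) ^ 2 < r} = ⋃ a ∈ {a : Fin (e + 1) → ℝ | a j = 1},
        {X | ∑ i, (∑ l, a l * X l i) ^ 2 < r} := by ext; simp
    rw [this]
    refine isOpen_biUnion fun a _ => isOpen_lt (by fun_prop) continuous_const
  have hmp := (measurePreserving_piFinSuccAbove (fun _ : Fin (e + 1) => m) j).symm
  rw [measureReal_def, ← hmp.measure_preimage hopen.measurableSet.nullMeasurableSet,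
    Measure.prod_apply_symm (hmp.measurable hopen.measurableSet)]
  have hY : ∀ Y : Fin e → ρ → ℝ, m ((fun x => (x, Y)) ⁻¹'
      ((MeasurableEquiv.piFinSuccAbove (fun _ : Fin (e + 1) => ρ → ℝ) j).symm ⁻¹'
      {X : Fin (e + 1) → ρ → ℝ | ∃ a : Fin (e + 1) → ℝ, a j = 1 ∧
      ∑ i, (∑ l, a l * X l i) ^ 2 < r})) ≤ ENNReal.ofReal (Real.exp (-(c * k / 4))) := by
    intro Y
    -- A short combination of row `j` with the other rows `Y` forces the projection of row `j` to
    -- the orthogonal complement of `Y` to be short, whatever the coefficients.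
    obtain ⟨U, hU, hUY⟩ := exists_orthonormal_rows (k := k) (by omega) Y
    have hsub : ((fun x => (x, Y)) ⁻¹'
      ((MeasurableEquiv.piFinSuccAbove (fun _ : Fin (e + 1) => ρ → ℝ) j).symm ⁻¹'
      {X : Fin (e + 1) → ρ → ℝ | ∃ a : Fin (e + 1) → ℝ, a j = 1 ∧
      ∑ i, (∑ l, a l * X l i) ^ 2 < r})) ⊆ {x | ∑ i, ((U *ᵥ x) i - (0 : Fin k → ℝ) i) ^ 2 ≤ r} := by
      rintro x ⟨a, ha, hlt⟩
      simp only [Pi.zero_apply, sub_zero, Set.mem_ofPred_eq]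
      set z : ρ → ℝ := fun i => ∑ l, a l * (MeasurableEquiv.piFinSuccAbove
        (fun _ : Fin (e + 1) => ρ → ℝ) j).symm (x, Y) l i with hz
      have hz' : z = x + ∑ l, a (j.succAbove l) • Y l := by
        ext i
        simp only [hz, Fin.sum_univ_succAbove _ j, ha, one_mul]
        simp [MeasurableEquiv.piFinSuccAbove, Fin.insertNthEquiv]
      have hUz : U *ᵥ z = U *ᵥ x := by
        rw [hz', mulVec_add, mulVec_sum]
        simp [mulVec_smul, hUY]
      have hcontr : ∑ i, (U *ᵥ z) i ^ 2 ≤ ∑ i, z i ^ 2 := by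
        -- the difference is the squared norm of `z - Uᵀ U z`
        have h1 : 0 ≤ (z - Uᵀ *ᵥ (U *ᵥ z)) ⬝ᵥ (z - Uᵀ *ᵥ (U *ᵥ z)) :=
          Finset.sum_nonneg fun i _ => mul_self_nonneg _
        have h2 : z ⬝ᵥ Uᵀ *ᵥ (U *ᵥ z) = (U *ᵥ z) ⬝ᵥ (U *ᵥ z) := by
          rw [dotProduct_mulVec, vecMul_transpose]
        have h3 : (Uᵀ *ᵥ (U *ᵥ z)) ⬝ᵥ (Uᵀ *ᵥ (U *ᵥ z)) = (U *ᵥ z) ⬝ᵥ (U *ᵥ z) := by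
          rw [dotProduct_mulVec, vecMul_transpose, mulVec_mulVec, hU, one_mulVec]
        rw [sub_dotProduct, dotProduct_sub, dotProduct_sub, h3, dotProduct_comm (Uᵀ *ᵥ (U *ᵥ z)) z,
          h2] at h1
        have h4 : ∑ i, (U *ᵥ z) i ^ 2 = (U *ᵥ z) ⬝ᵥ (U *ᵥ z) := by simp [dotProduct, sq]
        have h5 : ∑ i, z i ^ 2 = z ⬝ᵥ z := by simp [dotProduct, sq]
        rw [h4, h5]; linarith
      rw [← hUz]
      exact hcontr.trans hlt.le
    refine (measure_mono hsub).trans ?_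
    rw [← ofReal_measureReal]
    apply ENNReal.ofReal_le_ofReal
    refine (measure_le_exp_mul_integral m (f := fun x => ∑ i, ((U *ᵥ x) i - (0 : Fin k → ℝ) i) ^ 2)
      ?_ (fun x => by positivity) (B ^ 2) (by positivity) r).trans ?_
    · apply Continuous.measurable
      simp only [mulVec, dotProduct]; fun_prop
    have h1 := integral_exp_neg_proj_le hc ν hν (by omega) U hU hB hch 0
    calc _ ≤ Real.exp (c * k / 4) * Real.exp (-(c * k / 2)) :=
          mul_le_mul (Real.exp_le_exp.2 hr) h1 (integral_nonneg fun _ => (Real.exp_pos _).le)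
            (Real.exp_pos _).le
      _ = _ := by rw [← Real.exp_add]; congr 1; ring
  refine ENNReal.toReal_le_of_le_ofReal (Real.exp_pos _).le ?_
  refine (lintegral_mono hY).trans ?_
  simp

/-! ### Euclidean norm, operator norm, nets -/

/-- The Euclidean norm of a finite family of reals. -/
noncomputable def euclNorm {ι : Type*} [Fintype ι] (x : ι → ℝ) : ℝ :=
  ‖(WithLp.toLp 2 x : EuclideanSpace ℝ ι)‖

/-- The operator norm of a rectangular real matrix with respect to the Euclidean norms. -/
noncomputable def opNorm {m n : Type*} [Fintype m] [Fintype n] [DecidableEq n]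
    (A : Matrix m n ℝ) : ℝ :=
  ‖(Matrix.toEuclideanLin A).toContinuousLinearMap‖

section euclNorm

variable {ι κ : Type*} [Fintype ι] [Fintype κ]

lemma euclNorm_sq (x : ι → ℝ) : euclNorm x ^ 2 = ∑ i, x i ^ 2 := by
  rw [euclNorm, EuclideanSpace.norm_sq_eq]; simp

lemma euclNorm_nonneg (x : ι → ℝ) : 0 ≤ euclNorm x := norm_nonneg _

lemma euclNorm_add_le (x y : ι → ℝ) : euclNorm (x + y) ≤ euclNorm x + euclNorm y := norm_add_le _ _

lemma euclNorm_sub_le (x y : ι → ℝ) : euclNorm (x - y) ≤ euclNorm x + euclNorm y := norm_sub_le _ _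

lemma euclNorm_smul (a : ℝ) (x : ι → ℝ) : euclNorm (a • x) = |a| * euclNorm x :=
  norm_smul a (WithLp.toLp 2 x : EuclideanSpace ℝ ι)

lemma euclNorm_neg (x : ι → ℝ) : euclNorm (-x) = euclNorm x :=
  norm_neg (WithLp.toLp 2 x : EuclideanSpace ℝ ι)

lemma euclNorm_le_iff {x : ι → ℝ} {a : ℝ} (ha : 0 ≤ a) : euclNorm x ≤ a ↔ ∑ i, x i ^ 2 ≤ a ^ 2 := by
  rw [← euclNorm_sq, sq_le_sq₀ (euclNorm_nonneg _) ha]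

lemma euclNorm_eq_zero {x : ι → ℝ} : euclNorm x = 0 ↔ x = 0 := by
  rw [euclNorm, norm_eq_zero]; simp

lemma dotProduct_self_eq_euclNorm_sq (x : ι → ℝ) : dotProduct x x = euclNorm x ^ 2 := by
  rw [euclNorm_sq]; simp [dotProduct, sq]

lemma abs_dotProduct_le (x y : ι → ℝ) : |dotProduct x y| ≤ euclNorm x * euclNorm y := by
  have := abs_real_inner_le_norm (WithLp.toLp 2 x : EuclideanSpace ℝ ι) (WithLp.toLp 2 y)
  rw [PiLp.inner_apply] at this
  simp only [euclNorm]
  convert this using 2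
  simp [dotProduct, mul_comm]

lemma euclNorm_comp_le {f : κ → ι} (hf : Function.Injective f) (x : ι → ℝ) :
    euclNorm (x ∘ f) ≤ euclNorm x := by
  classical
  rw [euclNorm_le_iff (euclNorm_nonneg _), euclNorm_sq]
  calc ∑ i, (x ∘ f) i ^ 2 = ∑ i ∈ Finset.univ.image f, x i ^ 2 := by
        rw [Finset.sum_image (hf.injOn)]; rfl
    _ ≤ _ := Finset.sum_le_sum_of_subset_of_nonneg (Finset.subset_univ _) fun i _ _ => sq_nonneg _

lemma continuous_euclNorm : Continuous (euclNorm : (ι → ℝ) → ℝ) :=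
  continuous_norm.comp (PiLp.continuous_toLp 2 _)

lemma sum_abs_le_sqrt_card_mul_euclNorm {n : ℝ} (hn : (Fintype.card ι : ℝ) ≤ n) (x : ι → ℝ) :
    ∑ i, |x i| ≤ √n * euclNorm x := by
  have h := Finset.sum_mul_sq_le_sq_mul_sq Finset.univ (fun i => |x i|) fun _ => (1 : ℝ)
  simp only [mul_one, sq_abs, one_pow, Finset.sum_const, Finset.card_univ, nsmul_eq_mul] at h
  rw [← euclNorm_sq] at h
  have hn0 : 0 ≤ n := (Nat.cast_nonneg _).trans hn
  refine (sq_le_sq₀ (Finset.sum_nonneg fun i _ => abs_nonneg _)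
    (mul_nonneg (Real.sqrt_nonneg _) (euclNorm_nonneg x))).1 ?_
  rw [mul_pow, Real.sq_sqrt hn0]
  nlinarith [sq_nonneg (euclNorm x)]

lemma euclNorm_le_of_abs_le {n g : ℝ} (hn : (Fintype.card ι : ℝ) ≤ n) (hg : 0 ≤ g) (x : ι → ℝ)
    (h : ∀ i, |x i| ≤ g) : euclNorm x ≤ √n * g := by
  rw [euclNorm_le_iff (by positivity), mul_pow, Real.sq_sqrt ((Nat.cast_nonneg _).trans hn)]
  calc ∑ i, x i ^ 2 ≤ ∑ i : ι, g ^ 2 := Finset.sum_le_sum fun i _ => by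
        rw [← sq_abs]; exact pow_le_pow_left₀ (abs_nonneg _) (h i) 2
    _ = Fintype.card ι * g ^ 2 := by simp
    _ ≤ _ := by gcongr

end euclNorm

section opNorm

variable {m n l : Type*} [Fintype m] [Fintype n] [Fintype l] [DecidableEq n] [DecidableEq l]

lemma opNorm_nonneg (A : Matrix m n ℝ) : 0 ≤ opNorm A := norm_nonneg _

lemma euclNorm_mulVec_le (A : Matrix m n ℝ) (x : n → ℝ) :
    euclNorm (A.mulVec x) ≤ opNorm A * euclNorm x :=
  (Matrix.toEuclideanLin A).toContinuousLinearMap.le_opNorm (WithLp.toLp 2 x)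

lemma opNorm_le_of {A : Matrix m n ℝ} {c : ℝ} (hc : 0 ≤ c)
    (h : ∀ x, euclNorm (A.mulVec x) ≤ c * euclNorm x) : opNorm A ≤ c :=
  (Matrix.toEuclideanLin A).toContinuousLinearMap.opNorm_le_bound hc fun x => h x.ofLp

open scoped Matrix.Norms.L2Operator in
lemma opNorm_transpose [DecidableEq m] (A : Matrix m n ℝ) : opNorm A.transpose = opNorm A := by
  have := Matrix.l2_opNorm_conjTranspose A
  rwa [Matrix.conjTranspose_eq_transpose_of_trivial] at this

open scoped Matrix.Norms.L2Operator in
lemma opNorm_mul_le (A : Matrix m n ℝ) (B : Matrix n l ℝ) : opNorm (A * B) ≤ opNorm A * opNorm B :=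
  Matrix.l2_opNorm_mul A B

lemma opNorm_le_of_abs_dotProduct {A : Matrix m n ℝ} {c : ℝ} (hc : 0 ≤ c)
    (h : ∀ x y, |dotProduct x (A.mulVec y)| ≤ c * euclNorm x * euclNorm y) : opNorm A ≤ c := by
  refine opNorm_le_of hc fun y => ?_
  have h1 := h (A.mulVec y) y
  rw [dotProduct_self_eq_euclNorm_sq, abs_of_nonneg (sq_nonneg _)] at h1
  by_contra hcon
  push Not at hcon
  have h0 : 0 < euclNorm (A.mulVec y) :=
    lt_of_le_of_lt (mul_nonneg hc (euclNorm_nonneg _)) hcon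
  nlinarith

/-- By homogeneity it suffices to bound the bilinear form on the unit balls. -/
lemma opNorm_le_of_dotProduct_le {A : Matrix m n ℝ} {c : ℝ} (hc : 0 ≤ c)
    (h : ∀ x y, euclNorm x ≤ 1 → euclNorm y ≤ 1 → dotProduct x (A.mulVec y) ≤ c) :
    opNorm A ≤ c := by
  apply opNorm_le_of_abs_dotProduct hc
  intro x y
  rcases (euclNorm_nonneg x).eq_or_lt with hx | hx
  · have : x = 0 := euclNorm_eq_zero.1 hx.symm
    simp [this, show euclNorm (0 : m → ℝ) = 0 from euclNorm_eq_zero.2 rfl]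
  rcases (euclNorm_nonneg y).eq_or_lt with hy | hy
  · have : y = 0 := euclNorm_eq_zero.1 hy.symm
    simp [this, show euclNorm (0 : n → ℝ) = 0 from euclNorm_eq_zero.2 rfl]
  have hun : ∀ ε : ℝ, |ε| = 1 → ε * dotProduct x (A.mulVec y) ≤ c * euclNorm x * euclNorm y := by
    intro ε hε
    have := h ((ε * (euclNorm x)⁻¹) • x) ((euclNorm y)⁻¹ • y)
      (by rw [euclNorm_smul, abs_mul, hε, abs_of_pos (by positivity), one_mul,
        inv_mul_cancel₀ hx.ne'])
      (by rw [euclNorm_smul, abs_of_pos (by positivity), inv_mul_cancel₀ hy.ne'])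
    rw [Matrix.mulVec_smul, dotProduct_smul, smul_dotProduct, smul_eq_mul, smul_eq_mul] at this
    calc ε * dotProduct x (A.mulVec y) = ((euclNorm y)⁻¹ * (ε * (euclNorm x)⁻¹ *
          dotProduct x (A.mulVec y))) * (euclNorm x * euclNorm y) := by
          field_simp
      _ ≤ c * (euclNorm x * euclNorm y) := by gcongr
      _ = _ := by ring
  rw [abs_le]
  have h1 := hun 1 (by simp)
  have h2 := hun (-1) (by simp)
  constructor <;> linarith

/-- Deleting rows does not increase the operator norm. -/
lemma opNorm_submatrix_le {k : Type*} [Fintype k] (A : Matrix m n ℝ) {f : k → m}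
    (hf : Function.Injective f) : opNorm (A.submatrix f id) ≤ opNorm A :=
  opNorm_le_of (opNorm_nonneg _) fun x =>
    (euclNorm_comp_le hf (A.mulVec x)).trans (euclNorm_mulVec_le A x)

open scoped Matrix.Norms.L2Operator in
lemma continuous_opNorm : Continuous (opNorm : Matrix m n ℝ → ℝ) := continuous_norm

end opNorm

/-- Counting by weights: a family of integer-like codes whose product weights are at least
`exp (-A)` is no larger than `exp A` times the total weight. -/
lemma card_le_exp_mul_prod {γ κ : Type*} [Fintype γ] [DecidableEq γ] (S : γ → Finset κ)
    (w : γ → κ → ℝ) (hw : ∀ j k, 0 ≤ w j k) (Z : Finset (γ → κ)) (hZ : Z ⊆ Fintype.piFinset S)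
    {A : ℝ} (hA : ∀ z ∈ Z, Real.exp (-A) ≤ ∏ j, w j (z j)) :
    (Z.card : ℝ) ≤ Real.exp A * ∏ j, ∑ k ∈ S j, w j k := by
  have h1 : Z.card * Real.exp (-A) ≤ ∏ j, ∑ k ∈ S j, w j k := by
    rw [Finset.prod_univ_sum]
    calc Z.card * Real.exp (-A) = ∑ z ∈ Z, Real.exp (-A) := by simp
      _ ≤ ∑ z ∈ Z, ∏ j, w j (z j) := Finset.sum_le_sum hA
      _ ≤ _ := Finset.sum_le_sum_of_subset_of_nonneg hZ
          fun z _ _ => Finset.prod_nonneg fun j _ => hw _ _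
  calc (Z.card : ℝ) = Real.exp A * (Z.card * Real.exp (-A)) := by
        rw [mul_left_comm, ← Real.exp_add]; simp
    _ ≤ _ := by gcongr

lemma sum_exp_neg_abs_div_le {R : ℝ} (hR : 0 < R) (m : ℕ) :
    ∑ k ∈ Finset.Icc (-(m : ℤ)) m, Real.exp (-(|(k : ℝ)| / R)) ≤ 2 * R + 1 := by
  set x := Real.exp (-(1 / R)) with hx
  have hx0 : 0 < x := Real.exp_pos _
  have hx1 : x < 1 := Real.exp_lt_one_iff.2 (by
    have : 0 < 1 / R := by positivity
    linarith)
  have hxR : x ≤ R * (1 - x) := by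
    have h1 := Real.add_one_le_exp (1 / R)
    have h2 : x * Real.exp (1 / R) = 1 := by rw [hx, ← Real.exp_add]; simp
    have h3 : x * (1 / R + 1) ≤ 1 := by
      calc x * (1 / R + 1) ≤ x * Real.exp (1 / R) := mul_le_mul_of_nonneg_left h1 hx0.le
        _ = 1 := h2
    have h4 : x * (1 / R + 1) * R = x * (1 + R) := by field_simp
    nlinarith
  have hpow : ∀ k : ℕ, Real.exp (-(k / R)) = x ^ k := fun k => by
    rw [hx, ← Real.exp_nat_mul]; congr 1; ring
  have key : ∑ k ∈ Finset.Icc (-(m : ℤ)) m, Real.exp (-(|(k : ℝ)| / R)) =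
      1 + 2 * ∑ k ∈ Finset.range m, x ^ (k + 1) := by
    induction m with
    | zero => simp
    | succ m ih =>
      have e : Finset.Icc (-((m + 1 : ℕ) : ℤ)) ((m + 1 : ℕ) : ℤ) =
          insert (((m + 1 : ℕ) : ℤ)) (insert (-((m + 1 : ℕ) : ℤ)) (Finset.Icc (-(m : ℤ)) m)) := by
        ext k; simp only [Finset.mem_Icc, Finset.mem_insert]; push_cast; omega
      rw [e, Finset.sum_insert, Finset.sum_insert, ih, Finset.sum_range_succ, ← hpow (m + 1)]
      · have : |((((m + 1 : ℕ) : ℤ)) : ℝ)| = ((m + 1 : ℕ) : ℝ) := by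
          rw [Int.cast_natCast]; exact abs_of_nonneg (Nat.cast_nonneg _)
        rw [Int.cast_neg, abs_neg, this]; ring
      · simp only [Finset.mem_Icc]; push_cast; omega
      · simp only [Finset.mem_Icc, Finset.mem_insert]; push_cast; omega
  rw [key]
  have hg : ∑ k ∈ Finset.range m, x ^ (k + 1) ≤ R := by
    have h1 : (∑ k ∈ Finset.range m, x ^ k) * (1 - x) = 1 - x ^ m := by
      have := geom_sum_mul x m
      linarith
    have h2 : ∑ k ∈ Finset.range m, x ^ (k + 1) = x * ∑ k ∈ Finset.range m, x ^ k := by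
      rw [Finset.mul_sum]; exact Finset.sum_congr rfl fun k _ => by ring
    rw [h2, ← mul_le_mul_iff_left₀ (show 0 < 1 - x by linarith), mul_assoc, h1]
    have : 0 ≤ x * x ^ m := by positivity
    nlinarith
  linarith

/-- The integer points of a weighted cross-polytope. -/
noncomputable def crossPolytope {γ : Type*} [Fintype γ] [DecidableEq γ] (R : γ → ℝ) (A : ℝ) :
    Finset (γ → ℤ) :=
  (Fintype.piFinset fun j => Finset.Icc (-(⌈A * R j⌉₊ : ℤ)) ⌈A * R j⌉₊).filter
    fun z => ∑ j, |(z j : ℝ)| / R j ≤ A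

lemma mem_crossPolytope {γ : Type*} [Fintype γ] [DecidableEq γ] {R : γ → ℝ} (hR : ∀ j, 0 < R j)
    {A : ℝ} {z : γ → ℤ} : z ∈ crossPolytope R A ↔ ∑ j, |(z j : ℝ)| / R j ≤ A := by
  simp only [crossPolytope, Finset.mem_filter, Fintype.mem_piFinset, and_iff_right_iff_imp]
  intro h j
  have h1 : |(z j : ℝ)| / R j ≤ A := (Finset.single_le_sum (f := fun j => |(z j : ℝ)| / R j)
    (fun j _ => div_nonneg (abs_nonneg _) (hR j).le) (Finset.mem_univ j)).trans h
  rw [div_le_iff₀ (hR j)] at h1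
  have h2 : |(z j : ℝ)| ≤ (⌈A * R j⌉₊ : ℝ) := h1.trans (Nat.le_ceil _)
  have h3 : |z j| ≤ (⌈A * R j⌉₊ : ℤ) := by exact_mod_cast h2
  rw [Finset.mem_Icc]
  exact abs_le.1 h3

lemma card_crossPolytope_le {γ : Type*} [Fintype γ] [DecidableEq γ] {R : γ → ℝ} (hR : ∀ j, 0 < R j)
    (A : ℝ) : ((crossPolytope R A).card : ℝ) ≤ Real.exp A * ∏ j, (2 * R j + 1) := by
  refine (card_le_exp_mul_prod (fun j => Finset.Icc (-(⌈A * R j⌉₊ : ℤ)) ⌈A * R j⌉₊)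
    (fun j k => Real.exp (-(|(k : ℝ)| / R j))) (fun _ _ => (Real.exp_pos _).le) _
    (Finset.filter_subset _ _) (A := A) ?_).trans ?_
  · intro z hz
    have hz := (mem_crossPolytope hR).1 hz
    rw [← Real.exp_sum, Finset.sum_neg_distrib]
    exact Real.exp_le_exp.2 (by linarith)
  · gcongr with j
    exact sum_exp_neg_abs_div_le (hR j) _

/-- A set whose elements are classified by finitely many codes has a net of representatives inside
the set, no larger than the number of codes. -/
lemma exists_net {α κ : Type*} (V : Set α) (f : α → κ) (C : Finset κ) (hf : ∀ v ∈ V, f v ∈ C) :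
    ∃ N : Finset α, ↑N ⊆ V ∧ N.card ≤ C.card ∧ ∀ v ∈ V, ∃ v' ∈ N, f v = f v' := by
  classical
  have hex : ∀ c : κ, ∃ u : Option α, (∀ a, u = some a → a ∈ V ∧ f a = c) ∧
      ((∃ v ∈ V, f v = c) → u ≠ none) := by
    intro c
    by_cases h : ∃ v ∈ V, f v = c
    · obtain ⟨v, hv, hc⟩ := h
      exact ⟨some v, by rintro a ⟨⟩; exact ⟨hv, hc⟩, by simp⟩
    · exact ⟨none, by simp, fun h' => absurd h' h⟩
  choose u hu1 hu2 using hex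
  refine ⟨(C.image u).eraseNone, ?_, ?_, ?_⟩
  · intro a ha
    simp only [Finset.mem_coe, Finset.mem_eraseNone, Finset.mem_image] at ha
    obtain ⟨c, _, hc⟩ := ha
    exact (hu1 c a hc).1
  · refine (Finset.card_eraseNone_le _).trans Finset.card_image_le
  · intro v hv
    have h := hu2 (f v) ⟨v, hv, rfl⟩
    obtain ⟨a, ha⟩ := Option.ne_none_iff_exists'.1 h
    refine ⟨a, ?_, (hu1 _ a ha).2.symm⟩
    simp only [Finset.mem_eraseNone, Finset.mem_image]
    exact ⟨f v, hf v hv, ha⟩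

/-- Exponential moments of a bilinear form of a random matrix with independent entries. -/
lemma integral_exp_bilinear_le {σ q₀ K₀ : ℝ} {μ : Measure ℝ} [IsProbabilityMeasure μ]
    (hμ : SpreadLaw σ q₀ K₀ μ) {γ ρ : Type*} [Fintype γ] [Fintype ρ] (x : γ → ℝ) (y : ρ → ℝ)
    (t : ℝ) :
    Integrable (fun X : γ → ρ → ℝ => Real.exp (t * dotProduct x ((Matrix.of X).mulVec y)))
      (Measure.pi fun _ => Measure.pi fun _ => μ) ∧
    ∫ X : γ → ρ → ℝ, Real.exp (t * dotProduct x ((Matrix.of X).mulVec y))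
      ∂(Measure.pi fun _ => Measure.pi fun _ => μ) ≤
        Real.exp (σ * t ^ 2 * (euclNorm x ^ 2 * euclNorm y ^ 2)) := by
  have e : ∀ X : γ → ρ → ℝ, Real.exp (t * dotProduct x ((Matrix.of X).mulVec y)) =
      ∏ j, ∏ r, Real.exp ((t * (x j * y r)) * X j r) := by
    intro X
    rw [show (∏ j, ∏ r, Real.exp ((t * (x j * y r)) * X j r)) =
      ∏ j, Real.exp (∑ r, (t * (x j * y r)) * X j r) from
      Finset.prod_congr rfl fun j _ => (Real.exp_sum _ _).symm, ← Real.exp_sum]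
    congr 1
    simp only [dotProduct, Matrix.mulVec, Matrix.of_apply, Finset.mul_sum]
    exact Finset.sum_congr rfl fun j _ => Finset.sum_congr rfl fun r _ => by ring
  simp_rw [e]
  constructor
  · exact Integrable.fintype_prod (f := fun j (z : ρ → ℝ) => ∏ r, Real.exp ((t * (x j * y r)) * z r))
      fun j => Integrable.fintype_prod (f := fun r (u : ℝ) => Real.exp ((t * (x j * y r)) * u))
        fun r => hμ.mgf_integrable _
  · rw [integral_fintype_prod_eq_prod (f := fun j (z : ρ → ℝ) => ∏ r, Real.exp ((t * (x j * y r)) * z r))]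
    rw [Finset.prod_congr rfl fun j _ => integral_fintype_prod_eq_prod
      (μ := fun _ : ρ => μ) (fun r (u : ℝ) => Real.exp ((t * (x j * y r)) * u))]
    calc _ ≤ ∏ j, ∏ r, Real.exp (σ * (t * (x j * y r)) ^ 2) := by
          refine Finset.prod_le_prod (fun j _ => Finset.prod_nonneg fun r _ =>
            integral_nonneg fun _ => (Real.exp_pos _).le) fun j _ =>
            Finset.prod_le_prod (fun r _ => integral_nonneg fun _ => (Real.exp_pos _).le)
              fun r _ => hμ.mgf_le _
      _ = _ := by
          simp_rw [← Real.exp_sum]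
          congr 1
          rw [euclNorm_sq, euclNorm_sq, Finset.sum_mul_sum, Finset.mul_sum]
          refine Finset.sum_congr rfl fun j _ => ?_
          rw [Finset.mul_sum]
          exact Finset.sum_congr rfl fun r _ => by ring

lemma exists_grid_approx {ι : Type*} [Fintype ι] [DecidableEq ι] {n : ℕ} (hn : 0 < n)
    (hι : Fintype.card ι ≤ n) (x : ι → ℝ) (hx : euclNorm x ≤ 1) :
    ∃ z ∈ crossPolytope (fun _ : ι => (1 : ℝ)) (5 * n),
      euclNorm (x - fun j => (z j : ℝ) / (4 * √n)) ≤ 1 / 4 := by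
  have hn' : (0 : ℝ) < √n := Real.sqrt_pos.2 (by exact_mod_cast hn)
  have hnn : √(n : ℝ) * √n = n := Real.mul_self_sqrt (Nat.cast_nonneg _)
  have hι' : (Fintype.card ι : ℝ) ≤ n := by exact_mod_cast hι
  refine ⟨fun j => ⌊x j * (4 * √n)⌋, ?_, ?_⟩
  · rw [mem_crossPolytope (fun _ => one_pos)]
    have h1 : ∀ j, |((⌊x j * (4 * √n)⌋ : ℤ) : ℝ)| / 1 ≤ |x j| * (4 * √n) + 1 := by
      intro j
      rw [div_one]
      have h2 := Int.floor_le (x j * (4 * √n))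
      have h3 := Int.lt_floor_add_one (x j * (4 * √n))
      have h4 := abs_mul (x j) (4 * √n)
      rw [abs_of_pos (show 0 < 4 * √(n : ℝ) by positivity)] at h4
      rw [← h4, abs_le]
      constructor
      · have := neg_abs_le (x j * (4 * √n)); linarith
      · have := le_abs_self (x j * (4 * √n)); linarith
    refine (Finset.sum_le_sum fun j _ => h1 j).trans ?_
    rw [Finset.sum_add_distrib, ← Finset.sum_mul]
    have h5 := sum_abs_le_sqrt_card_mul_euclNorm hι' x
    simp only [Finset.sum_const, Finset.card_univ, nsmul_eq_mul, mul_one]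
    have h6 : ∑ i, |x i| ≤ √n := h5.trans (by nlinarith)
    nlinarith
  · have h1 := euclNorm_le_of_abs_le hι' (g := 1 / (4 * √n)) (by positivity)
      (x - fun j => ((⌊x j * (4 * √n)⌋ : ℤ) : ℝ) / (4 * √n)) ?_
    · refine h1.trans (le_of_eq ?_)
      field_simp
    · intro j
      have h2 := Int.floor_le (x j * (4 * √n))
      have h3 := Int.lt_floor_add_one (x j * (4 * √n))
      have e : (x - fun j => ((⌊x j * (4 * √n)⌋ : ℤ) : ℝ) / (4 * √n)) j =
          (x j * (4 * √n) - ⌊x j * (4 * √n)⌋) / (4 * √n) := by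
        simp only [Pi.sub_apply]; field_simp
      rw [e, abs_div, abs_of_pos (show 0 < 4 * √(n : ℝ) by positivity)]
      gcongr
      rw [abs_le]; constructor <;> linarith

lemma card_unit_crossPolytope_le {ι : Type*} [Fintype ι] [DecidableEq ι] {n : ℕ}
    (hι : Fintype.card ι ≤ n) :
    ((crossPolytope (fun _ : ι => (1 : ℝ)) (5 * n)).card : ℝ) ≤ Real.exp (7 * n) := by
  have h0 := card_crossPolytope_le (γ := ι) (R := fun _ => 1) (fun _ => one_pos) (5 * n)
  have h1 : (2 * 1 + 1 : ℝ) ≤ Real.exp 2 := by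
    have := Real.add_one_le_exp (2 : ℝ); linarith
  calc _ ≤ Real.exp (5 * n) * ∏ j : ι, (2 * 1 + 1 : ℝ) := h0
    _ ≤ Real.exp (5 * n) * Real.exp 2 ^ n := by
        gcongr
        rw [Finset.prod_const, Finset.card_univ]
        exact (pow_le_pow_left₀ (by norm_num) h1 _).trans
          (pow_le_pow_right₀ (by linarith) hι)
    _ = _ := by rw [← Real.exp_nat_mul, ← Real.exp_add]; congr 1; ring

/-- The operator norm of a random matrix is `O(√n)` with exponentially high probability. -/
theorem measure_opNorm_gt_le {σ q₀ K₀ : ℝ} (hσ : 0 < σ) {μ : Measure ℝ} [IsProbabilityMeasure μ]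
    (hμ : SpreadLaw σ q₀ K₀ μ) {γ ρ : Type*} [Fintype γ] [Fintype ρ] [DecidableEq γ]
    [DecidableEq ρ] {n : ℕ} (hn : 0 < n) (hγ : Fintype.card γ ≤ n) (hρ : Fintype.card ρ ≤ n) :
    (Measure.pi fun _ : γ => Measure.pi fun _ : ρ => μ).real
      {X | (45 + 9 * σ) * √n < opNorm (Matrix.of X)} ≤ Real.exp (-n) := by
  set m := Measure.pi fun _ : γ => Measure.pi fun _ : ρ => μ with hm
  have : IsProbabilityMeasure m := by rw [hm]; infer_instance
  have hn' : (0 : ℝ) < √n := Real.sqrt_pos.2 (by exact_mod_cast hn)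
  have hnn : √(n : ℝ) * √n = n := Real.mul_self_sqrt (Nat.cast_nonneg _)
  set κ := 15 + 3 * σ with hκ
  let Nγ := (crossPolytope (fun _ : γ => (1 : ℝ)) (5 * n)).filter
    fun z => euclNorm (fun j => (z j : ℝ) / (4 * √n)) ≤ 5 / 4
  let Nρ := (crossPolytope (fun _ : ρ => (1 : ℝ)) (5 * n)).filter
    fun z => euclNorm (fun j => (z j : ℝ) / (4 * √n)) ≤ 5 / 4
  let bil : (γ → ℤ) → (ρ → ℤ) → (γ → ρ → ℝ) → ℝ := fun z w X =>
    dotProduct (fun j => (z j : ℝ) / (4 * √n)) ((Matrix.of X).mulVec fun j => (w j : ℝ) / (4 * √n))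
  have hsub : {X : γ → ρ → ℝ | (45 + 9 * σ) * √n < opNorm (Matrix.of X)} ⊆
      ⋃ p ∈ Nγ ×ˢ Nρ, {X | κ * √n ≤ bil p.1 p.2 X} := by
    intro X hX
    by_contra hcon
    simp only [Set.mem_iUnion, Finset.mem_product, not_exists, Set.mem_ofPred_eq, not_le] at hcon
    set s := opNorm (Matrix.of X) with hs
    have hs0 : 0 ≤ s := opNorm_nonneg _
    have hle : s ≤ κ * √n + 9 / 16 * s := by
      have hkey : ∀ (x : γ → ℝ) (y : ρ → ℝ), euclNorm x ≤ 1 → euclNorm y ≤ 1 →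
          dotProduct x ((Matrix.of X).mulVec y) ≤ κ * √n + 9 / 16 * s := by
        intro x y hx hy
        obtain ⟨z, hz, hxz⟩ := exists_grid_approx hn hγ x hx
        obtain ⟨w, hw, hyw⟩ := exists_grid_approx hn hρ y hy
        set x' : γ → ℝ := fun j => (z j : ℝ) / (4 * √n) with hx'
        set y' : ρ → ℝ := fun j => (w j : ℝ) / (4 * √n) with hy'
        have hx'n : euclNorm x' ≤ 5 / 4 := by
          have := euclNorm_sub_le x (x - x')
          rw [sub_sub_cancel] at this; linarith
        have hy'n : euclNorm y' ≤ 5 / 4 := by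
          have := euclNorm_sub_le y (y - y')
          rw [sub_sub_cancel] at this; linarith
        have h1 := hcon (z, w) ⟨Finset.mem_filter.2 ⟨hz, hx'n⟩, Finset.mem_filter.2 ⟨hw, hy'n⟩⟩
        have h2 : dotProduct x ((Matrix.of X).mulVec y) = bil z w X +
            dotProduct (x - x') ((Matrix.of X).mulVec y) +
            dotProduct x' ((Matrix.of X).mulVec (y - y')) := by
          simp only [bil, ← hx', ← hy', Matrix.mulVec_sub, dotProduct_sub, sub_dotProduct]; ring
        have h3 : dotProduct (x - x') ((Matrix.of X).mulVec y) ≤ 1 / 4 * s := by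
          refine (le_abs_self _).trans ((abs_dotProduct_le _ _).trans ?_)
          refine mul_le_mul hxz ((euclNorm_mulVec_le _ _).trans ?_) (euclNorm_nonneg _) (by norm_num)
          nlinarith
        have h4 : dotProduct x' ((Matrix.of X).mulVec (y - y')) ≤ 5 / 4 * (s * (1 / 4)) := by
          refine (le_abs_self _).trans ((abs_dotProduct_le _ _).trans ?_)
          refine mul_le_mul hx'n ((euclNorm_mulVec_le _ _).trans ?_) (euclNorm_nonneg _)
            (by norm_num)
          exact mul_le_mul_of_nonneg_left hyw hs0
        linarith
      exact opNorm_le_of_dotProduct_le (by positivity) hkey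
    have hX' : (45 + 9 * σ) * √n < s := hX
    have : (45 + 9 * σ) * √n = 3 * (κ * √n) := by rw [hκ]; ring
    have : 0 < κ * √n := by positivity
    linarith
  have hpair : ∀ p ∈ Nγ ×ˢ Nρ, m.real {X | κ * √n ≤ bil p.1 p.2 X} ≤ Real.exp (-15 * n) := by
    rintro ⟨z, w⟩ hp
    obtain ⟨hz, hw⟩ := Finset.mem_product.1 hp
    obtain ⟨hI, hle⟩ := integral_exp_bilinear_le hμ (fun j => (z j : ℝ) / (4 * √n))
      (fun j => (w j : ℝ) / (4 * √n)) √n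
    have h1 := measure_ge_le_exp_mul_mgf (μ := m) (X := bil z w) (κ * √n) hn'.le hI
    refine h1.trans ?_
    have h2 : mgf (bil z w) m √n ≤ Real.exp (3 * σ * n) := by
      refine hle.trans (Real.exp_le_exp.2 ?_)
      have hz' := (Finset.mem_filter.1 hz).2
      have hw' := (Finset.mem_filter.1 hw).2
      have e1 : euclNorm (fun j => (z j : ℝ) / (4 * √n)) ^ 2 ≤ (5 / 4) ^ 2 :=
        pow_le_pow_left₀ (euclNorm_nonneg _) hz' 2
      have e2 : euclNorm (fun j => (w j : ℝ) / (4 * √n)) ^ 2 ≤ (5 / 4) ^ 2 :=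
        pow_le_pow_left₀ (euclNorm_nonneg _) hw' 2
      have e3 := mul_le_mul e1 e2 (sq_nonneg _) (by norm_num)
      rw [sq √(n : ℝ), hnn]
      have : 0 < σ * n := by have : (0 : ℝ) < n := by exact_mod_cast hn
                             positivity
      nlinarith
    calc Real.exp (-√n * (κ * √n)) * mgf (bil z w) m √n
        ≤ Real.exp (-√n * (κ * √n)) * Real.exp (3 * σ * n) := by gcongr
      _ = Real.exp (-15 * n) := by
          rw [← Real.exp_add]; congr 1
          rw [hκ]; linear_combination (-(15 + 3 * σ)) * hnn
  calc m.real {X | (45 + 9 * σ) * √n < opNorm (Matrix.of X)}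
      ≤ m.real (⋃ p ∈ Nγ ×ˢ Nρ, {X | κ * √n ≤ bil p.1 p.2 X}) :=
        measureReal_mono hsub (measure_ne_top _ _)
    _ ≤ ∑ p ∈ Nγ ×ˢ Nρ, m.real {X | κ * √n ≤ bil p.1 p.2 X} := measureReal_biUnion_finset_le _ _
    _ ≤ ∑ p ∈ Nγ ×ˢ Nρ, Real.exp (-15 * n) := Finset.sum_le_sum hpair
    _ = Nγ.card * Nρ.card * Real.exp (-15 * n) := by
        rw [Finset.sum_const, Finset.card_product, nsmul_eq_mul]; push_cast; ring
    _ ≤ Real.exp (7 * n) * Real.exp (7 * n) * Real.exp (-15 * n) := by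
        gcongr
        · exact (Nat.cast_le.2 (Finset.card_filter_le _ _)).trans (card_unit_crossPolytope_le hγ)
        · exact (Nat.cast_le.2 (Finset.card_filter_le _ _)).trans (card_unit_crossPolytope_le hρ)
    _ = Real.exp (-n) := by rw [← Real.exp_add, ← Real.exp_add]; congr 1; ring

/-! ### Products of independent blocks -/

/-- The law of a random matrix with independent entries of law `μ`. -/
noncomputable abbrev iidLaw (γ ρ : Type*) [Fintype γ] [Fintype ρ] (μ : Measure ℝ) :
    Measure (γ → ρ → ℝ) :=
  Measure.pi fun _ => Measure.pi fun _ => μ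

/-- The conclusion of `exists_anticoncentration`: no normalized linear combination of independent
variables of law `μ` concentrates at unit scale. -/
def IsAntiConcentrated (c : ℝ) (μ : Measure ℝ) : Prop :=
  ∀ (ι : Type) [Fintype ι] (v : ι → ℝ), 1 ≤ ∑ j, v j ^ 2 → ∀ s : ℝ, 1 ≤ s → ∀ b : ℝ,
    ∫ x : ι → ℝ, Real.exp (-s * (∑ j, x j * v j - b) ^ 2) ∂(Measure.pi fun _ => μ) ≤ Real.exp (-c)

lemma IsAntiConcentrated.isNonConcentrated {c : ℝ} {μ : Measure ℝ} [IsProbabilityMeasure μ]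
    (h : IsAntiConcentrated c μ) : IsNonConcentrated c μ := by
  intro a b ha
  have h1 := h Unit (fun _ => 1) (by simp) a ha b
  have h2 := (measurePreserving_funUnique μ Unit).integral_comp'
    (fun x => Real.exp (-a * (x - b) ^ 2))
  rw [← h2]
  simpa using h1

/-- A symmetric matrix with quadratic form between `ℓ⁻¹ |x|²` and `ℓ |x|²`. -/
structure SpectralBounds {ρ : Type*} [Fintype ρ] (ℓ : ℝ) (S : Matrix ρ ρ ℝ) : Prop where
  symm : S.transpose = S
  le_form : ∀ x : ρ → ℝ, euclNorm x ^ 2 ≤ ℓ * dotProduct x (S.mulVec x)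
  form_le : ∀ x : ρ → ℝ, dotProduct x (S.mulVec x) ≤ ℓ * euclNorm x ^ 2

section SpectralBounds

variable {ρ : Type*} [Fintype ρ] {ℓ : ℝ} {S : Matrix ρ ρ ℝ}

open Matrix in
lemma SpectralBounds.dotProduct_comm (h : SpectralBounds ℓ S) (x y : ρ → ℝ) :
    x ⬝ᵥ S *ᵥ y = y ⬝ᵥ S *ᵥ x := by
  conv_rhs => rw [dotProduct_mulVec, ← mulVec_transpose, h.symm, _root_.dotProduct_comm]

lemma SpectralBounds.euclNorm_le (h : SpectralBounds ℓ S) (hℓ : 0 < ℓ) (x : ρ → ℝ) :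
    euclNorm x ≤ ℓ * euclNorm (S.mulVec x) := by
  have h1 := h.le_form x
  have h2 := (le_abs_self _).trans (abs_dotProduct_le x (S.mulVec x))
  rcases (euclNorm_nonneg x).eq_or_lt with h0 | h0
  · rw [← h0]; exact mul_nonneg hℓ.le (euclNorm_nonneg _)
  · have h3 : euclNorm x * euclNorm x ≤ euclNorm x * (ℓ * euclNorm (S.mulVec x)) := by nlinarith
    exact le_of_mul_le_mul_left h3 h0

lemma SpectralBounds.opNorm_le [DecidableEq ρ] (h : SpectralBounds ℓ S) (hℓ : 0 < ℓ) :
    opNorm S ≤ ℓ := by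
  apply opNorm_le_of_dotProduct_le hℓ.le
  intro x y hx hy
  have h1 : 0 ≤ dotProduct (x - y) (S.mulVec (x - y)) := by
    have := h.le_form (x - y)
    have h2 := sq_nonneg (euclNorm (x - y))
    exact nonneg_of_mul_nonneg_right (h2.trans this) hℓ
  rw [Matrix.mulVec_sub, dotProduct_sub, sub_dotProduct, sub_dotProduct,
    h.dotProduct_comm y x] at h1
  have h3 := h.form_le x
  have h4 := h.form_le y
  have h5 : euclNorm x ^ 2 ≤ 1 := pow_le_one₀ (euclNorm_nonneg _) hx
  have h6 : euclNorm y ^ 2 ≤ 1 := pow_le_one₀ (euclNorm_nonneg _) hy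
  nlinarith

end SpectralBounds

/-- Transposing a random matrix with independent entries preserves its law. -/
lemma measurePreserving_swap_iidLaw (γ ρ : Type*) [Fintype γ] [Fintype ρ] (μ : Measure ℝ)
    [IsProbabilityMeasure μ] :
    MeasurePreserving (fun (X : γ → ρ → ℝ) r j => X j r) (iidLaw γ ρ μ) (iidLaw ρ γ μ) := by
  have hc : ∀ (α β : Type _) [Fintype α] [Fintype β],
      MeasurePreserving (MeasurableEquiv.curry α β ℝ) (Measure.pi fun _ : α × β => μ)
        (iidLaw α β μ) := by
    intro α β _ _
    refine ⟨MeasurableEquiv.measurable _, ?_⟩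
    have := Measure.infinitePi_map_curry (fun (_ : α) (_ : β) => μ)
    simpa only [Measure.infinitePi_eq_pi] using this
  have hc' : MeasurePreserving (MeasurableEquiv.curry ρ γ ℝ) (Measure.pi fun _ : ρ × γ => μ)
        (iidLaw ρ γ μ) := by
    refine ⟨MeasurableEquiv.measurable _, ?_⟩
    have := Measure.infinitePi_map_curry (fun (_ : ρ) (_ : γ) => μ)
    simpa only [Measure.infinitePi_eq_pi] using this
  have h1 := (hc γ ρ).symm
  have h2 := measurePreserving_piCongrLeft (fun _ : ρ × γ => μ) (Equiv.prodComm γ ρ)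
  have h3 := hc'.comp (h2.comp h1)
  exact h3

/-- The entries of `v ᵥ* X` are independent with the law of `∑ v j * x j`. -/
lemma measurePreserving_vecMul {γ ρ : Type*} [Fintype γ] [Fintype ρ] (μ : Measure ℝ)
    [IsProbabilityMeasure μ] (v : γ → ℝ) :
    MeasurePreserving (fun X : γ → ρ → ℝ => Matrix.vecMul v (Matrix.of X)) (iidLaw γ ρ μ)
      (Measure.pi fun _ : ρ => (Measure.pi fun _ : γ => μ).map fun x => ∑ j, x j * v j) := by
  have hm : Measurable fun x : γ → ℝ => ∑ j, x j * v j := by fun_prop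
  have : IsProbabilityMeasure ((Measure.pi fun _ : γ => μ).map fun x => ∑ j, x j * v j) :=
    Measure.isProbabilityMeasure_map hm.aemeasurable
  have h1 : MeasurePreserving (fun (Y : ρ → γ → ℝ) r => ∑ j, Y r j * v j) (iidLaw ρ γ μ)
      (Measure.pi fun _ : ρ => (Measure.pi fun _ : γ => μ).map fun x => ∑ j, x j * v j) :=
    ⟨by fun_prop, Measure.pi_map_pi fun _ => hm.aemeasurable⟩
  have h2 := h1.comp (measurePreserving_swap_iidLaw γ ρ μ)
  convert h2 using 1
  ext X r
  simp [Matrix.vecMul, dotProduct, mul_comm]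

/-- A random matrix rarely shortens a fixed vector `w`: the entries of `X w` are independent and
each is anticoncentrated. -/
lemma integral_exp_neg_mulVec_le {c : ℝ} {μ : Measure ℝ} [IsProbabilityMeasure μ]
    (hμ : IsAntiConcentrated c μ) {γ ρ : Type} [Fintype γ] [Fintype ρ] (w : ρ → ℝ) {s : ℝ}
    (hs : 0 ≤ s) (hw : 1 ≤ s * euclNorm w ^ 2) :
    ∫ X : γ → ρ → ℝ, Real.exp (-s * euclNorm ((Matrix.of X).mulVec w) ^ 2) ∂(iidLaw γ ρ μ) ≤
      Real.exp (-(c * Fintype.card γ)) := by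
  have e : ∀ X : γ → ρ → ℝ, Real.exp (-s * euclNorm ((Matrix.of X).mulVec w) ^ 2) =
      ∏ j, Real.exp (-1 * (∑ r, X j r * (√s * w r) - 0) ^ 2) := by
    intro X
    rw [← Real.exp_sum, euclNorm_sq, Finset.mul_sum]
    congr 1
    refine Finset.sum_congr rfl fun j _ => ?_
    have : ∑ r, X j r * (√s * w r) = √s * (Matrix.of X).mulVec w j := by
      simp only [Matrix.mulVec, dotProduct, Matrix.of_apply, Finset.mul_sum]
      exact Finset.sum_congr rfl fun r _ => by ring
    rw [this, sub_zero, mul_pow, Real.sq_sqrt hs]; ring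
  simp_rw [e]
  rw [integral_fintype_prod_eq_prod (f := fun _ (x : ρ → ℝ) =>
    Real.exp (-1 * (∑ r, x r * (√s * w r) - 0) ^ 2))]
  have h1 := hμ ρ (fun r => √s * w r) (by
    simp_rw [mul_pow, Real.sq_sqrt hs, ← Finset.mul_sum, ← euclNorm_sq]; exact hw) 1 le_rfl 0
  calc _ ≤ ∏ _j : γ, Real.exp (-c) :=
        Finset.prod_le_prod (fun _ _ => integral_nonneg fun _ => (Real.exp_pos _).le) fun _ _ => h1
    _ = _ := by
        rw [Finset.prod_const, Finset.card_univ, ← Real.exp_nat_mul]; congr 1; ring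

/-- The transposed form of `integral_exp_neg_mulVec_le`. -/
lemma integral_exp_neg_vecMul_le {c : ℝ} {μ : Measure ℝ} [IsProbabilityMeasure μ]
    (hμ : IsAntiConcentrated c μ) {γ ρ : Type} [Fintype γ] [Fintype ρ] (v : γ → ℝ) {s : ℝ}
    (hs : 0 ≤ s) (hv : 1 ≤ s * euclNorm v ^ 2) :
    ∫ X : γ → ρ → ℝ, Real.exp (-s * euclNorm (Matrix.vecMul v (Matrix.of X)) ^ 2)
      ∂(iidLaw γ ρ μ) ≤ Real.exp (-(c * Fintype.card ρ)) := by
  rw [← (measurePreserving_swap_iidLaw ρ γ μ).map_eq, integral_map]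
  · refine le_trans (le_of_eq ?_) (integral_exp_neg_mulVec_le (γ := ρ) hμ v hs hv)
    congr 1
    ext X
    rw [← Matrix.vecMul_transpose]
    rfl
  · exact (measurePreserving_swap_iidLaw ρ γ μ).measurable.aemeasurable
  · apply Continuous.aestronglyMeasurable
    have := continuous_euclNorm (ι := ρ)
    have h2 : Continuous fun X : γ → ρ → ℝ => Matrix.vecMul v (Matrix.of X) := by
      simp only [Matrix.vecMul_eq_sum]; fun_prop
    fun_prop

/-- With the two blocks `A`, `B` of a random matrix independent, `v ᵥ* A` is long and `B` maps the
long vector `S *ᵥ (v ᵥ* A)` to a long vector. -/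
lemma integral_exp_neg_two_block_le {c ℓ : ℝ} (hc : 0 < c) (hℓ : 0 < ℓ) {μ : Measure ℝ}
    [IsProbabilityMeasure μ] (hμ : IsAntiConcentrated c μ) {α β ρ : Type} [Fintype α] [Fintype β]
    [Fintype ρ] [Nonempty ρ] {S : Matrix ρ ρ ℝ} (hS : SpectralBounds ℓ S) (v : α → ℝ)
    (hv : 1 / 2 ≤ euclNorm v) :
    ∫ z : (α → ρ → ℝ) × (β → ρ → ℝ), Real.exp (-(8 * ℓ ^ 2 / (c * Fintype.card ρ)) * euclNorm
        ((Matrix.of z.2).mulVec (S.mulVec (Matrix.vecMul v (Matrix.of z.1)))) ^ 2)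
        ∂((iidLaw α ρ μ).prod (iidLaw β ρ μ)) ≤
      Real.exp (-(c * Fintype.card ρ / 2)) + Real.exp (-(c * Fintype.card β)) := by
  have hN : (0 : ℝ) < Fintype.card ρ := by exact_mod_cast Fintype.card_pos
  set s := 8 * ℓ ^ 2 / (c * Fintype.card ρ) with hs
  have hs0 : 0 < s := by positivity
  set F : (α → ρ → ℝ) × (β → ρ → ℝ) → ℝ := fun z => Real.exp (-s * euclNorm
        ((Matrix.of z.2).mulVec (S.mulVec (Matrix.vecMul v (Matrix.of z.1)))) ^ 2) with hF
  have hcont : Continuous F := by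
    have h1 := continuous_euclNorm (ι := β)
    have h2 : Continuous fun z : (α → ρ → ℝ) × (β → ρ → ℝ) =>
        (Matrix.of z.2).mulVec (S.mulVec (Matrix.vecMul v (Matrix.of z.1))) := by
      refine continuous_pi fun j => ?_
      simp only [Matrix.mulVec, dotProduct, Matrix.vecMul, Matrix.of_apply]
      fun_prop
    fun_prop
  have hF1 : ∀ z, F z ≤ 1 := fun z => by
    apply Real.exp_le_one_iff.2
    have : 0 ≤ s * euclNorm
        ((Matrix.of z.2).mulVec (S.mulVec (Matrix.vecMul v (Matrix.of z.1)))) ^ 2 := by positivity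
    linarith
  have hFI : Integrable F ((iidLaw α ρ μ).prod (iidLaw β ρ μ)) :=
    Integrable.of_bound hcont.aestronglyMeasurable 1 (Filter.Eventually.of_forall fun z => by
      rw [Real.norm_eq_abs, abs_of_pos (Real.exp_pos _)]; exact hF1 z)
  have hFe : ∀ A B, F (A, B) = Real.exp (-s * euclNorm
        ((Matrix.of B).mulVec (S.mulVec (Matrix.vecMul v (Matrix.of A)))) ^ 2) := fun _ _ => rfl
  have hF0 : ∀ z, 0 ≤ F z := fun z => (Real.exp_pos _).le
  clear_value F
  rw [integral_prod _ hFI]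
  set bad : Set (α → ρ → ℝ) :=
    {A | euclNorm (Matrix.vecMul v (Matrix.of A)) ^ 2 ≤ c * Fintype.card ρ / 8} with hbad
  have hvc : Continuous fun A : α → ρ → ℝ => euclNorm (Matrix.vecMul v (Matrix.of A)) ^ 2 := by
    have := continuous_euclNorm (ι := ρ)
    have h2 : Continuous fun X : α → ρ → ℝ => Matrix.vecMul v (Matrix.of X) := by
      simp only [Matrix.vecMul_eq_sum]; fun_prop
    fun_prop
  have hbadm : MeasurableSet bad := (isClosed_le hvc continuous_const).measurableSet
  have hbadP : (iidLaw α ρ μ).real bad ≤ Real.exp (-(c * Fintype.card ρ / 2)) := by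
    refine (measure_le_exp_mul_integral (iidLaw α ρ μ) hvc.measurable (fun _ => sq_nonneg _) 4
      (by norm_num) _).trans ?_
    have h1 := integral_exp_neg_vecMul_le (ρ := ρ) hμ v (s := 4) (by norm_num) (by nlinarith)
    calc _ ≤ Real.exp (4 * (c * Fintype.card ρ / 8)) * Real.exp (-(c * Fintype.card ρ)) := by gcongr
      _ = _ := by rw [← Real.exp_add]; congr 1; ring
  have hin : ∀ A, ∫ B, F (A, B) ∂(iidLaw β ρ μ) ≤
      bad.indicator (fun _ => (1 : ℝ)) A + Real.exp (-(c * Fintype.card β)) := by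
    intro A
    by_cases hA : A ∈ bad
    · rw [Set.indicator_of_mem hA]
      have : ∫ B, F (A, B) ∂(iidLaw β ρ μ) ≤ ∫ _B, (1 : ℝ) ∂(iidLaw β ρ μ) := by
        refine integral_mono_of_nonneg (Filter.Eventually.of_forall fun _ => hF0 _)
          (integrable_const _) (Filter.Eventually.of_forall fun B => hF1 (A, B))
      have h2 := Real.exp_pos (-(c * Fintype.card β))
      simp only [integral_const, probReal_univ, smul_eq_mul, mul_one] at this
      linarith
    · rw [Set.indicator_of_notMem hA, zero_add]
      simp_rw [hFe]
      apply integral_exp_neg_mulVec_le hμ _ hs0.le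
      have h1 := hS.euclNorm_le hℓ (Matrix.vecMul v (Matrix.of A))
      have h2 : c * Fintype.card ρ / 8 < euclNorm (Matrix.vecMul v (Matrix.of A)) ^ 2 := not_le.1 hA
      have h3 := pow_le_pow_left₀ (euclNorm_nonneg _) h1 2
      rw [mul_pow] at h3
      rw [hs, div_mul_eq_mul_div, one_le_div (by positivity)]
      linarith
  have hg : Integrable (fun A => bad.indicator (fun _ => (1 : ℝ)) A) (iidLaw α ρ μ) :=
    (integrable_const (1 : ℝ)).indicator hbadm
  calc _ ≤ ∫ A, (bad.indicator (fun _ => (1 : ℝ)) A + Real.exp (-(c * Fintype.card β)))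
        ∂(iidLaw α ρ μ) := integral_mono hFI.integral_prod_left (hg.add (integrable_const _)) hin
    _ = (iidLaw α ρ μ).real bad + Real.exp (-(c * Fintype.card β)) := by
        rw [integral_add hg (integrable_const _), integral_indicator_const _ hbadm]
        simp
    _ ≤ _ := by gcongr

/-! ### Compressible eigenvectors -/

/-- The matrix `X S Xᵀ`; it is `Mᵀ S M` for `M = Xᵀ`. -/
def rowGram {γ ρ : Type*} [Fintype ρ] (S : Matrix ρ ρ ℝ) (X : γ → ρ → ℝ) : Matrix γ γ ℝ :=
  Matrix.of X * S * (Matrix.of X).transpose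

section rowGram

variable {γ ρ : Type*} [Fintype γ] [Fintype ρ]

open Matrix in
lemma rowGram_mulVec (S : Matrix ρ ρ ℝ) (X : γ → ρ → ℝ) (v : γ → ℝ) :
    rowGram S X *ᵥ v = of X *ᵥ (S *ᵥ (v ᵥ* of X)) := by
  rw [rowGram, ← mulVec_mulVec, mulVec_transpose, ← mulVec_mulVec]

lemma opNorm_rowGram_le [DecidableEq γ] [DecidableEq ρ] {ℓ b : ℝ} (hℓ : 0 < ℓ) {S : Matrix ρ ρ ℝ}
    (hS : SpectralBounds ℓ S) {X : γ → ρ → ℝ} (hX : opNorm (Matrix.of X) ≤ b) :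
    opNorm (rowGram S X) ≤ ℓ * b ^ 2 := by
  have hb : 0 ≤ b := (opNorm_nonneg _).trans hX
  calc opNorm (rowGram S X) ≤ opNorm (Matrix.of X * S) * opNorm (Matrix.of X).transpose :=
        opNorm_mul_le _ _
    _ ≤ (opNorm (Matrix.of X) * opNorm S) * opNorm (Matrix.of X) := by
        rw [opNorm_transpose]
        exact mul_le_mul_of_nonneg_right (opNorm_mul_le _ _) (opNorm_nonneg _)
    _ ≤ (b * ℓ) * b := by
        have := opNorm_nonneg (Matrix.of X)
        have := opNorm_nonneg S
        have := hS.opNorm_le hℓ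
        gcongr
    _ = _ := by ring

end rowGram

lemma continuous_rowGram {γ ρ : Type*} [Fintype ρ] (S : Matrix ρ ρ ℝ) :
    Continuous (rowGram S : (γ → ρ → ℝ) → Matrix γ γ ℝ) := by
  refine continuous_matrix fun i j => ?_
  simp only [rowGram, Matrix.mul_apply, Matrix.transpose_apply, Matrix.of_apply]
  fun_prop

/-- For a fixed vector `v` supported in a set of rows, the vector `X S Xᵀ v` is unlikely to be small
on the remaining rows. -/
lemma measure_rowGram_mulVec_compl_le {c ℓ : ℝ} (hc : 0 < c) (hℓ : 0 < ℓ) {μ : Measure ℝ}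
    [IsProbabilityMeasure μ] (hμ : IsAntiConcentrated c μ) {γ ρ : Type} [Fintype γ] [Fintype ρ]
    [Nonempty ρ] {S : Matrix ρ ρ ℝ} (hS : SpectralBounds ℓ S) (v : γ → ℝ)
    (hv : 1 / 2 ≤ euclNorm v) (P : γ → Prop) [DecidablePred P] (hP : ∀ j, ¬ P j → v j = 0)
    {t : ℝ} (ht : 0 ≤ t) :
    (iidLaw γ ρ μ).real {X | euclNorm (fun j : {j // ¬ P j} => (rowGram S X).mulVec v j) ≤ t} ≤
      Real.exp (8 * ℓ ^ 2 / (c * Fintype.card ρ) * t ^ 2) *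
        (Real.exp (-(c * Fintype.card ρ / 2)) + Real.exp (-(c * Fintype.card {j // ¬ P j}))) := by
  set s := 8 * ℓ ^ 2 / (c * Fintype.card ρ) with hs
  have hs0 : 0 ≤ s := by positivity
  let e : {j // P j} ⊕ {j // ¬ P j} ≃ γ := Equiv.sumCompl P
  let w : {j // P j} → ℝ := fun j => v j
  have hw : euclNorm w = euclNorm v := by
    rw [← sq_eq_sq₀ (euclNorm_nonneg _) (euclNorm_nonneg _), euclNorm_sq, euclNorm_sq,
      ← e.sum_comp, Fintype.sum_sum_type]
    have : ∀ b, v (e (Sum.inr b)) = 0 := fun b => hP _ b.2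
    simp only [this]
    simp [w, e]
  set F : ({j // P j} → ρ → ℝ) × ({j // ¬ P j} → ρ → ℝ) → ℝ := fun z => Real.exp (-s * euclNorm
        ((Matrix.of z.2).mulVec (S.mulVec (Matrix.vecMul w (Matrix.of z.1)))) ^ 2) with hF
  have hcont : Continuous F := by
    have h1 := continuous_euclNorm (ι := {j // ¬ P j})
    have h2 : Continuous fun z : ({j // P j} → ρ → ℝ) × ({j // ¬ P j} → ρ → ℝ) =>
        (Matrix.of z.2).mulVec (S.mulVec (Matrix.vecMul w (Matrix.of z.1))) := by
      refine continuous_pi fun j => ?_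
      simp only [Matrix.mulVec, dotProduct, Matrix.vecMul, Matrix.of_apply]
      fun_prop
    fun_prop
  have hsplit : ∀ X : γ → ρ → ℝ, (fun j : {j // ¬ P j} => (rowGram S X).mulVec v j) =
      (Matrix.of fun b => X (e (Sum.inr b))).mulVec
        (S.mulVec (Matrix.vecMul w (Matrix.of fun a => X (e (Sum.inl a))))) := by
    intro X
    have h1 : Matrix.vecMul v (Matrix.of X) =
        Matrix.vecMul w (Matrix.of fun a => X (e (Sum.inl a))) := by
      ext r
      simp only [Matrix.vecMul, dotProduct]
      rw [← e.sum_comp, Fintype.sum_sum_type]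
      have : ∀ b, v (e (Sum.inr b)) = 0 := fun b => hP _ b.2
      simp only [this]
      simp [w, e]
    ext j
    rw [rowGram_mulVec, h1]
    rfl
  have hXc : Continuous fun X : γ → ρ → ℝ =>
      euclNorm (fun j : {j // ¬ P j} => (rowGram S X).mulVec v j) := by
    have h1 := continuous_euclNorm (ι := {j // ¬ P j})
    refine h1.comp (continuous_pi fun j => ?_)
    exact (continuous_apply j.1).comp ((continuous_rowGram S).matrix_mulVec continuous_const)
  have hset : {X : γ → ρ → ℝ | euclNorm (fun j : {j // ¬ P j} => (rowGram S X).mulVec v j) ≤ t} =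
      {X | euclNorm (fun j : {j // ¬ P j} => (rowGram S X).mulVec v j) ^ 2 ≤ t ^ 2} := by
    ext X
    simp only [Set.mem_ofPred_eq]
    rw [sq_le_sq₀ (euclNorm_nonneg _) ht]
  rw [hset]
  refine (measure_le_exp_mul_integral (iidLaw γ ρ μ)
    (f := fun X => euclNorm (fun j : {j // ¬ P j} => (rowGram S X).mulVec v j) ^ 2)
    (hXc.pow 2).measurable (fun _ => sq_nonneg _) s hs0 _).trans ?_
  have h1 := integral_split (Measure.pi fun _ : ρ => μ) e hcont.aestronglyMeasurable
  have h2 := integral_exp_neg_two_block_le hc hℓ hμ hS (β := {j // ¬ P j}) w (hw ▸ hv)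
  have h3 : ∫ X, Real.exp (-s * euclNorm (fun j : {j // ¬ P j} => (rowGram S X).mulVec v j) ^ 2)
      ∂(iidLaw γ ρ μ) = ∫ X : γ → ρ → ℝ, F ((fun a => X (e (Sum.inl a))),
        fun b => X (e (Sum.inr b))) ∂(iidLaw γ ρ μ) := by
    simp_rw [hsplit, hF]
  rw [h3]
  exact mul_le_mul_of_nonneg_left (h1.le.trans h2) (Real.exp_pos _).le

/-- Functions with at most `e` entries different from `none`, and integer entries at most `m` in
absolute value. -/
noncomputable def sparseCodes (γ : Type*) [Fintype γ] [DecidableEq γ] (m e : ℕ) :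
    Finset (γ → Option ℤ) :=
  (Fintype.piFinset fun _ => Finset.insertNone (Finset.Icc (-(m : ℤ)) m)).filter
    fun f => (Finset.univ.filter fun j => f j ≠ none).card ≤ e

lemma card_sparseCodes_le (γ : Type*) [Fintype γ] [DecidableEq γ] [Nonempty γ] (m e : ℕ) :
    ((sparseCodes γ m e).card : ℝ) ≤
      Real.exp (e * Real.log ((2 * m + 1) * Fintype.card γ) + 1) := by
  set p := Fintype.card γ with hp
  have hp0 : (1 : ℝ) ≤ p := by exact_mod_cast Fintype.card_pos (α := γ)
  set t : ℝ := (2 * m + 1) * p with ht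
  have ht1 : 1 ≤ t := by
    have : (0 : ℝ) ≤ m := Nat.cast_nonneg _
    rw [ht]; nlinarith
  have ht0 : 0 < t := by linarith
  let w : γ → Option ℤ → ℝ := fun _ o => o.elim 1 fun _ => t⁻¹
  have hw : ∀ j k, 0 ≤ w j k := by
    intro j k
    cases k <;> simp [w, ht0.le]
  refine (card_le_exp_mul_prod (fun _ => Finset.insertNone (Finset.Icc (-(m : ℤ)) m)) w hw _
    (Finset.filter_subset _ _) (A := e * Real.log t) ?_).trans ?_
  · intro f hf
    have hf2 := (Finset.mem_filter.1 hf).2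
    have h1 : ∏ j, w j (f j) = (t⁻¹) ^ (Finset.univ.filter fun j => f j ≠ none).card := by
      rw [← Finset.prod_const, Finset.prod_filter]
      refine Finset.prod_congr rfl fun j _ => ?_
      cases h : f j <;> simp [w]
    rw [h1, ← mul_neg, Real.exp_nat_mul, Real.exp_neg, Real.exp_log ht0]
    exact pow_le_pow_of_le_one (by positivity) (inv_le_one_of_one_le₀ ht1) hf2
  · rw [Real.exp_add]
    gcongr
    have h2 : ∀ j : γ, ∑ k ∈ Finset.insertNone (Finset.Icc (-(m : ℤ)) m), w j k = 1 + 1 / p := by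
      intro j
      rw [Finset.sum_insertNone]
      simp only [w, Option.elim, Finset.sum_const, Int.card_Icc, nsmul_eq_mul]
      have : (((m : ℤ) + 1 - -(m : ℤ)).toNat : ℝ) = 2 * m + 1 := by
        have : ((m : ℤ) + 1 - -(m : ℤ)).toNat = 2 * m + 1 := by omega
        rw [this]; push_cast; ring
      rw [this, ht]
      field_simp
    simp_rw [h2]
    rw [Finset.prod_const, Finset.card_univ, ← hp]
    calc (1 + 1 / p : ℝ) ^ p ≤ Real.exp (1 / p) ^ p := by
          gcongr
          have := Real.add_one_le_exp (1 / p : ℝ)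
          linarith
      _ = Real.exp 1 := by rw [← Real.exp_nat_mul]; congr 1; field_simp

/-- The size parameters of the argument: `n` is comparable to the 18th power of the scale `q`,
there are `p` columns with `c₁ n ≤ p ≤ n`, and `N` rows with `n - 1 ≤ N ≤ n`. -/
structure Regime (c₁ : ℝ) (q n p N : ℕ) : Prop where
  q_pos : 0 < q
  pow_le : q ^ 18 ≤ n
  le_pow : n ≤ (2 * q) ^ 18
  aspect : c₁ * n ≤ p
  p_le : p ≤ n
  N_le : N ≤ n
  le_N : n ≤ N + 1

/-- The coordinates of `v` exceeding `b` in absolute value. -/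
noncomputable def largeCoords {γ : Type*} [Fintype γ] (b : ℝ) (v : γ → ℝ) : Finset γ :=
  Finset.univ.filter fun j => b < |v j|

lemma card_largeCoords_mul_le {γ : Type*} [Fintype γ] {b : ℝ} (hb : 0 ≤ b) (v : γ → ℝ) :
    (largeCoords b v).card * b ^ 2 ≤ euclNorm v ^ 2 := by
  rw [euclNorm_sq]
  calc (largeCoords b v).card * b ^ 2 = ∑ j ∈ largeCoords b v, b ^ 2 := by simp
    _ ≤ ∑ j ∈ largeCoords b v, v j ^ 2 := Finset.sum_le_sum fun j hj => by
        rw [← sq_abs (v j)]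
        exact pow_le_pow_left₀ hb (Finset.mem_filter.1 hj).2.le 2
    _ ≤ _ := Finset.sum_le_sum_of_subset_of_nonneg (Finset.subset_univ _) fun i _ _ => sq_nonneg _

lemma Regime.card_largeCoords_le {c₁ : ℝ} {q n p N : ℕ} (h : Regime c₁ q n p N) {γ : Type*}
    [Fintype γ] {v : γ → ℝ} (hv : euclNorm v ≤ 1) :
    (largeCoords (q / √n) v).card ≤ n / q ^ 2 := by
  have hq := h.q_pos
  have hn : 0 < n := lt_of_lt_of_le (by positivity) h.pow_le
  have h1 := card_largeCoords_mul_le (b := q / √n) (by positivity) v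
  rw [Nat.le_div_iff_mul_le (by positivity)]
  rw [div_pow, Real.sq_sqrt (Nat.cast_nonneg _)] at h1
  have h2 : euclNorm v ^ 2 ≤ 1 := pow_le_one₀ (euclNorm_nonneg _) hv
  have h3 := h1.trans h2
  have hn' : (0 : ℝ) < n := by exact_mod_cast hn
  rw [← mul_div_assoc, div_le_one hn'] at h3
  exact_mod_cast h3

lemma Regime.log_le {c₁ : ℝ} {q n p N : ℕ} (h : Regime c₁ q n p N) : Real.log n ≤ 36 * q := by
  have hq := h.q_pos
  have hn : 0 < n := lt_of_lt_of_le (by positivity) h.pow_le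
  have h1 : (n : ℝ) ≤ (2 * q : ℝ) ^ 18 := by exact_mod_cast h.le_pow
  calc Real.log n ≤ Real.log ((2 * q : ℝ) ^ 18) := Real.log_le_log (by exact_mod_cast hn) h1
    _ = 18 * Real.log (2 * q) := by rw [Real.log_pow]; norm_num
    _ ≤ 18 * (2 * q) := by
        have := Real.log_le_self (show (0 : ℝ) ≤ 2 * q by positivity)
        linarith
    _ = _ := by ring

set_option maxHeartbeats 1000000 in
/-- An eigenvector of `X S Xᵀ` is rarely carried, up to a vector of norm `1 / q`, by its large
coordinates. -/
theorem exists_measure_compressible_le {c c₁ ℓ K : ℝ} (hc : 0 < c) (hc₁ : 0 < c₁) (hℓ : 0 < ℓ)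
    (hK : 0 < K) :
    ∃ q₁ : ℕ, ∀ q n : ℕ, q₁ ≤ q → ∀ (γ ρ : Type) [Fintype γ] [Fintype ρ] [DecidableEq γ]
      [DecidableEq ρ], Regime c₁ q n (Fintype.card γ) (Fintype.card ρ) →
      ∀ (μ : Measure ℝ) [IsProbabilityMeasure μ], IsAntiConcentrated c μ →
      ∀ S : Matrix ρ ρ ℝ, SpectralBounds ℓ S →
      (iidLaw γ ρ μ).real {X | opNorm (Matrix.of X) ≤ K * √n ∧ ∃ (lam : ℝ) (v : γ → ℝ),
        euclNorm v = 1 ∧ (rowGram S X).mulVec v = lam • v ∧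
        ∑ j ∈ (largeCoords (q / √n) v)ᶜ, v j ^ 2 ≤ (1 / q) ^ 2} ≤
          Real.exp (-(c * c₁ / 8) * n) := by
  set G : ℝ := 144 * ℓ ^ 4 * K ^ 4 / c with hG
  obtain ⟨q₁, hq₁⟩ := exists_nat_ge (max 4 (max (2 / c₁) (8 * (114 + G) / (c * c₁))))
  refine ⟨q₁, fun q n hq γ ρ _ _ _ _ hR μ _ hμ S hS => ?_⟩
  have hqR : (max 4 (max (2 / c₁) (8 * (114 + G) / (c * c₁)))) ≤ (q : ℝ) :=
    hq₁.trans (by exact_mod_cast hq)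
  have hq4 : (4 : ℝ) ≤ q := (le_max_left _ _).trans hqR
  have hq2 : 2 / c₁ ≤ (q : ℝ) := (le_max_left _ _).trans ((le_max_right _ _).trans hqR)
  have hq3 : 8 * (114 + G) / (c * c₁) ≤ (q : ℝ) :=
    (le_max_right _ _).trans ((le_max_right _ _).trans hqR)
  have hq0 : (0 : ℝ) < q := by linarith
  have hqn : q ≤ n := (Nat.le_self_pow (by norm_num) q).trans hR.pow_le
  have hqn' : (q : ℝ) ≤ n := by exact_mod_cast hqn
  have hn0 : (0 : ℝ) < n := hq0.trans_le hqn'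
  have hnn : √(n : ℝ) * √n = n := Real.mul_self_sqrt (Nat.cast_nonneg _)
  have hsn : 0 < √(n : ℝ) := Real.sqrt_pos.2 hn0
  set p := Fintype.card γ with hp
  set N := Fintype.card ρ with hN
  have hpn : (p : ℝ) ≤ n := by exact_mod_cast hR.p_le
  have hc₁1 : c₁ ≤ 1 := by
    have := hR.aspect.trans hpn
    nlinarith
  have hN2 : (n : ℝ) / 2 ≤ N := by
    have : (n : ℝ) ≤ N + 1 := by exact_mod_cast hR.le_N
    linarith
  have hp0 : (0 : ℝ) < p := lt_of_lt_of_le (by positivity) hR.aspect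
  have hneρ : Nonempty ρ := Fintype.card_pos_iff.1 (by
    rw [← hN]; have : (0 : ℝ) < N := by linarith
    exact_mod_cast this)
  have hneγ : Nonempty γ := Fintype.card_pos_iff.1 (by rw [← hp]; exact_mod_cast hp0)
  set t : ℝ := 3 * ℓ * K ^ 2 * n / q with ht
  set e : ℕ := n / q ^ 2 with he
  have heR : (e : ℝ) ≤ n / q ^ 2 := by
    have := Nat.cast_div_le (α := ℝ) (m := n) (n := q ^ 2)
    rw [he]; push_cast at this; exact this
  -- A code records the support of the large coordinates and their roundings at scale `1 / √n`.
  let dec : (γ → Option ℤ) → γ → ℝ := fun f j => (f j).elim 0 fun z => z / √n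
  set C := (sparseCodes γ (n + 1) e).filter fun f => 1 / 2 ≤ euclNorm (dec f) with hC
  let bad : (γ → Option ℤ) → Set (γ → ρ → ℝ) := fun f =>
    {X | euclNorm (fun j : {j // ¬ (f j ≠ none)} => (rowGram S X).mulVec (dec f) j) ≤ t}
  have hsub : {X : γ → ρ → ℝ | opNorm (Matrix.of X) ≤ K * √n ∧ ∃ (lam : ℝ) (v : γ → ℝ),
        euclNorm v = 1 ∧ (rowGram S X).mulVec v = lam • v ∧
        ∑ j ∈ (largeCoords (q / √n) v)ᶜ, v j ^ 2 ≤ (1 / q) ^ 2} ⊆ ⋃ f ∈ C, bad f := by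
    rintro X ⟨hX, lam, v, hv, hev, hcomp⟩
    set E := largeCoords (q / √n) v with hE
    have hEc : E.card ≤ e := hR.card_largeCoords_le hv.le
    have hEn : (E.card : ℝ) ≤ n / q ^ 2 := le_trans (by exact_mod_cast hEc) heR
    let f : γ → Option ℤ := fun j => if j ∈ E then some ⌊v j * √n⌋ else none
    have hfE : ∀ j, f j ≠ none ↔ j ∈ E := fun j => by by_cases hj : j ∈ E <;> simp [f, hj]
    have hv1 : ∀ j, |v j| ≤ 1 := fun j => by
      rw [← sq_le_one_iff_abs_le_one, ← one_pow 2, ← hv, euclNorm_sq]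
      exact Finset.single_le_sum (f := fun j => v j ^ 2) (fun i _ => sq_nonneg _) (Finset.mem_univ j)
    have hdecE : ∀ j ∈ E, |v j - dec f j| ≤ 1 / √n := by
      intro j hj
      have e1 : dec f j = ⌊v j * √n⌋ / √n := by simp [dec, f, hj]
      have e2 : v j - ⌊v j * √n⌋ / √n = (v j * √n - ⌊v j * √n⌋) / √n := by field_simp
      rw [e1, e2, abs_div, abs_of_pos hsn]
      gcongr
      rw [abs_le]
      constructor <;> linarith [Int.floor_le (v j * √n), Int.lt_floor_add_one (v j * √n)]
    have hdecN : ∀ j, j ∉ E → dec f j = 0 := fun j hj => by simp [dec, f, hj]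
    -- Both the small coordinates and the rounding errors on the sparse set contribute `1 / q`.
    have hdist : euclNorm (v - dec f) ≤ 2 / q := by
      rw [euclNorm_le_iff (by positivity), ← Finset.sum_add_sum_compl E]
      have h1 : ∑ j ∈ E, (v - dec f) j ^ 2 ≤ (1 / q) ^ 2 := by
        calc ∑ j ∈ E, (v - dec f) j ^ 2 ≤ ∑ j ∈ E, (1 / √n) ^ 2 :=
              Finset.sum_le_sum fun j hj => by
                rw [← sq_abs]; exact pow_le_pow_left₀ (abs_nonneg _) (hdecE j hj) 2
          _ = E.card * (1 / n) := by
              rw [Finset.sum_const, nsmul_eq_mul, div_pow, Real.sq_sqrt hn0.le, one_pow]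
          _ ≤ n / q ^ 2 * (1 / n) := by gcongr
          _ = _ := by field_simp
      have h2 : ∑ j ∈ Eᶜ, (v - dec f) j ^ 2 ≤ (1 / q) ^ 2 := by
        refine le_trans (le_of_eq ?_) hcomp
        refine Finset.sum_congr rfl fun j hj => ?_
        rw [Pi.sub_apply, hdecN j (Finset.mem_compl.1 hj), sub_zero]
      have h3 : (2 / q : ℝ) ^ 2 = 4 * (1 / q) ^ 2 := by ring
      have h4 : (0 : ℝ) ≤ (1 / q) ^ 2 := sq_nonneg _
      linarith
    have h2q : (2 / q : ℝ) ≤ 1 / 2 := by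
      rw [div_le_div_iff₀ hq0 (by norm_num)]; linarith
    have hfC : f ∈ C := by
      refine Finset.mem_filter.2 ⟨Finset.mem_filter.2 ⟨?_, ?_⟩, ?_⟩
      · rw [Fintype.mem_piFinset]
        intro j
        rw [Finset.mem_insertNone]
        intro z hz
        by_cases hj : j ∈ E
        · have hz' : z = ⌊v j * √n⌋ := by
            have : f j = some ⌊v j * √n⌋ := by simp [f, hj]
            rw [this] at hz
            simpa using hz.symm
          have h1 : |v j * √n| ≤ n := by
            rw [abs_mul, abs_of_pos hsn]
            have h2 : √(n : ℝ) ≤ n := by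
              rw [Real.sqrt_le_left hn0.le]
              have : (1 : ℝ) ≤ n := by linarith
              nlinarith
            have := hv1 j
            nlinarith [abs_nonneg (v j)]
          have h3 := abs_le.1 h1
          rw [hz', Finset.mem_Icc]
          constructor
          · apply Int.le_floor.2
            push_cast; linarith
          · apply (Int.floor_le_iff).2
            push_cast; linarith
        · simp [f, hj] at hz
      · have : (Finset.univ.filter fun j => f j ≠ none) = E := by
          ext j; simp only [Finset.mem_filter, Finset.mem_univ, true_and]; exact hfE j
        rw [this]; exact hEc
      · have := euclNorm_add_le (v - dec f) (dec f)
        rw [sub_add_cancel, hv] at this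
        linarith
    refine Set.mem_biUnion hfC ?_
    change euclNorm (fun j : {j // ¬ (f j ≠ none)} => (rowGram S X).mulVec (dec f) j) ≤ t
    have hW := opNorm_rowGram_le hℓ hS hX
    have hW' : opNorm (rowGram S X) ≤ ℓ * K ^ 2 * n := by
      refine hW.trans (le_of_eq ?_)
      rw [mul_pow, Real.sq_sqrt hn0.le]; ring
    have hlam : |lam| ≤ ℓ * K ^ 2 * n := by
      have h1 := euclNorm_mulVec_le (rowGram S X) v
      rw [hev, euclNorm_smul, hv, mul_one, mul_one] at h1
      exact h1.trans hW'
    have hinj : Function.Injective fun j : {j // ¬ (f j ≠ none)} => (j : γ) := Subtype.val_injective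
    have e1 : (fun j : {j // ¬ (f j ≠ none)} => (rowGram S X).mulVec (dec f) j) =
        lam • (fun j : {j // ¬ (f j ≠ none)} => v j) -
        ((rowGram S X).mulVec (v - dec f)) ∘ fun j : {j // ¬ (f j ≠ none)} => (j : γ) := by
      ext j
      simp only [Pi.sub_apply, Pi.smul_apply, Function.comp_apply, Matrix.mulVec_sub, hev]
      ring
    rw [e1]
    refine (euclNorm_sub_le _ _).trans ?_
    have h5 : euclNorm (lam • (fun j : {j // ¬ (f j ≠ none)} => v j)) ≤
        ℓ * K ^ 2 * n * (1 / q) := by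
      rw [euclNorm_smul]
      refine mul_le_mul hlam ?_ (euclNorm_nonneg _) (by positivity)
      rw [euclNorm_le_iff (by positivity)]
      refine le_trans (le_of_eq ?_) hcomp
      rw [Finset.sum_subtype (p := fun j => ¬ (f j ≠ none))]
      intro j
      rw [Finset.mem_compl, hfE]
    have h6 : euclNorm (((rowGram S X).mulVec (v - dec f)) ∘
        fun j : {j // ¬ (f j ≠ none)} => (j : γ)) ≤ ℓ * K ^ 2 * n * (2 / q) :=
      (euclNorm_comp_le hinj _).trans ((euclNorm_mulVec_le _ _).trans
        (mul_le_mul hW' hdist (euclNorm_nonneg _) (by positivity)))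
    refine (add_le_add h5 h6).trans (le_of_eq ?_)
    rw [ht]; ring
  have hq2' : n / (q : ℝ) ^ 2 ≤ n * c₁ / 2 := by
    rw [div_le_div_iff₀ (by positivity) (by norm_num)]
    have h1 : 2 ≤ (q : ℝ) * c₁ := by rwa [div_le_iff₀ hc₁] at hq2
    have h2 : 2 ≤ c₁ * (q : ℝ) ^ 2 := by nlinarith
    nlinarith
  -- Outside its support a decoded vector vanishes, so the eigenvalue drops out of the equation
  -- there.
  have hfix : ∀ f ∈ C, (iidLaw γ ρ μ).real (bad f) ≤ 2 * Real.exp (G * n / q - c * c₁ * n / 4) := by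
    intro f hf
    obtain ⟨hf1, hf2⟩ := Finset.mem_filter.1 hf
    have hf3 := (Finset.mem_filter.1 hf1).2
    have h1 := measure_rowGram_mulVec_compl_le hc hℓ hμ hS (dec f) hf2 (fun j => f j ≠ none)
      (fun j hj => by simp only [ne_eq, not_not] at hj; simp [dec, hj]) (t := t) (by positivity)
    refine h1.trans ?_
    have hcard : (n : ℝ) * c₁ / 2 ≤ Fintype.card {j // ¬ (f j ≠ none)} := by
      have h2 := Fintype.card_subtype_compl (fun j => f j ≠ none)
      rw [Fintype.card_subtype (fun j => f j ≠ none)] at h2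
      have h3 : (Fintype.card γ : ℝ) - e ≤ Fintype.card {j // ¬ (f j ≠ none)} := by
        rw [h2]
        have : Fintype.card γ ≤ (Fintype.card γ - (Finset.univ.filter fun j => f j ≠ none).card) + e := by
          omega
        have : (Fintype.card γ : ℝ) ≤
          ((Fintype.card γ - (Finset.univ.filter fun j => f j ≠ none).card : ℕ) : ℝ) + e := by
          exact_mod_cast this
        linarith
      have h4 := hR.aspect
      linarith
    have hs : 8 * ℓ ^ 2 / (c * N) * t ^ 2 ≤ G * n / q := by
      calc 8 * ℓ ^ 2 / (c * N) * t ^ 2 ≤ 8 * ℓ ^ 2 / (c * (n / 2)) * t ^ 2 := by gcongr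
        _ = G * n / q ^ 2 := by rw [hG, ht]; field_simp; ring
        _ ≤ G * n / q := by
            have : 0 ≤ G * n := by positivity
            apply div_le_div_of_nonneg_left this hq0
            nlinarith
    have e1 : Real.exp (-(c * N / 2)) ≤ Real.exp (-(c * c₁ * n / 4)) := by
      apply Real.exp_le_exp.2
      have : c * c₁ * n ≤ c * n := by nlinarith [mul_pos hc hn0]
      nlinarith
    have e2 : Real.exp (-(c * Fintype.card {j // ¬ (f j ≠ none)})) ≤
        Real.exp (-(c * c₁ * n / 4)) := by
      apply Real.exp_le_exp.2
      have : 0 < c * c₁ * n := by positivity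
      nlinarith
    calc _ ≤ Real.exp (G * n / q) * (Real.exp (-(c * c₁ * n / 4)) + Real.exp (-(c * c₁ * n / 4))) := by
          gcongr
      _ = _ := by
          rw [← two_mul, sub_eq_add_neg, Real.exp_add]; ring
  have hcardC : (C.card : ℝ) ≤ Real.exp (112 * n / q + 1) := by
    have h1 : (C.card : ℝ) ≤ (sparseCodes γ (n + 1) e).card := by
      exact_mod_cast Finset.card_filter_le _ _
    refine h1.trans ((card_sparseCodes_le γ (n + 1) e).trans (Real.exp_le_exp.2 ?_))
    have h2 : Real.log ((2 * ((n + 1 : ℕ) : ℝ) + 1) * p) ≤ 112 * q := by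
      have h3 : (2 * ((n + 1 : ℕ) : ℝ) + 1) * p ≤ (n : ℝ) ^ 3 := by
        push_cast
        have h4 : (4 : ℝ) ≤ n := hq4.trans hqn'
        have h5 : (2 * ((n : ℝ) + 1) + 1) * p ≤ (2 * (n + 1) + 1) * n := by gcongr
        have h6 : 2 * ((n : ℝ) + 1) + 1 ≤ n ^ 2 := by nlinarith
        calc _ ≤ (2 * ((n : ℝ) + 1) + 1) * n := h5
          _ ≤ (n : ℝ) ^ 2 * n := by gcongr
          _ = _ := by ring
      have h6 := Real.log_le_log (by positivity) h3
      rw [Real.log_pow] at h6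
      have := hR.log_le
      push_cast at h6
      push_cast
      linarith
    have h7 : (e : ℝ) * Real.log ((2 * ((n + 1 : ℕ) : ℝ) + 1) * p) ≤ n / q ^ 2 * (112 * q) := by
      have : (0 : ℝ) ≤ e := Nat.cast_nonneg _
      calc _ ≤ (e : ℝ) * (112 * q) := by gcongr
        _ ≤ _ := by gcongr
    have h8 : (n : ℝ) / q ^ 2 * (112 * q) = 112 * n / q := by field_simp
    linarith
  calc (iidLaw γ ρ μ).real _ ≤ (iidLaw γ ρ μ).real (⋃ f ∈ C, bad f) :=
        measureReal_mono hsub (measure_ne_top _ _)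
    _ ≤ ∑ f ∈ C, (iidLaw γ ρ μ).real (bad f) := measureReal_biUnion_finset_le _ _
    _ ≤ ∑ f ∈ C, 2 * Real.exp (G * n / q - c * c₁ * n / 4) := Finset.sum_le_sum hfix
    _ = C.card * (2 * Real.exp (G * n / q - c * c₁ * n / 4)) := by
        rw [Finset.sum_const, nsmul_eq_mul]
    _ ≤ Real.exp (112 * n / q + 1) * (Real.exp 1 * Real.exp (G * n / q - c * c₁ * n / 4)) := by
        have : (2 : ℝ) ≤ Real.exp 1 := by have := Real.add_one_le_exp (1 : ℝ); linarith
        gcongr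
    _ ≤ Real.exp (-(c * c₁ / 8) * n) := by
        rw [← Real.exp_add, ← Real.exp_add]
        apply Real.exp_le_exp.2
        have h1 : (114 + G) * n / q ≤ c * c₁ * n / 8 := by
          rw [div_le_iff₀ (by positivity)] at hq3
          rw [div_le_div_iff₀ hq0 (by norm_num)]
          nlinarith
        have h2 : (1 : ℝ) ≤ n / q := by rwa [one_le_div hq0]
        have h3 : (114 + G) * n / q = 112 * n / q + 2 * (n / q) + G * n / q := by ring
        nlinarith

/-! ### Parameters of the structured case -/

lemma Regime.n_pos {c₁ : ℝ} {q n p N : ℕ} (h : Regime c₁ q n p N) : 0 < n :=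
  lt_of_lt_of_le (pow_pos h.q_pos 18) h.pow_le

lemma Regime.pow_nine_le_sqrt {c₁ : ℝ} {q n p N : ℕ} (h : Regime c₁ q n p N) :
    (q : ℝ) ^ 9 ≤ √n := by
  apply Real.le_sqrt_of_sq_le
  rw [← pow_mul]
  exact_mod_cast h.pow_le

lemma Regime.sqrt_le {c₁ : ℝ} {q n p N : ℕ} (h : Regime c₁ q n p N) :
    √(n : ℝ) ≤ (2 * q) ^ 9 := by
  rw [Real.sqrt_le_left (by positivity), ← pow_mul]
  exact_mod_cast h.le_pow

lemma four_pow_le_exp (q : ℕ) : (4 : ℝ) ^ q ≤ Real.exp (2 * q) := by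
  have h : (4 : ℝ) ≤ Real.exp 2 := by
    have h1 := Real.add_one_le_exp (1 : ℝ)
    have h2 : Real.exp 2 = Real.exp 1 * Real.exp 1 := by rw [← Real.exp_add]; norm_num
    nlinarith
  calc (4 : ℝ) ^ q ≤ Real.exp 2 ^ q := by gcongr
    _ = _ := by rw [← Real.exp_nat_mul]; congr 1; ring

/-- The largest scale considered is at most exponential in `q`. -/
lemma Regime.scale_le_exp {c₁ D : ℝ} {q n p N : ℕ} (h : Regime c₁ q n p N)
    (hD : D ≤ 4 ^ q * (√n / (2 * q))) : D ≤ Real.exp (20 * q) := by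
  have hq : (1 : ℝ) ≤ q := by exact_mod_cast h.q_pos
  have h1 : √(n : ℝ) / (2 * q) ≤ (2 * q) ^ 9 :=
    (div_le_self (Real.sqrt_nonneg _) (by linarith)).trans h.sqrt_le
  have h2 : (2 * q : ℝ) ≤ Real.exp (2 * q) := by
    have := Real.add_one_le_exp (2 * q : ℝ); linarith
  calc D ≤ Real.exp (2 * q) * Real.exp (2 * q) ^ 9 := by
        refine hD.trans (mul_le_mul (four_pow_le_exp q) (h1.trans ?_) (by positivity) (by positivity))
        gcongr
    _ = Real.exp (20 * q) := by
        rw [← Real.exp_nat_mul, ← Real.exp_add]; congr 1; push_cast; ring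

/-- Small-ball estimate in power form for a vector without arithmetic structure below scale `D`,
in the sense of `small_ball_of_unstructured` with the parameters of `Regime`. -/
lemma exists_small_ball_power {q₀ K₀ : ℝ} (hq₀ : 0 < q₀) (hK₀ : 1 ≤ K₀) :
    ∃ (Γ₀ : ℝ) (q₁ : ℕ), 0 < Γ₀ ∧ ∀ (q n p N : ℕ) (c₁ : ℝ), q₁ ≤ q → Regime c₁ q n p N →
      ∀ (σ : ℝ) (μ : Measure ℝ) [IsProbabilityMeasure μ], SpreadLaw σ q₀ K₀ μ →
      ∀ (ι : Type) [Fintype ι] (w : ι → ℝ) (A B : Finset ι) (D : ℝ), 0 < D →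
        D ≤ 4 ^ q * (√n / (2 * q)) →
        (∀ j ∈ A, |w j| ≤ q / √n) → (1 / q ^ 2) ^ 2 ≤ ∑ j ∈ A, w j ^ 2 →
        (∀ θ : ℝ, √n / (2 * q) ≤ θ → θ ≤ D →
          (q : ℝ) ^ 2 ≤ ∑ j ∈ B, (1 - Real.cos (2 * Real.pi * θ * w j))) →
        ∀ a b : ℝ, 0 < a → a ≤ (D / (q * K₀)) ^ 2 →
          ∫ x : ι → ℝ, Real.exp (-a * (∑ j, x j * w j - b) ^ 2) ∂(Measure.pi fun _ => μ) ≤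
            Γ₀ * q ^ 2 * a ^ (-(1 / 2 : ℝ)) := by
  set κ := min (q₀ / 2) (1 / 4) with hκ
  have hκ0 : 0 < κ := by positivity
  obtain ⟨q₁, hq₁⟩ := exists_nat_ge (max 2 (20 / κ))
  refine ⟨Real.pi / √q₀ + 1, q₁, by positivity, ?_⟩
  intro q n p N c₁ hq hR σ μ _ hμ ι _ w A B D hD0 hD hA hAρ hB a b ha haD
  have hqR : max 2 (20 / κ) ≤ (q : ℝ) := hq₁.trans (by exact_mod_cast hq)
  have hq2 : (2 : ℝ) ≤ q := (le_max_left _ _).trans hqR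
  have hqκ : 20 / κ ≤ (q : ℝ) := (le_max_right _ _).trans hqR
  have hq0 : (0 : ℝ) < q := by linarith
  have hn0 : (0 : ℝ) < n := by exact_mod_cast hR.n_pos
  have hsn : 0 < √(n : ℝ) := Real.sqrt_pos.2 hn0
  have hsa : √a ≤ D / (q * K₀) := by
    rw [Real.sqrt_le_left (by positivity)]; exact haD
  have hsa0 : 0 < √a := Real.sqrt_pos.2 ha
  have h1 := small_ball_of_unstructured hq₀ hμ w A B (θ₁ := √n / (2 * q)) (D := D)
    (ρ := 1 / q ^ 2) (H := q ^ 2) (s := a) (R := q) (by positivity) (by positivity) ha hq0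
    (fun j hj => (hA j hj).trans (le_of_eq (by field_simp))) hAρ hB ?_ b
  · refine h1.trans ?_
    have hrp : a ^ (-(1 / 2 : ℝ)) = 1 / √a := by
      rw [Real.rpow_neg ha.le, Real.sqrt_eq_rpow, one_div]; norm_num
    rw [hrp]
    have e1 : Real.pi / (1 / (q : ℝ) ^ 2 * √(q₀ * a)) = Real.pi / √q₀ * q ^ 2 * (1 / √a) := by
      rw [Real.sqrt_mul hq₀.le]; field_simp
    have e2 : Real.exp (-(q₀ * (q : ℝ) ^ 2 / 2)) ≤ Real.exp (-(κ * q ^ 2)) := by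
      apply Real.exp_le_exp.2
      have : κ ≤ q₀ / 2 := min_le_left _ _
      nlinarith [sq_nonneg (q : ℝ)]
    have e3 : Real.exp (-((q : ℝ) ^ 2 / 4)) ≤ Real.exp (-(κ * q ^ 2)) := by
      apply Real.exp_le_exp.2
      have : κ ≤ 1 / 4 := min_le_right _ _
      nlinarith [sq_nonneg (q : ℝ)]
    have e4 : √a * Real.exp (-(κ * q ^ 2)) ≤ 1 := by
      have h2 : √a ≤ Real.exp (20 * q) := by
        refine hsa.trans ((div_le_self hD0.le ?_).trans (hR.scale_le_exp hD))
        nlinarith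
      calc √a * Real.exp (-(κ * q ^ 2)) ≤ Real.exp (20 * q) * Real.exp (-(κ * q ^ 2)) := by gcongr
        _ = Real.exp (20 * q - κ * q ^ 2) := by rw [← Real.exp_add]; ring_nf
        _ ≤ 1 := by
          apply Real.exp_le_one_iff.2
          rw [div_le_iff₀ hκ0] at hqκ
          nlinarith
    have e5 : Real.exp (-(κ * q ^ 2)) ≤ 1 / √a := by
      rw [le_div_iff₀ hsa0]; linarith
    have e6 : √2 ≤ (3 : ℝ) / 2 := by
      rw [Real.sqrt_le_left (by norm_num)]; norm_num
    have e7 : (4 : ℝ) ≤ (q : ℝ) ^ 2 := by nlinarith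
    have e8 : 0 < 1 / √a := by positivity
    rw [e1]
    have e9 : √2 * Real.exp (-((q : ℝ) ^ 2 / 4)) ≤ 3 / 2 * (1 / √a) :=
      mul_le_mul e6 (e3.trans e5) (Real.exp_pos _).le (by norm_num)
    have e10 : (4 : ℝ) * (1 / √a) ≤ (q : ℝ) ^ 2 * (1 / √a) := by gcongr
    have e11 := e2.trans e5
    calc _ ≤ Real.pi / √q₀ * q ^ 2 * (1 / √a) + 1 / √a + 3 / 2 * (1 / √a) := by gcongr
      _ ≤ Real.pi / √q₀ * q ^ 2 * (1 / √a) + q ^ 2 * (1 / √a) := by linarith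
      _ = _ := by ring
  · have hK0 : 0 < K₀ := by linarith
    rw [Real.sqrt_mul (by norm_num)]
    have h2 : √2 ≤ 2 * Real.pi := by
      have : √2 ≤ (2 : ℝ) := by rw [Real.sqrt_le_left (by norm_num)]; norm_num
      have := Real.pi_gt_three
      linarith
    calc √2 * √a * q * K₀ ≤ √2 * (D / (q * K₀)) * q * K₀ := by gcongr
      _ = √2 * D := by field_simp
      _ ≤ _ := by gcongr

open Matrix in
/-- With high probability the rows of `B S` span a large volume. -/
lemma measure_det_lt_le {c ℓ : ℝ} (hc : 0 < c) (hℓ : 0 < ℓ) (ν : Measure ℝ)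
    [IsProbabilityMeasure ν] (hν : IsNonConcentrated c ν) {d k : ℕ} {ρ : Type*} [Fintype ρ]
    [DecidableEq ρ] (hk : d + k ≤ Fintype.card ρ + 1) {B : ℝ} (hB : 1 < B)
    (hch : ((Fintype.card ρ).choose k : ℝ) ≤ B ^ k) {r : ℝ} (hr0 : 0 < r)
    (hr : B ^ 2 * r ≤ c * k / 4) {S : Matrix ρ ρ ℝ} (hS : SpectralBounds ℓ S) :
    (iidLaw (Fin d) ρ ν).real {X | (of X * S * (of X * S)ᵀ).det < (r / ℓ ^ 2) ^ d} ≤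
      d * Real.exp (-(c * k / 4)) := by
  refine le_trans (measureReal_mono ?_ (measure_ne_top _ _))
    (measure_exists_short_combination_le hc ν hν hk hB hch hr)
  intro X hX
  by_contra hcon
  simp only [Set.mem_ofPred_eq, not_exists, not_and, not_lt] at hcon hX
  refine absurd hX (not_lt.2 (pow_le_det_mul_transpose (by positivity) _ ?_))
  intro j a ha
  have h1 := hcon j a ha
  have h2 : ∑ i, (∑ l, a l * X l i) ^ 2 = euclNorm (a ᵥ* of X) ^ 2 := by
    rw [euclNorm_sq]; rfl
  have h3 := hS.euclNorm_le hℓ (a ᵥ* of X)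
  have h4 : a ᵥ* (of X * S) = S *ᵥ (a ᵥ* of X) := by
    rw [← vecMul_vecMul, ← mulVec_transpose, hS.symm]
  rw [← euclNorm_sq, h4, div_le_iff₀ (by positivity)]
  have h5 := pow_le_pow_left₀ (euclNorm_nonneg _) h3 2
  rw [h2] at h1
  rw [mul_pow] at h5
  linarith

open Matrix in
/-- For a fixed vector `w` with a power small-ball bound, the image of the random vector `w ᵥ* A`
under the independent random map `B S` is rarely near a target depending on `B` only. -/
lemma measure_two_block_near_le {ℓ Γ amax b s η D₀ : ℝ} (hℓ : 0 < ℓ) (hΓ : 0 ≤ Γ) (hs : 0 < s)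
    (hη : 0 ≤ η) (hD₀ : 0 < D₀) (hsb : s * (ℓ * b) ^ 2 ≤ amax)
    {μ : Measure ℝ} [IsProbabilityMeasure μ] {α ρ : Type} [Fintype α] [Fintype ρ] [DecidableEq ρ]
    {d : ℕ} (hd : d ≤ Fintype.card ρ) {S : Matrix ρ ρ ℝ} (hS : SpectralBounds ℓ S) (w : α → ℝ)
    (hw : ∀ a b : ℝ, 0 < a → a ≤ amax →
      ∫ x : α → ℝ, Real.exp (-a * (∑ j, x j * w j - b) ^ 2) ∂(Measure.pi fun _ => μ) ≤
        Γ * a ^ (-(1 / 2 : ℝ)))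
    (y : (Fin d → ρ → ℝ) → Fin d → ℝ) (hy : Continuous y) :
    ((iidLaw α ρ μ).prod (iidLaw (Fin d) ρ μ)).real {z | opNorm (of z.2) ≤ b ∧
        D₀ ^ d ≤ (of z.2 * S * (of z.2 * S)ᵀ).det ∧
        euclNorm (of z.2 *ᵥ (S *ᵥ (w ᵥ* of z.1)) - y z.2) ≤ η} ≤
      Real.exp (s * η ^ 2) *
        (Γ ^ d * ((Fintype.card ρ).choose d / (s ^ d * D₀ ^ d)) ^ (1 / 2 : ℝ)) := by
  set bnd := Real.exp (s * η ^ 2) *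
        (Γ ^ d * ((Fintype.card ρ).choose d / (s ^ d * D₀ ^ d)) ^ (1 / 2 : ℝ)) with hbnd
  have hbnd0 : 0 ≤ bnd := by positivity
  set ν : Measure ℝ := (Measure.pi fun _ : α => μ).map fun x => ∑ j, x j * w j with hν
  have hm : Measurable fun x : α → ℝ => ∑ j, x j * w j := by fun_prop
  have hνp : IsProbabilityMeasure ν := Measure.isProbabilityMeasure_map hm.aemeasurable
  have hνi : ∀ a b : ℝ, 0 < a → a ≤ amax → ∫ x, Real.exp (-a * (x - b) ^ 2) ∂ν ≤
      Γ * a ^ (-(1 / 2 : ℝ)) := by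
    intro a b ha haa
    rw [hν, integral_map hm.aemeasurable (by fun_prop)]
    exact hw a b ha haa
  have hcont : Continuous fun z : (α → ρ → ℝ) × (Fin d → ρ → ℝ) =>
      euclNorm (of z.2 *ᵥ (S *ᵥ (w ᵥ* of z.1)) - y z.2) := by
    have h1 := continuous_euclNorm (ι := Fin d)
    have h2 : Continuous fun z : (α → ρ → ℝ) × (Fin d → ρ → ℝ) =>
        of z.2 *ᵥ (S *ᵥ (w ᵥ* of z.1)) := by
      refine continuous_pi fun j => ?_
      simp only [mulVec, dotProduct, vecMul, of_apply]
      fun_prop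
    fun_prop
  have hof : Continuous fun B : Fin d → ρ → ℝ => of B := continuous_id
  have hcl : IsClosed {z : (α → ρ → ℝ) × (Fin d → ρ → ℝ) | opNorm (of z.2) ≤ b ∧
        D₀ ^ d ≤ (of z.2 * S * (of z.2 * S)ᵀ).det ∧
        euclNorm (of z.2 *ᵥ (S *ᵥ (w ᵥ* of z.1)) - y z.2) ≤ η} := by
    have hof2 : Continuous fun z : (α → ρ → ℝ) × (Fin d → ρ → ℝ) => of z.2 :=
      hof.comp continuous_snd
    have hdetc : Continuous fun z : (α → ρ → ℝ) × (Fin d → ρ → ℝ) =>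
        (of z.2 * S * (of z.2 * S)ᵀ).det :=
      ((hof2.matrix_mul continuous_const).matrix_mul
        (hof2.matrix_mul continuous_const).matrix_transpose).matrix_det
    have h3 := (isClosed_le (continuous_opNorm.comp hof2) (continuous_const (y := b))).inter
      ((isClosed_le (continuous_const (y := D₀ ^ d)) hdetc).inter
        (isClosed_le hcont (continuous_const (y := η))))
    convert h3 using 1
    ext z
    simp only [Set.mem_inter_iff, Set.mem_ofPred_eq, Function.comp_apply]
  rw [measureReal_def, Measure.prod_apply_symm hcl.measurableSet]
  refine ENNReal.toReal_le_of_le_ofReal hbnd0 ?_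
  have hB : ∀ B : Fin d → ρ → ℝ, (iidLaw α ρ μ) ((fun A => (A, B)) ⁻¹'
      {z : (α → ρ → ℝ) × (Fin d → ρ → ℝ) | opNorm (of z.2) ≤ b ∧
        D₀ ^ d ≤ (of z.2 * S * (of z.2 * S)ᵀ).det ∧
        euclNorm (of z.2 *ᵥ (S *ᵥ (w ᵥ* of z.1)) - y z.2) ≤ η}) ≤ ENNReal.ofReal bnd := by
    intro B
    by_cases hgood : opNorm (of B) ≤ b ∧ D₀ ^ d ≤ (of B * S * (of B * S)ᵀ).det
    swap
    · have : ((fun A : α → ρ → ℝ => (A, B)) ⁻¹'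
        {z : (α → ρ → ℝ) × (Fin d → ρ → ℝ) | opNorm (of z.2) ≤ b ∧
        D₀ ^ d ≤ (of z.2 * S * (of z.2 * S)ᵀ).det ∧
        euclNorm (of z.2 *ᵥ (S *ᵥ (w ᵥ* of z.1)) - y z.2) ≤ η}) = ∅ := by
        ext A
        simp only [Set.mem_preimage, Set.mem_ofPred_eq, Set.mem_empty_iff_false, iff_false]
        exact fun h => hgood ⟨h.1, h.2.1⟩
      rw [this]; simp
    obtain ⟨hop, hdet⟩ := hgood
    set T := of B * S with hT
    have hcol : ∀ r, s * ∑ i, T i r ^ 2 ≤ amax := by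
      intro r
      have h1 : ∑ i, T i r ^ 2 = euclNorm (T *ᵥ Pi.single r 1) ^ 2 := by
        rw [euclNorm_sq]; simp
      have h2 : euclNorm (T *ᵥ Pi.single r 1) ≤ ℓ * b := by
        refine (euclNorm_mulVec_le _ _).trans ?_
        have h3 : euclNorm (Pi.single r (1 : ℝ) : ρ → ℝ) = 1 := by
          rw [euclNorm]; simp
        rw [h3, mul_one, hT]
        calc opNorm (of B * S) ≤ opNorm (of B) * opNorm S := opNorm_mul_le _ _
          _ ≤ b * ℓ := mul_le_mul hop (hS.opNorm_le hℓ) (opNorm_nonneg _)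
              ((opNorm_nonneg _).trans hop)
          _ = _ := mul_comm _ _
      rw [h1]
      exact (mul_le_mul_of_nonneg_left (pow_le_pow_left₀ (euclNorm_nonneg _) h2 2) hs.le).trans hsb
    have hdet0 : 0 < (T * Tᵀ).det := lt_of_lt_of_le (by positivity) hdet
    have hLR := integral_exp_neg_linear_image_le ν hΓ (by norm_num : (0 : ℝ) ≤ 1 / 2) hνi hd T hs
      hcol hdet0 (y B)
    have hset : (fun A : α → ρ → ℝ => (A, B)) ⁻¹'
        {z : (α → ρ → ℝ) × (Fin d → ρ → ℝ) | opNorm (of z.2) ≤ b ∧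
        D₀ ^ d ≤ (of z.2 * S * (of z.2 * S)ᵀ).det ∧
        euclNorm (of z.2 *ᵥ (S *ᵥ (w ᵥ* of z.1)) - y z.2) ≤ η} ⊆
        (fun A : α → ρ → ℝ => w ᵥ* of A) ⁻¹' {g | ∑ i, ((T *ᵥ g) i - y B i) ^ 2 ≤ η ^ 2} := by
      rintro A ⟨-, -, h3⟩
      simp only at h3
      rw [euclNorm_le_iff hη] at h3
      simp only [Set.mem_preimage, Set.mem_ofPred_eq]
      refine le_trans (le_of_eq ?_) h3
      refine Finset.sum_congr rfl fun i _ => ?_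
      rw [hT, Pi.sub_apply, ← mulVec_mulVec]
    refine (measure_mono hset).trans ?_
    have hTc : Continuous fun g : ρ → ℝ => ∑ i, ((T *ᵥ g) i - y B i) ^ 2 := by
      simp only [mulVec, dotProduct]; fun_prop
    rw [(measurePreserving_vecMul μ w).measure_preimage
      (isClosed_le hTc continuous_const).measurableSet.nullMeasurableSet, ← ofReal_measureReal]
    apply ENNReal.ofReal_le_ofReal
    refine (measure_le_exp_mul_integral _ (f := fun g => ∑ i, ((T *ᵥ g) i - y B i) ^ 2)
      hTc.measurable (fun g => by positivity) s hs.le _).trans ?_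
    refine mul_le_mul_of_nonneg_left (hLR.trans ?_) (Real.exp_pos _).le
    gcongr
  refine (lintegral_mono hB).trans ?_
  simp

/-! ### A net for structured vectors -/

/-- The coordinates of `v` in the `i`-th block that do not exceed `b` in absolute value. -/
noncomputable def smallBlock {γ β : Type*} [Fintype γ] [DecidableEq β] (blk : γ → β) (b : ℝ)
    (v : γ → ℝ) (i : β) : Finset γ :=
  Finset.univ.filter fun j => blk j = i ∧ |v j| ≤ b

/-- The vector `v` is arithmetically structured up to scale `D`: for each block some dilate
`θ v`, with `√n / (2 q) ≤ θ ≤ D`, is close to an integer vector on the small coordinates of the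
block. -/
def IsStructured {γ β : Type*} [Fintype γ] [DecidableEq β] (blk : γ → β) (q n : ℕ) (D : ℝ)
    (v : γ → ℝ) : Prop :=
  ∀ i, ∃ θ : ℝ, √n / (2 * q) ≤ θ ∧ θ ≤ D ∧
    ∑ j ∈ smallBlock blk (q / √n) v i, (1 - Real.cos (2 * Real.pi * θ * v j)) < q ^ 2

/-- The cosine controls the distance to the nearest integer. -/
lemma eight_mul_sq_sub_round_le (x : ℝ) :
    8 * (x - round x) ^ 2 ≤ 1 - Real.cos (2 * Real.pi * x) := by
  have h1 : Real.cos (2 * Real.pi * x) = Real.cos (2 * Real.pi * (x - round x)) := by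
    rw [mul_sub, show 2 * Real.pi * (round x : ℝ) = (round x : ℝ) * (2 * Real.pi) by ring,
      Real.cos_sub_int_mul_two_pi]
  have h2 : |x - round x| ≤ 1 / 2 := abs_sub_round x
  have hpi := Real.pi_pos
  have h3 := Real.cos_le_one_sub_mul_cos_sq (x := 2 * Real.pi * (x - round x)) (by
    rw [abs_mul, abs_of_pos (by positivity)]; nlinarith)
  rw [h1]
  have h4 : 2 / Real.pi ^ 2 * (2 * Real.pi * (x - round x)) ^ 2 = 8 * (x - round x) ^ 2 := by
    field_simp; ring
  linarith

/-- The code of a structured vector: the dilated coordinates `θ v` are rounded to `z`, and the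
remainder `v - z / ⌊θ⌋` is recorded at scale `q ^ 2 / (D √n)`. On average over the coordinates the
remainder takes `D / θ` values, because the vector is structured. -/
lemma code_mem_crossPolytope {c₁ D : ℝ} {q n N : ℕ} {γ : Type*} [Fintype γ] [DecidableEq γ]
    (hq : 2 ≤ q) (hR : Regime c₁ q n (Fintype.card γ) N) (blk : γ → Fin (q ^ 2)) (v : γ → ℝ)
    (hv : euclNorm v = 1) (θ : Fin (q ^ 2) → ℝ) (hθ1 : ∀ i, √n / (2 * q) ≤ θ i)
    (hθD : ∀ i, θ i ≤ D)
    (hθ : ∀ i, ∑ j ∈ smallBlock blk (q / √n) v i,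
      (1 - Real.cos (2 * Real.pi * θ i * v j)) < q ^ 2) :
    (fun j => ⌊(v j - ((if j ∈ largeCoords (q / √n) v then 0 else round (θ (blk j) * v j) : ℤ) : ℝ) /
      (⌊θ (blk j)⌋₊ : ℝ)) / (q ^ 2 / (D * √n))⌋) ∈
      crossPolytope (fun j => if j ∈ largeCoords (q / √n) v then D else D / (⌊θ (blk j)⌋₊ : ℝ))
        (4 * n) := by
  set E := largeCoords (q / √n) v with hE
  have hq2 : (2 : ℝ) ≤ q := by exact_mod_cast hq
  have hn0 : (0 : ℝ) < n := by exact_mod_cast hR.n_pos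
  have hsn : 0 < √(n : ℝ) := Real.sqrt_pos.2 hn0
  have hnn : √(n : ℝ) * √n = n := Real.mul_self_sqrt hn0.le
  have hθ2 : ∀ i, 2 ≤ θ i := fun i => by
    refine le_trans ?_ (hθ1 i)
    rw [le_div_iff₀ (by positivity)]
    have h1 := hR.pow_nine_le_sqrt
    have h2 : (2 : ℝ) ^ 8 * q ≤ q ^ 9 := by
      rw [show (q : ℝ) ^ 9 = q ^ 8 * q by ring]; gcongr
    nlinarith
  have hm1 : ∀ i, (1 : ℝ) ≤ ⌊θ i⌋₊ := fun i => by
    have : 1 ≤ ⌊θ i⌋₊ := Nat.le_floor (by have := hθ2 i; norm_num; linarith)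
    exact_mod_cast this
  have hmθ : ∀ i, (⌊θ i⌋₊ : ℝ) ≤ θ i := fun i => Nat.floor_le (by have := hθ2 i; linarith)
  have hθm : ∀ i, θ i ≤ ⌊θ i⌋₊ + 1 := fun i => (Nat.lt_floor_add_one _).le
  have hD1 : ∀ j : γ, 2 ≤ D := fun j => (hθ2 (blk j)).trans (hθD _)
  have hRpos : ∀ j, 0 < (if j ∈ E then D else D / (⌊θ (blk j)⌋₊ : ℝ)) := by
    intro j
    have := hD1 j
    have := hm1 (blk j)
    split_ifs <;> positivity
  rw [mem_crossPolytope hRpos]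
  -- The distances to the integers; structure bounds their squares by `q ^ 2` on each block.
  set r : γ → ℝ := fun j => if j ∈ E then 0 else |θ (blk j) * v j - round (θ (blk j) * v j)| with hr
  have hterm : ∀ j, |((⌊(v j - ((if j ∈ E then 0 else round (θ (blk j) * v j) : ℤ) : ℝ) /
      (⌊θ (blk j)⌋₊ : ℝ)) / (q ^ 2 / (D * √n))⌋ : ℤ) : ℝ)| /
      (if j ∈ E then D else D / (⌊θ (blk j)⌋₊ : ℝ)) ≤ |v j| * √n + |r j| * (√n / q ^ 2) + 2 := by
    intro j
    have hD0 := hD1 j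
    have hfl : ∀ x : ℝ, |((⌊x⌋ : ℤ) : ℝ)| ≤ |x| + 1 := by
      intro x
      have h1 := Int.floor_le x
      have h2 := Int.lt_floor_add_one x
      rw [abs_le]
      constructor
      · have := neg_abs_le x; linarith
      · have := le_abs_self x; linarith
    by_cases hj : j ∈ E
    · simp only [hj, if_true, hr, abs_zero, zero_mul, Int.cast_zero, zero_div, sub_zero]
      rw [div_le_iff₀ (by linarith)]
      refine (hfl _).trans ?_
      rw [abs_div, abs_of_pos (show (0 : ℝ) < q ^ 2 / (D * √n) by positivity)]
      have e1 : |v j| / ((q : ℝ) ^ 2 / (D * √n)) = |v j| * √n * D / q ^ 2 := by field_simp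
      have e2 : |v j| * √n * D / q ^ 2 ≤ |v j| * √n * D :=
        div_le_self (by positivity) (by nlinarith)
      rw [e1]; nlinarith
    · simp only [hj, if_false, hr]
      set t := θ (blk j) with ht
      set m : ℝ := (⌊t⌋₊ : ℝ) with hm
      set z : ℝ := ((round (t * v j) : ℤ) : ℝ) with hz
      have ht2 : 2 ≤ t := hθ2 _
      have hmp : 1 ≤ m := hm1 _
      have hmt : m ≤ t := hmθ _
      have htm : t ≤ m + 1 := hθm _
      have htD : t ≤ D := hθD _
      have hmD : 0 < D / m := by positivity
      have hvj : |v j| ≤ q / √n := by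
        by_contra hcon
        exact hj (Finset.mem_filter.2 ⟨Finset.mem_univ _, not_le.1 hcon⟩)
      have h2t : 1 / (2 * t) ≤ q / √n := by
        have := hθ1 (blk j)
        rw [div_le_div_iff₀ (by positivity) hsn]
        rw [div_le_iff₀ (by positivity)] at this
        linarith
      rw [div_le_iff₀ hmD]
      refine (hfl _).trans ?_
      rw [abs_div, abs_of_pos (show (0 : ℝ) < q ^ 2 / (D * √n) by positivity)]
      -- Replacing `t` by its integer part `m` costs at most `2 q / √n` in the numerator.
      have key : |v j - z / m| ≤ (|t * v j - z| + 2 * (q / √n)) / m := by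
        have e1 : v j - z / m = (t * v j - z) / t + (-(z * (t - m) / (t * m))) := by
          field_simp; ring
        have e2 : |(t * v j - z) / t| ≤ |t * v j - z| / m := by
          rw [abs_div, abs_of_pos (show 0 < t by linarith)]
          gcongr
        have hzle : |z| ≤ t * |v j| + 1 / 2 := by
          have h1 : |t * v j - z| ≤ 1 / 2 := abs_sub_round _
          have h2 : |t * v j| = t * |v j| := by rw [abs_mul, abs_of_pos (show 0 < t by linarith)]
          have h3 := abs_sub_abs_le_abs_sub z (t * v j)
          rw [abs_sub_comm z] at h3
          linarith
        have e3 : |z * (t - m) / (t * m)| ≤ 2 * (q / √n) / m := by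
          rw [abs_div, abs_mul, abs_of_nonneg (show 0 ≤ t - m by linarith),
            abs_of_pos (show 0 < t * m by positivity), div_le_div_iff₀ (by positivity) (by positivity)]
          have h1 : |z| * (t - m) ≤ t * |v j| + 1 / 2 := by
            have : |z| * (t - m) ≤ |z| * 1 := by gcongr; linarith
            linarith
          have h2 : t * |v j| + 1 / 2 ≤ 2 * (q / √n) * t := by
            have h3 : t * |v j| ≤ t * (q / √n) := by gcongr
            have h4 : (1 : ℝ) / 2 = t * (1 / (2 * t)) := by field_simp
            have h5 : t * (1 / (2 * t)) ≤ t * (q / √n) := by gcongr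
            linarith
          calc |z| * (t - m) * m ≤ (2 * (q / √n) * t) * m :=
                mul_le_mul_of_nonneg_right (h1.trans h2) (by linarith)
            _ = _ := by ring
        rw [e1, add_div]
        refine (abs_add_le _ _).trans ?_
        rw [abs_neg]
        exact add_le_add e2 e3
      have h1 : |v j - z / m| / ((q : ℝ) ^ 2 / (D * √n)) ≤
          (|t * v j - z| + 2 * (q / √n)) / m / (q ^ 2 / (D * √n)) := by gcongr
      have h2 : (|t * v j - z| + 2 * (q / √n)) / m / ((q : ℝ) ^ 2 / (D * √n)) =
          (|t * v j - z| * (√n / q ^ 2) + 2 / q) * (D / m) := by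
        field_simp
      have h3 : 1 ≤ D / m := by rw [one_le_div (by linarith)]; linarith
      have h4 : 2 / (q : ℝ) ≤ 1 := by rw [div_le_one (by linarith)]; exact hq2
      have h5 : 0 ≤ |v j| * √n := by positivity
      rw [abs_abs]
      nlinarith
  refine (Finset.sum_le_sum fun j _ => hterm j).trans ?_
  rw [Finset.sum_add_distrib, Finset.sum_add_distrib, ← Finset.sum_mul, ← Finset.sum_mul]
  have hp : (Fintype.card γ : ℝ) ≤ n := by exact_mod_cast hR.p_le
  have h1 := sum_abs_le_sqrt_card_mul_euclNorm hp v
  have h2 := sum_abs_le_sqrt_card_mul_euclNorm hp r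
  have hrn : euclNorm r ≤ q ^ 2 := by
    rw [euclNorm_le_iff (by positivity), ← Finset.sum_fiberwise (s := Finset.univ) (g := blk)]
    have hi : ∀ i, ∑ j ∈ Finset.univ.filter (fun j => blk j = i), r j ^ 2 ≤ q ^ 2 := by
      intro i
      have e1 : ∑ j ∈ Finset.univ.filter (fun j => blk j = i), r j ^ 2 =
          ∑ j ∈ smallBlock blk (q / √n) v i, r j ^ 2 := by
        symm
        apply Finset.sum_subset
        · intro j hj
          have := (Finset.mem_filter.1 hj).2
          exact Finset.mem_filter.2 ⟨Finset.mem_univ _, this.1⟩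
        · intro j hj hj'
          have hjE : j ∈ E := by
            refine Finset.mem_filter.2 ⟨Finset.mem_univ _, ?_⟩
            by_contra hcon
            exact hj' (Finset.mem_filter.2 ⟨Finset.mem_univ _, (Finset.mem_filter.1 hj).2,
              not_lt.1 hcon⟩)
          simp [hr, hjE]
      rw [e1]
      refine le_trans (Finset.sum_le_sum fun j hj => ?_) (hθ i).le
      have hj2 := (Finset.mem_filter.1 hj).2
      have hjE : j ∉ E := fun h => absurd (Finset.mem_filter.1 h).2 (not_lt.2 hj2.2)
      have e2 := eight_mul_sq_sub_round_le (θ i * v j)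
      simp only [hr, hjE, if_false, hj2.1, sq_abs]
      rw [mul_assoc (2 * Real.pi)]
      nlinarith [sq_nonneg (θ i * v j - round (θ i * v j))]
    refine (Finset.sum_le_sum fun i _ => hi i).trans ?_
    simp only [Finset.sum_const, Finset.card_univ, Fintype.card_fin, nsmul_eq_mul]
    push_cast
    nlinarith
  rw [hv, mul_one] at h1
  have e1 : (∑ i, |v i|) * √n ≤ n := by
    calc _ ≤ √n * √n := by gcongr
      _ = n := hnn
  have e2 : (∑ i, |r i|) * (√n / q ^ 2) ≤ n := by
    calc _ ≤ (√n * q ^ 2) * (√n / q ^ 2) := by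
          gcongr
          exact h2.trans (by gcongr)
      _ = √n * √n := by field_simp
      _ = n := hnn
  simp only [Finset.sum_const, Finset.card_univ, nsmul_eq_mul]
  linarith

set_option maxHeartbeats 1000000 in
/-- A net of a set of structured vectors, by representatives in the set. Representatives in `V` are
needed because the bound for a single point uses further properties of the vectors in `V`. -/
theorem exists_structured_net {c₁ D : ℝ} {q n N : ℕ} {γ : Type*} [Fintype γ] [DecidableEq γ]
    (hq : 21 ≤ q) (hR : Regime c₁ q n (Fintype.card γ) N) (blk : γ → Fin (q ^ 2))
    (hD1 : √n / (2 * q) ≤ D) (hD2 : D ≤ 4 ^ q * (√n / (2 * q))) (V : Set (γ → ℝ))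
    (hV : ∀ v ∈ V, euclNorm v = 1 ∧ IsStructured blk q n D v) :
    ∃ A : Finset (γ → ℝ), ↑A ⊆ V ∧
      (A.card : ℝ) ≤ Real.exp (12 * n) * (D * q / √n) ^ Fintype.card γ ∧
      ∀ v ∈ V, ∃ v' ∈ A, ∀ j, |v j - v' j| ≤ q ^ 2 / (D * √n) := by
  have hq2 : (21 : ℝ) ≤ q := by exact_mod_cast hq
  have hn0 : (0 : ℝ) < n := by exact_mod_cast hR.n_pos
  have hsn : 0 < √(n : ℝ) := Real.sqrt_pos.2 hn0
  have hnn : √(n : ℝ) * √n = n := Real.mul_self_sqrt hn0.le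
  have hq18 : (q : ℝ) ^ 18 ≤ n := by exact_mod_cast hR.pow_le
  have hθ2 : (2 : ℝ) ≤ √n / (2 * q) := by
    rw [le_div_iff₀ (by positivity)]
    have h1 := hR.pow_nine_le_sqrt
    have h2 : (2 : ℝ) ^ 8 * q ≤ q ^ 9 := by
      rw [show (q : ℝ) ^ 9 = q ^ 8 * q by ring]; gcongr; linarith
    nlinarith
  have hD0 : 2 ≤ D := hθ2.trans hD1
  set p := Fintype.card γ with hp
  have hpn : (p : ℝ) ≤ n := by exact_mod_cast hR.p_le
  set g : ℝ := q ^ 2 / (D * √n) with hg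
  have hg0 : 0 < g := by positivity
  classical
  have hθex : ∀ v, ∃ θ : Fin (q ^ 2) → ℝ, v ∈ V → ∀ i, √n / (2 * q) ≤ θ i ∧ θ i ≤ D ∧
      ∑ j ∈ smallBlock blk (q / √n) v i, (1 - Real.cos (2 * Real.pi * θ i * v j)) < q ^ 2 := by
    intro v
    by_cases hv : v ∈ V
    · choose θ hθ using (hV v hv).2
      exact ⟨θ, fun _ => hθ⟩
    · exact ⟨0, fun h => absurd h hv⟩
  choose θ hθ using hθex
  -- The code consists of the large coordinates, the integer parts of the dilations, the rounded
  -- dilated coordinates and the remainders at scale `g`.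
  let zc : (γ → ℝ) → γ → ℤ := fun v j =>
    if j ∈ largeCoords (q / √n) v then 0 else round (θ v (blk j) * v j)
  let yc : (γ → ℝ) → γ → ℤ := fun v j => ⌊(v j - (zc v j : ℝ) / (⌊θ v (blk j)⌋₊ : ℝ)) / g⌋
  let f : (γ → ℝ) → (Finset γ × (Fin (q ^ 2) → ℕ)) × ((γ → ℤ) × (γ → ℤ)) := fun v =>
    ((largeCoords (q / √n) v, fun i => ⌊θ v i⌋₊), (zc v, yc v))
  let Z : Finset γ × (Fin (q ^ 2) → ℕ) → Finset (γ → ℤ) := fun c =>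
    Fintype.piFinset fun j => if j ∈ c.1 then {0} else
      Finset.Icc (-(⌊((c.2 (blk j) : ℝ) + 1) * (q / √n) + 1 / 2⌋₊ : ℤ))
        ⌊((c.2 (blk j) : ℝ) + 1) * (q / √n) + 1 / 2⌋₊
  let Rr : Finset γ × (Fin (q ^ 2) → ℕ) → γ → ℝ := fun c j =>
    if j ∈ c.1 then D else D / (c.2 (blk j) : ℝ)
  let S₀ : Finset (Finset γ × (Fin (q ^ 2) → ℕ)) :=
    (Finset.univ ×ˢ Fintype.piFinset fun _ => Finset.range (⌊D⌋₊ + 1)).filter fun c =>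
      c.1.card ≤ n / q ^ 2 ∧ ∀ i, √n / (4 * q) ≤ (c.2 i : ℝ)
  let C := S₀.biUnion fun c => ({c} : Finset _) ×ˢ (Z c ×ˢ crossPolytope (Rr c) (4 * n))
  have hfC : ∀ v ∈ V, f v ∈ C := by
    intro v hv
    have hθv := hθ v hv
    have hv1 := (hV v hv).1
    refine Finset.mem_biUnion.2 ⟨(largeCoords (q / √n) v, fun i => ⌊θ v i⌋₊), ?_, ?_⟩
    · refine Finset.mem_filter.2 ⟨Finset.mem_product.2 ⟨Finset.mem_univ _, ?_⟩,
        hR.card_largeCoords_le hv1.le, ?_⟩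
      · rw [Fintype.mem_piFinset]
        intro i
        rw [Finset.mem_range, Nat.lt_succ_iff]
        exact Nat.floor_le_floor (hθv i).2.1
      · intro i
        have h1 := (Nat.lt_floor_add_one (θ v i)).le
        have h2 := (hθv i).1
        have h3 : √(n : ℝ) / (4 * q) = √n / (2 * q) / 2 := by field_simp; norm_num
        simp only
        rw [h3]
        linarith
    · refine Finset.mem_product.2 ⟨Finset.mem_singleton_self _, Finset.mem_product.2 ⟨?_, ?_⟩⟩
      · rw [Fintype.mem_piFinset]
        intro j
        by_cases hj : j ∈ largeCoords (q / √n) v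
        · simp [f, zc, hj]
        · simp only [f, zc, hj, if_false]
          have hvj : |v j| ≤ q / √n := by
            by_contra hcon
            exact hj (Finset.mem_filter.2 ⟨Finset.mem_univ _, not_le.1 hcon⟩)
          have h1 : |((round (θ v (blk j) * v j) : ℤ) : ℝ)| ≤
              ((⌊θ v (blk j)⌋₊ : ℝ) + 1) * (q / √n) + 1 / 2 := by
            have h2 : |θ v (blk j) * v j - round (θ v (blk j) * v j)| ≤ 1 / 2 := abs_sub_round _
            have h3 := abs_sub_abs_le_abs_sub ((round (θ v (blk j) * v j) : ℤ) : ℝ)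
              (θ v (blk j) * v j)
            rw [abs_sub_comm ((round (θ v (blk j) * v j) : ℤ) : ℝ), abs_mul, abs_of_nonneg
              (show 0 ≤ θ v (blk j) by linarith [(hθv (blk j)).1])] at h3
            have h4 := (Nat.lt_floor_add_one (θ v (blk j))).le
            have h5 : θ v (blk j) * |v j| ≤ ((⌊θ v (blk j)⌋₊ : ℝ) + 1) * (q / √n) :=
              mul_le_mul h4 hvj (abs_nonneg _) (by positivity)
            linarith
          have h6 : |round (θ v (blk j) * v j)| ≤
              (⌊((⌊θ v (blk j)⌋₊ : ℝ) + 1) * (q / √n) + 1 / 2⌋₊ : ℤ) := by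
            rw [Int.abs_eq_natAbs]
            have : (round (θ v (blk j) * v j)).natAbs ≤
                ⌊((⌊θ v (blk j)⌋₊ : ℝ) + 1) * (q / √n) + 1 / 2⌋₊ := by
              apply Nat.le_floor
              rw [Nat.cast_natAbs, Int.cast_abs]
              exact h1
            exact_mod_cast this
          rw [Finset.mem_Icc]
          exact abs_le.1 h6
      · exact code_mem_crossPolytope (by omega) hR blk v hv1 (θ v) (fun i => (hθv i).1)
          (fun i => (hθv i).2.1) fun i => (hθv i).2.2
  obtain ⟨A, hAV, hAC, hA⟩ := exists_net V f C hfC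
  refine ⟨A, hAV, ?_, ?_⟩
  · have hCcard : ∀ c ∈ S₀, ((({c} : Finset _) ×ˢ (Z c ×ˢ crossPolytope (Rr c) (4 * n))).card : ℝ) ≤
        Real.exp (9 * n) * (D * q / √n) ^ p := by
      intro c hc
      obtain ⟨-, hcE, hcm⟩ := Finset.mem_filter.1 hc
      have hm0 : ∀ i, (0 : ℝ) < c.2 i := fun i => lt_of_lt_of_le (by positivity) (hcm i)
      have hm1 : ∀ i, (1 : ℝ) ≤ c.2 i := fun i => by
        have : 0 < c.2 i := by exact_mod_cast hm0 i
        exact_mod_cast this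
      have hmD : ∀ i, (c.2 i : ℝ) ≤ D := fun i => by
        have h1 := (Finset.mem_product.1 (Finset.mem_filter.1 hc).1).2
        rw [Fintype.mem_piFinset] at h1
        have h2 := h1 i
        rw [Finset.mem_range, Nat.lt_succ_iff] at h2
        exact (Nat.cast_le.2 h2).trans (Nat.floor_le (by linarith))
      have hRpos : ∀ j, 0 < Rr c j := fun j => by
        have := hm0 (blk j)
        simp only [Rr]; split_ifs <;> positivity
      rw [Finset.card_product, Finset.card_singleton, one_mul, Finset.card_product]
      push_cast
      have hcr := card_crossPolytope_le hRpos (4 * n)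
      have hZ : ((Z c).card : ℝ) ≤ ∏ j, (if j ∈ c.1 then (1 : ℝ) else 12 * c.2 (blk j) * (q / √n)) := by
        simp only [Z]
        rw [Fintype.card_piFinset]
        push_cast
        refine Finset.prod_le_prod (fun _ _ => Nat.cast_nonneg _) fun j _ => ?_
        by_cases hj : j ∈ c.1
        · simp [hj]
        · simp only [hj, if_false, Int.card_Icc]
          set h := ⌊((c.2 (blk j) : ℝ) + 1) * (q / √n) + 1 / 2⌋₊ with hh
          have e1 : ((h : ℤ) + 1 - -(h : ℤ)).toNat = 2 * h + 1 := by omega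
          have e2 : (h : ℝ) ≤ ((c.2 (blk j) : ℝ) + 1) * (q / √n) + 1 / 2 :=
            Nat.floor_le (by positivity)
          rw [e1]
          push_cast
          have e3 : (1 : ℝ) ≤ 4 * c.2 (blk j) * (q / √n) := by
            have := hcm (blk j)
            rw [div_le_iff₀ (by positivity)] at this
            rw [← mul_div_assoc, le_div_iff₀ hsn]
            linarith
          have e4 : (q : ℝ) / √n ≤ c.2 (blk j) * (q / √n) :=
            le_mul_of_one_le_left (by positivity) (hm1 _)
          linarith
      -- In each small coordinate the number of integers, about `θ q / √n`, and the number of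
      -- remainders, about `D / θ`, multiply to about `D q / √n`; the few large coordinates cost a
      -- factor `√n` each.
      have hprod : (∏ j, (if j ∈ c.1 then (1 : ℝ) else 12 * c.2 (blk j) * (q / √n))) *
          ∏ j, (2 * Rr c j + 1) ≤ (36 * (D * q / √n)) ^ p * √n ^ c.1.card := by
        rw [← Finset.prod_mul_distrib]
        calc _ ≤ ∏ j, (36 * (D * q / √n) * if j ∈ c.1 then √n else 1) := by
              refine Finset.prod_le_prod (fun j _ => ?_) fun j _ => ?_
              · have := hRpos j
                have := hm0 (blk j)
                split_ifs <;> positivity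
              · simp only [Rr]
                split_ifs
                · have : 36 * (D * q / √n) * √n = 36 * D * q := by field_simp
                  rw [this]; nlinarith
                · have hmj := hm0 (blk j)
                  have h1 : 1 ≤ D / c.2 (blk j) := by rw [one_le_div hmj]; exact hmD _
                  have h2 : 2 * (D / c.2 (blk j)) + 1 ≤ 3 * (D / c.2 (blk j)) := by linarith
                  calc _ ≤ 12 * c.2 (blk j) * (q / √n) * (3 * (D / c.2 (blk j))) := by gcongr
                    _ = _ := by field_simp; ring
          _ = _ := by
              rw [Finset.prod_mul_distrib, Finset.prod_const, Finset.card_univ, ← hp,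
                Finset.prod_ite, Finset.prod_const, Finset.prod_const, one_pow, mul_one]
              congr 3
              ext j; simp
      have hsqrt : √(n : ℝ) ^ c.1.card ≤ Real.exp n := by
        have h1 : √(n : ℝ) ≤ Real.exp (36 * q) := by
          have h2 : √(n : ℝ) ≤ n := by
            rw [Real.sqrt_le_left hn0.le]
            have : (1 : ℝ) ≤ n := by exact_mod_cast hR.n_pos
            nlinarith
          refine h2.trans ?_
          rw [← Real.log_le_iff_le_exp hn0]; exact hR.log_le
        have h3 : (c.1.card : ℝ) * (36 * q) ≤ 2 * n := by
          have h4 : (c.1.card : ℝ) ≤ n / q ^ 2 := by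
            have := Nat.cast_div_le (α := ℝ) (m := n) (n := q ^ 2)
            push_cast at this
            exact (Nat.cast_le.2 hcE).trans this
          calc _ ≤ n / (q : ℝ) ^ 2 * (36 * q) := by gcongr
            _ = 36 * n / q := by field_simp
            _ ≤ 2 * n := by rw [div_le_iff₀ (by linarith)]; nlinarith
        have h5 : √(n : ℝ) ≤ Real.exp (18 * q) := by
          have h6 : (n : ℝ) ≤ Real.exp (36 * q) := by
            rw [← Real.log_le_iff_le_exp hn0]; exact hR.log_le
          rw [Real.sqrt_le_left (Real.exp_pos _).le, ← Real.exp_nat_mul]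
          refine h6.trans (Real.exp_le_exp.2 (by push_cast; linarith))
        calc √(n : ℝ) ^ c.1.card ≤ Real.exp (18 * q) ^ c.1.card := by gcongr
          _ = Real.exp (c.1.card * (18 * q)) := by rw [← Real.exp_nat_mul]
          _ ≤ Real.exp n := Real.exp_le_exp.2 (by linarith)
      have h36 : (36 : ℝ) ^ p ≤ Real.exp (4 * n) := by
        have h1 : (36 : ℝ) ≤ Real.exp 4 := by
          have h2 : (2.7 : ℝ) ≤ Real.exp 1 := by have := Real.exp_one_gt_d9; linarith
          have h3 : Real.exp 4 = Real.exp 1 ^ 4 := by rw [← Real.exp_nat_mul]; norm_num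
          rw [h3]
          calc (36 : ℝ) ≤ 2.7 ^ 4 := by norm_num
            _ ≤ _ := by gcongr
        calc (36 : ℝ) ^ p ≤ Real.exp 4 ^ p := by gcongr
          _ = Real.exp (p * 4) := by rw [← Real.exp_nat_mul]
          _ ≤ _ := Real.exp_le_exp.2 (by linarith)
      calc ((Z c).card : ℝ) * (crossPolytope (Rr c) (4 * n)).card
          ≤ (∏ j, (if j ∈ c.1 then (1 : ℝ) else 12 * c.2 (blk j) * (q / √n))) *
            (Real.exp (4 * n) * ∏ j, (2 * Rr c j + 1)) := by
            refine mul_le_mul hZ hcr (Nat.cast_nonneg _) (Finset.prod_nonneg fun j _ => ?_)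
            have := hm0 (blk j)
            split_ifs <;> positivity
        _ = Real.exp (4 * n) * ((∏ j, (if j ∈ c.1 then (1 : ℝ) else 12 * c.2 (blk j) * (q / √n))) *
            ∏ j, (2 * Rr c j + 1)) := by ring
        _ ≤ Real.exp (4 * n) * ((36 * (D * q / √n)) ^ p * √n ^ c.1.card) := by gcongr
        _ ≤ Real.exp (4 * n) * ((Real.exp (4 * n) * (D * q / √n) ^ p) * Real.exp n) := by
            rw [mul_pow]
            gcongr
        _ = Real.exp (4 * n) * Real.exp (4 * n) * Real.exp n * (D * q / √n) ^ p := by ring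
        _ = _ := by
            rw [← Real.exp_add, ← Real.exp_add]; congr 2; ring
    have hS₀ : (S₀.card : ℝ) ≤ Real.exp (3 * n) := by
      have h1 : (S₀.card : ℝ) ≤ 2 ^ p * (⌊D⌋₊ + 1 : ℝ) ^ (q ^ 2) := by
        have : S₀.card ≤ 2 ^ p * (⌊D⌋₊ + 1) ^ (q ^ 2) := by
          refine (Finset.card_filter_le _ _).trans (le_of_eq ?_)
          rw [Finset.card_product, Fintype.card_piFinset]
          simp [hp]
        exact_mod_cast this
      have h2 : (2 : ℝ) ^ p ≤ Real.exp n := by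
        have h3 : (2 : ℝ) ≤ Real.exp 1 := by have := Real.add_one_le_exp (1 : ℝ); linarith
        calc (2 : ℝ) ^ p ≤ Real.exp 1 ^ p := by gcongr
          _ = Real.exp p := by rw [← Real.exp_nat_mul, mul_one]
          _ ≤ _ := Real.exp_le_exp.2 hpn
      have h4 : (⌊D⌋₊ + 1 : ℝ) ^ (q ^ 2) ≤ Real.exp (2 * n) := by
        have h5 : (⌊D⌋₊ + 1 : ℝ) ≤ Real.exp (21 * q) := by
          have h6 := Nat.floor_le (show 0 ≤ D by linarith)
          have h7 := hR.scale_le_exp hD2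
          have h8 : Real.exp (20 * q) + Real.exp (20 * q) ≤ Real.exp (21 * q) := by
            have h9 : (2 : ℝ) ≤ Real.exp q := by have := Real.add_one_le_exp (q : ℝ); linarith
            have : Real.exp (21 * q) = Real.exp q * Real.exp (20 * q) := by
              rw [← Real.exp_add]; ring_nf
            rw [this]
            nlinarith [Real.exp_pos (20 * q : ℝ)]
          have h10 : (1 : ℝ) ≤ Real.exp (20 * q) := Real.one_le_exp (by positivity)
          linarith
        calc (⌊D⌋₊ + 1 : ℝ) ^ (q ^ 2) ≤ Real.exp (21 * q) ^ (q ^ 2) := by gcongr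
          _ = Real.exp (21 * q ^ 3) := by rw [← Real.exp_nat_mul]; push_cast; ring_nf
          _ ≤ Real.exp (2 * n) := by
            apply Real.exp_le_exp.2
            have h11 : (q : ℝ) ^ 4 ≤ q ^ 18 := pow_le_pow_right₀ (by linarith) (by norm_num)
            have h12 : 21 * (q : ℝ) ^ 3 ≤ q ^ 4 := by
              rw [show (q : ℝ) ^ 4 = q * q ^ 3 by ring]; gcongr
            linarith
      calc (S₀.card : ℝ) ≤ Real.exp n * Real.exp (2 * n) := h1.trans (by gcongr)
        _ = _ := by rw [← Real.exp_add]; ring_nf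
    calc (A.card : ℝ) ≤ C.card := by exact_mod_cast hAC
      _ ≤ ∑ c ∈ S₀, ((({c} : Finset _) ×ˢ (Z c ×ˢ crossPolytope (Rr c) (4 * n))).card : ℝ) := by
          rw [← Nat.cast_sum]
          exact Nat.cast_le.2 Finset.card_biUnion_le
      _ ≤ ∑ _c ∈ S₀, Real.exp (9 * n) * (D * q / √n) ^ p := Finset.sum_le_sum hCcard
      _ = S₀.card * (Real.exp (9 * n) * (D * q / √n) ^ p) := by
          rw [Finset.sum_const, nsmul_eq_mul]
      _ ≤ Real.exp (3 * n) * (Real.exp (9 * n) * (D * q / √n) ^ p) := by gcongr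
      _ = _ := by rw [← mul_assoc, ← Real.exp_add]; ring_nf
  · intro v hv
    obtain ⟨v', hv', hff⟩ := hA v hv
    refine ⟨v', hv', fun j => ?_⟩
    have h1 : zc v = zc v' := congrArg (fun x => x.2.1) hff
    have h2 : yc v = yc v' := congrArg (fun x => x.2.2) hff
    have h3 : (fun i => ⌊θ v i⌋₊) = fun i => ⌊θ v' i⌋₊ := congrArg (fun x => x.1.2) hff
    have h4 := congrFun h2 j
    have h5 := congrFun h3 (blk j)
    simp only [yc] at h4
    have h6 := Int.abs_sub_lt_one_of_floor_eq_floor h4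
    rw [h1, show ⌊θ v (blk j)⌋₊ = ⌊θ v' (blk j)⌋₊ from h5, ← sub_div, sub_sub_sub_cancel_right,
      abs_div, abs_of_pos hg0, div_lt_one hg0] at h6
    exact h6.le

/-! ### A fixed structured vector -/

open Matrix in
/-- For fixed `v` and `lam`, the eigenvector equation for `X S Xᵀ`, read on the rows outside a set
carrying an unstructured part of `v`, is unlikely to hold approximately. -/
lemma measure_near_eigenvector_le {ℓ Γ amax b s η D₀ : ℝ} (hℓ : 0 < ℓ) (hΓ : 0 ≤ Γ) (hs : 0 < s)
    (hη : 0 ≤ η) (hD₀ : 0 < D₀) (hsb : s * (ℓ * b) ^ 2 ≤ amax)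
    {μ : Measure ℝ} [IsProbabilityMeasure μ] {α γ ρ : Type} [Fintype α] [Fintype γ] [Fintype ρ]
    [DecidableEq ρ] {d : ℕ} (hd : d ≤ Fintype.card ρ) {S : Matrix ρ ρ ℝ} (hS : SpectralBounds ℓ S)
    (e : α ⊕ Fin d ≃ γ) (v : γ → ℝ) (lam : ℝ)
    (hw : ∀ a b : ℝ, 0 < a → a ≤ amax →
      ∫ x : α → ℝ, Real.exp (-a * (∑ j, x j * v (e (Sum.inl j)) - b) ^ 2)
        ∂(Measure.pi fun _ => μ) ≤ Γ * a ^ (-(1 / 2 : ℝ))) :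
    (iidLaw γ ρ μ).real {X | opNorm (of X) ≤ b ∧
        D₀ ^ d ≤ (of (fun i => X (e (Sum.inr i))) * S *
          (of (fun i => X (e (Sum.inr i))) * S)ᵀ).det ∧
        euclNorm ((rowGram S X *ᵥ v - lam • v) ∘ fun i : Fin d => e (Sum.inr i)) ≤ η} ≤
      Real.exp (s * η ^ 2) *
        (Γ ^ d * ((Fintype.card ρ).choose d / (s ^ d * D₀ ^ d)) ^ (1 / 2 : ℝ)) := by
  set w : α → ℝ := fun a => v (e (Sum.inl a)) with hwdef
  set u : Fin d → ℝ := fun i => v (e (Sum.inr i)) with hu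
  -- The rows outside the set contribute to the equation only through this target.
  set y : (Fin d → ρ → ℝ) → Fin d → ℝ := fun B => lam • u - of B *ᵥ (S *ᵥ (u ᵥ* of B)) with hy
  have hyc : Continuous y := by
    refine continuous_pi fun j => ?_
    simp only [hy, Pi.sub_apply, mulVec, dotProduct, vecMul, of_apply]
    fun_prop
  have hmain := measure_two_block_near_le (α := α) hℓ hΓ hs hη hD₀ hsb hd hS w hw y hyc
  refine le_trans ?_ hmain
  have hmp := measurePreserving_split (Measure.pi fun _ : ρ => μ) e
  rw [measureReal_def, measureReal_def]
  refine ENNReal.toReal_mono (measure_ne_top _ _) ?_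
  rw [← hmp.map_eq]
  refine le_trans (measure_mono ?_) (Measure.le_map_apply hmp.measurable.aemeasurable _)
  rintro X ⟨h1, h2, h3⟩
  refine ⟨?_, h2, ?_⟩
  · refine le_trans ?_ h1
    exact opNorm_submatrix_le (of X) (f := fun i : Fin d => e (Sum.inr i))
      (e.injective.comp Sum.inr_injective)
  · refine le_trans (le_of_eq ?_) h3
    congr 1
    have hvec : v ᵥ* of X = w ᵥ* of (fun a => X (e (Sum.inl a))) +
        u ᵥ* of (fun i => X (e (Sum.inr i))) := by
      ext r
      simp only [vecMul, dotProduct, Pi.add_apply, of_apply]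
      rw [← e.sum_comp, Fintype.sum_sum_type]
    have hrow : (rowGram S X *ᵥ v) ∘ (fun i : Fin d => e (Sum.inr i)) =
        of (fun i => X (e (Sum.inr i))) *ᵥ (S *ᵥ (v ᵥ* of X)) := by
      rw [rowGram_mulVec]; rfl
    have hsub : (rowGram S X *ᵥ v - lam • v) ∘ (fun i : Fin d => e (Sum.inr i)) =
        (rowGram S X *ᵥ v) ∘ (fun i : Fin d => e (Sum.inr i)) - lam • u := rfl
    rw [hsub, hrow, hvec, mulVec_add, mulVec_add]
    simp only [hy]
    abel

/-- Unit vectors structured up to scale `D` but not up to `D / 2`: the block `b` witnesses the lack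
of structure, and the block `a` carries a part of the vector with small coordinates. -/
def structuredClass {γ β : Type*} [Fintype γ] [DecidableEq β] (blk : γ → β) (q n : ℕ) (D : ℝ)
    (a b : β) : Set (γ → ℝ) :=
  {v | euclNorm v = 1 ∧ IsStructured blk q n D v ∧
    (1 / (q : ℝ) ^ 2) ^ 2 ≤ ∑ j ∈ smallBlock blk (q / √n) v a, v j ^ 2 ∧
    ∀ θ : ℝ, √n / (2 * q) ≤ θ → θ ≤ D / 2 →
      (q : ℝ) ^ 2 ≤ ∑ j ∈ smallBlock blk (q / √n) v b, (1 - Real.cos (2 * Real.pi * θ * v j))}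

lemma choose_le_pow_of_le {N k : ℕ} {B : ℝ} (hk : 0 < k) (hB : 3 * (N : ℝ) / k ≤ B) :
    (N.choose k : ℝ) ≤ B ^ k := by
  have hk0 : (0 : ℝ) < k := by exact_mod_cast hk
  have h1 : (N.choose k : ℝ) ≤ (N : ℝ) ^ k / (k.factorial : ℝ) := Nat.choose_le_pow_div k N
  have h2 := Real.pow_div_factorial_le_exp (k : ℝ) hk0.le k
  have h3 : Real.exp 1 ≤ 3 := by have := Real.exp_one_lt_d9; linarith
  calc (N.choose k : ℝ) ≤ (N : ℝ) ^ k / (k.factorial : ℝ) := h1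
    _ = ((N : ℝ) / k) ^ k * ((k : ℝ) ^ k / k.factorial) := by rw [div_pow]; field_simp
    _ ≤ ((N : ℝ) / k) ^ k * Real.exp k := by gcongr
    _ = ((N : ℝ) / k * Real.exp 1) ^ k := by rw [mul_pow, ← Real.exp_nat_mul, mul_one]
    _ ≤ B ^ k := by
        gcongr
        refine le_trans ?_ hB
        calc (N : ℝ) / k * Real.exp 1 ≤ N / k * 3 := by gcongr
          _ = _ := by ring

/-! ### Union bound over the net -/

/-- The net has about `(D q / √n) ^ (d + m)` points and each is bad with probability about
`(q ^ 7 / D) ^ d`; the powers of `D` nearly cancel and `√n ≥ q ^ 9` wins. -/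
lemma net_card_mul_prob_le {n q d m : ℕ} {D G c₁ : ℝ} (hD : 0 < D) (hG : 0 < G) (hn : 0 < n)
    (hc₁ : 0 < c₁) (hq : 1 ≤ q) (hDm : D ^ m ≤ Real.exp n) (hq9 : (q : ℝ) ^ 9 ≤ √n)
    (hd : c₁ * n / 2 ≤ d) (hGq : G * Real.exp (34 / c₁) ≤ q) :
    Real.exp (15 * n) * ((D * q / √n) ^ (d + m) * (G * q ^ 7 / D) ^ d) ≤ Real.exp (-n) := by
  have hq0 : (0 : ℝ) < q := by exact_mod_cast hq
  have hq1 : (1 : ℝ) ≤ q := by exact_mod_cast hq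
  have hn0 : (0 : ℝ) < n := by exact_mod_cast hn
  have hsn : 0 < √(n : ℝ) := Real.sqrt_pos.2 hn0
  have e1 : (D * q / √n) ^ (d + m) * (G * q ^ 7 / D) ^ d =
      (G * (q ^ 8 / √n)) ^ d * (D ^ m * (q / √n) ^ m) := by
    rw [pow_add, mul_right_comm, ← mul_pow, ← mul_pow]
    congr 2
    · field_simp
    · field_simp
  have e2 : (q : ℝ) ^ 8 / √n ≤ 1 / q := by
    rw [div_le_div_iff₀ hsn hq0]
    linarith [show (q : ℝ) ^ 8 * q = q ^ 9 by ring]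
  have e3 : ((q : ℝ) / √n) ^ m ≤ 1 := by
    apply pow_le_one₀ (by positivity)
    rw [div_le_one hsn]
    exact (le_self_pow₀ hq1 (by norm_num)).trans hq9
  have e4 : G * ((q : ℝ) ^ 8 / √n) ≤ Real.exp (-(34 / c₁)) := by
    calc G * ((q : ℝ) ^ 8 / √n) ≤ G * (1 / q) := by gcongr
      _ ≤ Real.exp (-(34 / c₁)) := by
        rw [Real.exp_neg, mul_one_div, ← one_div, div_le_div_iff₀ hq0 (Real.exp_pos _)]
        linarith
  have e5 : (G * ((q : ℝ) ^ 8 / √n)) ^ d ≤ Real.exp (-(17 * n)) := by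
    calc _ ≤ Real.exp (-(34 / c₁)) ^ d := by gcongr
      _ = Real.exp (-(34 / c₁ * d)) := by rw [← Real.exp_nat_mul]; congr 1; ring
      _ ≤ Real.exp (-(17 * n)) := by
        apply Real.exp_le_exp.2
        have : 34 / c₁ * (c₁ * n / 2) ≤ 34 / c₁ * d := by gcongr
        have h2 : 34 / c₁ * (c₁ * n / 2) = 17 * n := by field_simp; norm_num
        linarith
  rw [e1]
  calc _ ≤ Real.exp (15 * n) * (Real.exp (-(17 * n)) * (Real.exp n * 1)) := by gcongr
    _ = Real.exp (-n) := by
      rw [mul_one, ← Real.exp_add, ← Real.exp_add]; congr 1; ring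

set_option maxHeartbeats 4000000 in
open Matrix in
/-- Eigenvectors of `X S Xᵀ` in a class of structured vectors are rare: union bound over the net
`exists_structured_net`, with `measure_near_eigenvector_le` for each point. -/
theorem exists_measure_structuredClass_le {q₀ K₀ c c₁ ℓ K : ℝ} (hq₀ : 0 < q₀) (hK₀ : 1 ≤ K₀)
    (hc : 0 < c) (hc₁ : 0 < c₁) (hℓ : 0 < ℓ) (hK : 1 ≤ K) :
    ∃ (q₁ : ℕ) (κ : ℝ), 0 < κ ∧ ∀ q n : ℕ, q₁ ≤ q → ∀ (γ ρ : Type) [Fintype γ] [Fintype ρ]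
      [DecidableEq γ] [DecidableEq ρ], Regime c₁ q n (Fintype.card γ) (Fintype.card ρ) →
      ∀ blk : γ → Fin (q ^ 2),
      (∀ i, c₁ * n / (2 * q ^ 2) ≤ (Finset.univ.filter fun j => blk j = i).card) →
      (∀ i, ((Finset.univ.filter fun j => blk j = i).card : ℝ) ≤ 2 * n / q ^ 2) →
      ∀ (σ : ℝ) (μ : Measure ℝ) [IsProbabilityMeasure μ], SpreadLaw σ q₀ K₀ μ →
      IsAntiConcentrated c μ → ∀ S : Matrix ρ ρ ℝ, SpectralBounds ℓ S →
      ∀ D : ℝ, √n / (2 * q) ≤ D → D ≤ 4 ^ q * (√n / (2 * q)) → ∀ a b : Fin (q ^ 2),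
      (iidLaw γ ρ μ).real {X | opNorm (of X) ≤ K * √n ∧ ∃ lam : ℝ,
        ∃ v ∈ structuredClass blk q n D a b, rowGram S X *ᵥ v = lam • v} ≤
          Real.exp (-n) + n * Real.exp (-(κ * n / q ^ 2)) := by
  obtain ⟨Γ₀, q₂, hΓ₀, hsmall⟩ := exists_small_ball_power hq₀ hK₀
  set G₁ : ℝ := 2 * ℓ * K ^ 2 + 1 with hG₁
  have hG₁0 : 0 < G₁ := by positivity
  set G₄ : ℝ := c * c₁ ^ 3 / (2304 * ℓ ^ 2) with hG₄
  have hG₄0 : 0 < G₄ := by positivity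
  set G₅ : ℝ := G₄ / G₁ ^ 2 with hG₅
  have hG₅0 : 0 < G₅ := by positivity
  set G : ℝ := Γ₀ / √G₅ with hG
  have hG0 : 0 < G := by positivity
  obtain ⟨q₁, hq₁⟩ := exists_nat_ge (max 80 (max K₀ (max (8 / c₁) (max (G * Real.exp (34 / c₁))
    (max q₂ (2 * ℓ * K ^ 2 + 5))))))
  refine ⟨q₁, c * c₁ / 16, by positivity, ?_⟩
  intro q n hq γ ρ _ _ _ _ hR blk hlo hhi σ μ _ hμ hμa S hS D hD1 hD2 a b
  have hqR : max 80 (max K₀ (max (8 / c₁) (max (G * Real.exp (34 / c₁))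
    (max q₂ (2 * ℓ * K ^ 2 + 5))))) ≤ (q : ℝ) := hq₁.trans (by exact_mod_cast hq)
  simp only [max_le_iff] at hqR
  obtain ⟨hq80, hqK, hqc, hqG, hqq₂, hqℓ⟩ := hqR
  have hq0 : (0 : ℝ) < q := by linarith
  have hn0 : (0 : ℝ) < n := by exact_mod_cast hR.n_pos
  have hsn : 0 < √(n : ℝ) := Real.sqrt_pos.2 hn0
  have hnn : √(n : ℝ) * √n = n := Real.mul_self_sqrt hn0.le
  have hq9 := hR.pow_nine_le_sqrt
  have hq18 : (q : ℝ) ^ 18 ≤ n := by exact_mod_cast hR.pow_le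
  set p := Fintype.card γ with hp
  set N := Fintype.card ρ with hN
  have hpn : (p : ℝ) ≤ n := by exact_mod_cast hR.p_le
  have hNn : (N : ℝ) ≤ n := by exact_mod_cast hR.N_le
  have hc₁1 : c₁ ≤ 1 := by
    exact le_of_mul_le_mul_right (by linarith [hR.aspect.trans hpn]) hn0
  have hD0 : 0 < D := lt_of_lt_of_le (by positivity) hD1
  have hDexp := hR.scale_le_exp hD2
  -- the rows carrying the two blocks, and the remaining `d` rows
  let P : γ → Prop := fun j => blk j = a ∨ blk j = b
  set d := Fintype.card {j // ¬ P j} with hd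
  set m := Fintype.card {j // P j} with hm
  let e : {j // P j} ⊕ Fin d ≃ γ :=
    (Equiv.sumCongr (Equiv.refl _) (Fintype.equivFin {j // ¬ P j}).symm).trans (Equiv.sumCompl P)
  have hdm : d + m = p := by
    have := Fintype.card_congr e
    rw [Fintype.card_sum, Fintype.card_fin] at this
    omega
  have hmle : (m : ℝ) ≤ 4 * n / q ^ 2 := by
    have h1 : m ≤ (Finset.univ.filter fun j => blk j = a).card +
        (Finset.univ.filter fun j => blk j = b).card := by
      rw [hm, Fintype.card_subtype, Finset.filter_or]
      exact Finset.card_union_le _ _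
    have h2 : (m : ℝ) ≤ ((Finset.univ.filter fun j => blk j = a).card : ℝ) +
        ((Finset.univ.filter fun j => blk j = b).card : ℝ) := by exact_mod_cast h1
    refine h2.trans ((add_le_add (hhi a) (hhi b)).trans (le_of_eq ?_))
    ring
  have hmge : c₁ * n / (2 * q ^ 2) ≤ m := by
    refine (hlo a).trans ?_
    have : (Finset.univ.filter fun j => blk j = a).card ≤ m := by
      rw [hm, Fintype.card_subtype]
      exact Finset.card_le_card fun j hj =>
        Finset.mem_filter.2 ⟨Finset.mem_univ _, Or.inl (Finset.mem_filter.1 hj).2⟩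
    exact_mod_cast this
  have hnq2 : (q : ℝ) * q ≤ n / q ^ 2 := by
    rw [le_div_iff₀ (by positivity)]
    calc (q : ℝ) * q * (q : ℝ) ^ 2 = (q : ℝ) ^ 4 := by ring
      _ ≤ (q : ℝ) ^ 18 := pow_le_pow_right₀ (by linarith) (by norm_num)
      _ ≤ (n : ℝ) := hq18
  have hqc' : 8 ≤ (q : ℝ) * c₁ := by rwa [div_le_iff₀ hc₁] at hqc
  have hqc2 : 8 ≤ c₁ * (q : ℝ) ^ 2 := by
    have h1 : (q : ℝ) * c₁ * 1 ≤ q * c₁ * q := by gcongr; linarith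
    linarith [show (q : ℝ) * c₁ * q = c₁ * q ^ 2 by ring]
  have hdge : c₁ * n / 2 ≤ d := by
    have h1 : (d : ℝ) + m = p := by exact_mod_cast hdm
    have h2 : 4 * n / (q : ℝ) ^ 2 ≤ c₁ * n / 2 := by
      rw [div_le_div_iff₀ (by positivity) (by norm_num)]
      linarith [mul_le_mul_of_nonneg_right hqc2 hn0.le,
        show c₁ * (q : ℝ) ^ 2 * n = c₁ * n * q ^ 2 by ring]
    have := hR.aspect
    linarith
  have hdn : (d : ℝ) ≤ n := by
    have : d ≤ p := by omega
    exact le_trans (by exact_mod_cast this) hpn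
  -- volume of the remaining rows
  -- The two blocks leave codimension at least `k` for the remaining rows.
  set k := ⌊c₁ * n / (2 * q ^ 2)⌋₊ with hk
  have hkle : (k : ℝ) ≤ c₁ * n / (2 * q ^ 2) := Nat.floor_le (by positivity)
  have hbig : 2 ≤ c₁ * n / (2 * (q : ℝ) ^ 2) := by
    have h1 : c₁ * n / (2 * (q : ℝ) ^ 2) = c₁ / 2 * (n / q ^ 2) := by field_simp
    rw [h1]
    have : c₁ / 2 * (q * q) ≤ c₁ / 2 * (n / q ^ 2) := by gcongr
    linarith [show c₁ / 2 * ((q : ℝ) * q) = c₁ * q ^ 2 / 2 by ring]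
  have hkge : c₁ * n / (4 * q ^ 2) ≤ k := by
    have h1 := (Nat.lt_floor_add_one (c₁ * n / (2 * (q : ℝ) ^ 2))).le
    have h2 : c₁ * n / (4 * (q : ℝ) ^ 2) = c₁ * n / (2 * q ^ 2) / 2 := by field_simp; norm_num
    rw [h2]
    rw [← hk] at h1
    linarith
  have hk0 : 0 < k := by
    have : (0 : ℝ) < k := lt_of_lt_of_le (by positivity) hkge
    exact_mod_cast this
  have hdk : d + k ≤ N + 1 := by
    have h1 : (k : ℝ) ≤ m := hkle.trans hmge
    have h2 : k ≤ m := by exact_mod_cast h1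
    have := hR.p_le
    have := hR.le_N
    omega
  set B : ℝ := 12 * q ^ 2 / c₁ with hB
  have hB1 : 1 < B := by
    rw [hB, one_lt_div hc₁]
    linarith [one_le_pow₀ (n := 2) (show (1 : ℝ) ≤ q by linarith)]
  have hch : (N.choose k : ℝ) ≤ B ^ k := by
    apply choose_le_pow_of_le hk0
    rw [div_le_iff₀ (by exact_mod_cast hk0), hB]
    calc 3 * (N : ℝ) ≤ 3 * n := by linarith
      _ = 12 * q ^ 2 / c₁ * (c₁ * n / (4 * q ^ 2)) := by field_simp; norm_num
      _ ≤ _ := by gcongr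
  set r : ℝ := c * c₁ ^ 3 * n / (2304 * q ^ 6) with hr
  have hr0 : 0 < r := by positivity
  have hBr : B ^ 2 * r ≤ c * k / 4 := by
    calc B ^ 2 * r = c * (c₁ * n / (4 * q ^ 2)) / 4 := by
          rw [hB, hr]; field_simp; norm_num
      _ ≤ _ := by gcongr
  have hdet := measure_det_lt_le (d := d) hc hℓ μ hμa.isNonConcentrated hdk hB1 hch hr0 hBr hS
  set D₀ : ℝ := r / ℓ ^ 2 with hD₀
  have hD₀0 : 0 < D₀ := by positivity
  -- the approximation scales
  set δ : ℝ := q ^ 2 / D with hδ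
  have hδ0 : 0 < δ := by positivity
  -- Replacing `v` by a point of the net and `lam` by a multiple of `n δ` perturbs the eigenvector
  -- equation by at most `η`; with this `s` the factor `exp (s η ^ 2)` is `exp n`.
  set η : ℝ := G₁ * (n * δ) with hη
  have hη0 : 0 < η := by positivity
  set s : ℝ := n / η ^ 2 with hs
  have hs0 : 0 < s := by positivity
  have hsη : s * η ^ 2 = n := by rw [hs]; field_simp
  have hsb : s * (ℓ * (K * √n)) ^ 2 ≤ (D / 2 / (q * K₀)) ^ 2 := by
    have h1 : s * (ℓ * (K * √n)) ^ 2 = (ℓ * K * D / (G₁ * q ^ 2)) ^ 2 := by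
      have h0 : (ℓ * (K * √n)) ^ 2 = ℓ ^ 2 * K ^ 2 * n := by
        rw [mul_pow, mul_pow, Real.sq_sqrt hn0.le]; ring
      rw [h0, hs, hη, hδ]; field_simp
    rw [h1]
    apply pow_le_pow_left₀ (by positivity)
    rw [div_div, div_le_div_iff₀ (by positivity) (by positivity)]
    have h2 : ℓ * K * 2 ≤ G₁ := by
      have h2' : ℓ * K ≤ ℓ * K ^ 2 :=
        mul_le_mul_of_nonneg_left (le_self_pow₀ hK (by norm_num)) hℓ.le
      rw [hG₁]; linarith
    have h3 : (q : ℝ) * K₀ ≤ q ^ 2 := by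
      rw [sq]; exact mul_le_mul_of_nonneg_left hqK hq0.le
    calc ℓ * K * D * (2 * (q * K₀)) = (ℓ * K * 2) * (D * (q * K₀)) := by ring
      _ ≤ G₁ * (D * q ^ 2) := by gcongr
      _ = _ := by ring
  -- the net
  obtain ⟨A, hAV, hAcard, hA⟩ := exists_structured_net (show 21 ≤ q by
    have : (21 : ℝ) ≤ q := by linarith
    exact_mod_cast this) hR blk hD1 hD2 (structuredClass blk q n D a b) fun v hv => ⟨hv.1, hv.2.1⟩
  set M : ℕ := ⌈ℓ * K ^ 2 / δ⌉₊ + 1 with hM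
  set L : Finset ℤ := Finset.Icc (-(M : ℤ)) M with hL
  let bad : (γ → ℝ) → ℤ → Set (γ → ρ → ℝ) := fun v i => {X | opNorm (of X) ≤ K * √n ∧
        D₀ ^ d ≤ (of (fun i => X (e (Sum.inr i))) * S *
          (of (fun i => X (e (Sum.inr i))) * S)ᵀ).det ∧
        euclNorm ((rowGram S X *ᵥ v - (i * (n * δ)) • v) ∘ fun i : Fin d => e (Sum.inr i)) ≤ η}
  let badDet : Set (γ → ρ → ℝ) := {X | (of (fun i => X (e (Sum.inr i))) * S *
          (of (fun i => X (e (Sum.inr i))) * S)ᵀ).det < D₀ ^ d}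
  have hcover : {X : γ → ρ → ℝ | opNorm (of X) ≤ K * √n ∧ ∃ lam : ℝ,
        ∃ v ∈ structuredClass blk q n D a b, rowGram S X *ᵥ v = lam • v} ⊆
      badDet ∪ ⋃ z ∈ A ×ˢ L, bad z.1 z.2 := by
    rintro X ⟨hX, lam, v, hvV, hev⟩
    by_cases hXd : X ∈ badDet
    · exact Or.inl hXd
    right
    obtain ⟨v', hv'A, hvv'⟩ := hA v hvV
    have hv1 := hvV.1
    have hv'1 : euclNorm v' = 1 := (hAV hv'A).1
    have hdist : euclNorm (v' - v) ≤ δ := by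
      refine (euclNorm_le_of_abs_le hpn (g := q ^ 2 / (D * √n)) (by positivity) _ fun j => ?_).trans
        (le_of_eq ?_)
      · rw [Pi.sub_apply, abs_sub_comm]; exact hvv' j
      · rw [hδ]; field_simp
    have hW : opNorm (rowGram S X) ≤ ℓ * K ^ 2 * n := by
      refine (opNorm_rowGram_le hℓ hS hX).trans (le_of_eq ?_)
      rw [mul_pow, Real.sq_sqrt hn0.le]; ring
    have hlam : |lam| ≤ ℓ * K ^ 2 * n := by
      have h1 := euclNorm_mulVec_le (rowGram S X) v
      rw [hev, euclNorm_smul, hv1, mul_one, mul_one] at h1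
      exact h1.trans hW
    have hnδ : 0 < n * δ := by positivity
    set i : ℤ := ⌊lam / (n * δ)⌋ with hi
    have hi1 : |lam - i * (n * δ)| ≤ n * δ := by
      have h1 := Int.floor_le (lam / (n * δ))
      have h2 := Int.lt_floor_add_one (lam / (n * δ))
      rw [le_div_iff₀ hnδ] at h1
      rw [div_lt_iff₀ hnδ] at h2
      rw [abs_le]
      constructor <;> linarith
    have hiL : i ∈ L := by
      have h1 : |lam / (n * δ)| ≤ (⌈ℓ * K ^ 2 / δ⌉₊ : ℝ) := by
        rw [abs_div, abs_of_pos hnδ]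
        refine le_trans ?_ (Nat.le_ceil _)
        rw [div_le_div_iff₀ hnδ hδ0]
        calc |lam| * δ ≤ (ℓ * K ^ 2 * n) * δ := by gcongr
          _ = _ := by ring
      have h2 := abs_le.1 h1
      rw [hL, Finset.mem_Icc, hi, hM]
      constructor
      · apply Int.le_floor.2
        push_cast; linarith
      · apply Int.floor_le_iff.2
        push_cast; linarith
    refine Set.mem_biUnion (x := (v', i)) (Finset.mem_coe.2 (Finset.mk_mem_product hv'A hiL)) ?_
    refine ⟨hX, not_lt.1 hXd, ?_⟩
    have hinj : Function.Injective fun i : Fin d => e (Sum.inr i) :=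
      e.injective.comp Sum.inr_injective
    refine (euclNorm_comp_le hinj _).trans ?_
    have e1 : rowGram S X *ᵥ v' - ((i : ℝ) * (n * δ)) • v' =
        rowGram S X *ᵥ (v' - v) + (lam • (v - v') + (lam - i * (n * δ)) • v') := by
      rw [mulVec_sub, hev, smul_sub, sub_smul]; abel
    rw [e1]
    refine (euclNorm_add_le _ _).trans ?_
    have h1 : euclNorm (rowGram S X *ᵥ (v' - v)) ≤ ℓ * K ^ 2 * n * δ :=
      (euclNorm_mulVec_le _ _).trans (mul_le_mul hW hdist (euclNorm_nonneg _) (by positivity))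
    have h2 : euclNorm (lam • (v - v')) ≤ ℓ * K ^ 2 * n * δ := by
      rw [euclNorm_smul, ← neg_sub, euclNorm_neg]
      exact mul_le_mul hlam hdist (euclNorm_nonneg _) (by positivity)
    have h3 : euclNorm ((lam - i * (n * δ)) • v') ≤ n * δ := by
      rw [euclNorm_smul, hv'1, mul_one]; exact hi1
    have h4 := euclNorm_add_le (lam • (v - v')) ((lam - i * (n * δ)) • v')
    rw [hη, hG₁]
    linarith
  -- the probability for one vector of the net and one approximate eigenvalue
  have hpair : ∀ z ∈ A ×ˢ L, (iidLaw γ ρ μ).real (bad z.1 z.2) ≤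
      Real.exp (2 * n) * (G * q ^ 7 / D) ^ d := by
    rintro ⟨v, i⟩ hz
    obtain ⟨hvA, -⟩ := Finset.mem_product.1 hz
    have hvV := hAV hvA
    have hPa : ∀ j ∈ smallBlock blk (q / √n) v a, P j := fun j hj =>
      Or.inl (Finset.mem_filter.1 hj).2.1
    have hPb : ∀ j ∈ smallBlock blk (q / √n) v b, P j := fun j hj =>
      Or.inr (Finset.mem_filter.1 hj).2.1
    have hw := hsmall q n p N c₁ (by exact_mod_cast hqq₂) hR σ μ hμ {j // P j} (fun j => v j)
      ((smallBlock blk (q / √n) v a).subtype P) ((smallBlock blk (q / √n) v b).subtype P) (D / 2)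
      (by positivity) (by linarith)
      (fun j hj => (Finset.mem_filter.1 (Finset.mem_subtype.1 hj)).2.2)
      (by rw [Finset.sum_subtype_of_mem (fun j => v j ^ 2) hPa]; exact hvV.2.2.1)
      (fun θ h1 h2 => by
        rw [Finset.sum_subtype_of_mem (fun j => 1 - Real.cos (2 * Real.pi * θ * v j)) hPb]
        exact hvV.2.2.2 θ h1 h2)
    have h1 := measure_near_eigenvector_le (Γ := Γ₀ * q ^ 2) hℓ (by positivity) hs0 hη0.le hD₀0
      hsb (by omega : d ≤ Fintype.card ρ) hS e v (i * (n * δ)) hw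
    refine h1.trans ?_
    rw [hsη, ← mul_pow]
    have hsD : s * D₀ = G₅ * (D / q ^ 5) ^ 2 := by
      rw [hs, hη, hδ, hD₀, hr, hG₅, hG₄]; field_simp
    have hroot : ((N.choose d : ℝ) / (s * D₀) ^ d) ^ (1 / 2 : ℝ) ≤
        Real.exp n * (q ^ 5 / (√G₅ * D)) ^ d := by
      have h0 : (Real.exp n * (q ^ 5 / (√G₅ * D)) ^ d) ^ 2 =
          Real.exp n ^ 2 * ((q ^ 5) ^ 2 / (G₅ * D ^ 2)) ^ d := by
        rw [mul_pow, ← pow_mul, mul_comm d 2, pow_mul, div_pow, mul_pow, Real.sq_sqrt hG₅0.le]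
      rw [← Real.sqrt_eq_rpow, Real.sqrt_le_left (by positivity), h0, hsD]
      have h2 : (N.choose d : ℝ) ≤ Real.exp n ^ 2 := by
        have h3 : (N.choose d : ℝ) ≤ 2 ^ N := by exact_mod_cast Nat.choose_le_two_pow N d
        have h4 : (2 : ℝ) ≤ Real.exp 1 := by have := Real.add_one_le_exp (1 : ℝ); linarith
        calc (N.choose d : ℝ) ≤ 2 ^ N := h3
          _ ≤ Real.exp 1 ^ N := by gcongr
          _ = Real.exp N := by rw [← Real.exp_nat_mul, mul_one]
          _ ≤ Real.exp (n + n) := Real.exp_le_exp.2 (by linarith)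
          _ = _ := by rw [Real.exp_add, sq]
      have h5 : (((q : ℝ) ^ 5) ^ 2 / (G₅ * D ^ 2)) ^ d = 1 / (G₅ * (D / q ^ 5) ^ 2) ^ d := by
        rw [one_div, ← inv_pow]; congr 1; field_simp
      rw [h5, mul_one_div]
      gcongr
    calc Real.exp n * ((Γ₀ * q ^ 2) ^ d * ((N.choose d : ℝ) / (s * D₀) ^ d) ^ (1 / 2 : ℝ))
        ≤ Real.exp n * ((Γ₀ * q ^ 2) ^ d * (Real.exp n * (q ^ 5 / (√G₅ * D)) ^ d)) := by gcongr
      _ = (Real.exp n * Real.exp n) * ((Γ₀ * q ^ 2) * (q ^ 5 / (√G₅ * D))) ^ d := by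
          rw [mul_pow (Γ₀ * (q : ℝ) ^ 2)]; ring
      _ = _ := by
          rw [← Real.exp_add, ← two_mul]
          congr 2
          rw [hG]; field_simp
  have hLcard : (L.card : ℝ) ≤ Real.exp n := by
    rw [hL, Int.card_Icc, show ((M : ℤ) + 1 - -(M : ℤ)).toNat = 2 * M + 1 by omega, hM]
    push_cast
    have h1 : (⌈ℓ * K ^ 2 / δ⌉₊ : ℝ) ≤ ℓ * K ^ 2 / δ + 1 := (Nat.ceil_lt_add_one (by positivity)).le
    have h2 : ℓ * K ^ 2 / δ ≤ ℓ * K ^ 2 * D := by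
      rw [hδ, div_div_eq_mul_div]
      exact div_le_self (by positivity) (one_le_pow₀ (by linarith))
    have h3 : ℓ * K ^ 2 * D ≤ ℓ * K ^ 2 * Real.exp (20 * q) := by gcongr
    have h4 : (1 : ℝ) ≤ Real.exp (20 * q) := Real.one_le_exp (by positivity)
    have h5 : (2 * ℓ * K ^ 2 + 5) * Real.exp (20 * q) ≤ q * Real.exp (20 * q) := by gcongr
    have h6 : (q : ℝ) * Real.exp (20 * q) ≤ Real.exp (21 * q) := by
      have h7 : (q : ℝ) ≤ Real.exp q := by have := Real.add_one_le_exp (q : ℝ); linarith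
      calc (q : ℝ) * Real.exp (20 * q) ≤ Real.exp q * Real.exp (20 * q) := by gcongr
        _ = _ := by rw [← Real.exp_add]; ring_nf
    have h8 : Real.exp (21 * q) ≤ Real.exp n := by
      apply Real.exp_le_exp.2
      have : (q : ℝ) ^ 2 ≤ q ^ 18 := pow_le_pow_right₀ (by linarith) (by norm_num)
      linarith [mul_le_mul_of_nonneg_right (show (21 : ℝ) ≤ q by linarith) hq0.le]
    linarith
  -- The excess `m` of the dimension of the net over the number of equations is harmless.
  have hDm : D ^ m ≤ Real.exp n := by
    calc D ^ m ≤ Real.exp (20 * q) ^ m := by gcongr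
      _ = Real.exp (m * (20 * q)) := by rw [← Real.exp_nat_mul]
      _ ≤ Real.exp n := by
        apply Real.exp_le_exp.2
        calc (m : ℝ) * (20 * q) ≤ 4 * n / q ^ 2 * (20 * q) := by gcongr
          _ = 80 * n / q := by field_simp; norm_num
          _ ≤ n := by
            rw [div_le_iff₀ hq0]
            linarith [mul_le_mul_of_nonneg_right hq80 hn0.le]
  have hunion : (iidLaw γ ρ μ).real (⋃ z ∈ A ×ˢ L, bad z.1 z.2) ≤ Real.exp (-n) := by
    calc _ ≤ ∑ z ∈ A ×ˢ L, (iidLaw γ ρ μ).real (bad z.1 z.2) := measureReal_biUnion_finset_le _ _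
      _ ≤ ∑ _z ∈ A ×ˢ L, Real.exp (2 * n) * (G * q ^ 7 / D) ^ d := Finset.sum_le_sum hpair
      _ = A.card * L.card * (Real.exp (2 * n) * (G * q ^ 7 / D) ^ d) := by
          rw [Finset.sum_const, Finset.card_product, nsmul_eq_mul]; push_cast; ring
      _ ≤ (Real.exp (12 * n) * (D * q / √n) ^ p) * Real.exp n *
          (Real.exp (2 * n) * (G * q ^ 7 / D) ^ d) := by gcongr
      _ = (Real.exp (12 * n) * Real.exp n * Real.exp (2 * n)) *
          ((D * q / √n) ^ (d + m) * (G * q ^ 7 / D) ^ d) := by rw [hdm]; ring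
      _ = Real.exp (15 * n) * ((D * q / √n) ^ (d + m) * (G * q ^ 7 / D) ^ d) := by
          rw [← Real.exp_add, ← Real.exp_add]; congr 2; ring
      _ ≤ _ := net_card_mul_prob_le hD0 hG0 hR.n_pos hc₁ hR.q_pos hDm hq9 hdge hqG
  have hdet' : (iidLaw γ ρ μ).real badDet ≤ n * Real.exp (-(c * c₁ / 16 * n / q ^ 2)) := by
    have hmp := (measurePreserving_snd (μ := iidLaw {j // P j} ρ μ) (ν := iidLaw (Fin d) ρ μ)).comp
      (measurePreserving_split (Measure.pi fun _ : ρ => μ) e)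
    have h1 : (iidLaw γ ρ μ).real badDet ≤ (iidLaw (Fin d) ρ μ).real
        {X | (of X * S * (of X * S)ᵀ).det < (r / ℓ ^ 2) ^ d} := by
      rw [measureReal_def, measureReal_def]
      refine ENNReal.toReal_mono (measure_ne_top _ _) ?_
      conv_rhs => rw [← hmp.map_eq]
      exact Measure.le_map_apply hmp.measurable.aemeasurable _
    refine h1.trans (hdet.trans ?_)
    have h2 : Real.exp (-(c * k / 4)) ≤ Real.exp (-(c * c₁ / 16 * n / q ^ 2)) := by
      apply Real.exp_le_exp.2
      have h3 : c * c₁ / 16 * n / (q : ℝ) ^ 2 = c / 4 * (c₁ * n / (4 * q ^ 2)) := by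
        field_simp; norm_num
      have h4 : c / 4 * (c₁ * n / (4 * (q : ℝ) ^ 2)) ≤ c / 4 * k := by gcongr
      linarith
    gcongr
  calc _ ≤ (iidLaw γ ρ μ).real (badDet ∪ ⋃ z ∈ A ×ˢ L, bad z.1 z.2) :=
        measureReal_mono hcover (measure_ne_top _ _)
    _ ≤ (iidLaw γ ρ μ).real badDet + (iidLaw γ ρ μ).real (⋃ z ∈ A ×ˢ L, bad z.1 z.2) :=
        measureReal_union_le _ _
    _ ≤ _ := by linarith

/-! ### Eigenvectors are unstructured -/

/-- A finite type splits into `k` blocks of nearly equal size: the residue classes modulo `k` of an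
enumeration. -/
lemma exists_balanced_blocks (γ : Type*) [Fintype γ] {k : ℕ} (hk : 0 < k) :
    ∃ blk : γ → Fin k, ∀ i,
      Fintype.card γ / k ≤ (Finset.univ.filter fun j => blk j = i).card ∧
      (Finset.univ.filter fun j => blk j = i).card ≤ Fintype.card γ / k + 1 := by
  refine ⟨fun j => ⟨(Fintype.equivFin γ j : ℕ) % k, Nat.mod_lt _ hk⟩, fun i => ?_⟩
  have h1 : (Finset.univ.filter fun j : γ =>
      (⟨(Fintype.equivFin γ j : ℕ) % k, Nat.mod_lt _ hk⟩ : Fin k) = i).card =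
      Nat.count (fun x => x ≡ i [MOD k]) (Fintype.card γ) := by
    rw [Nat.count_eq_card_filter_range]
    refine Finset.card_bij (fun j _ => (Fintype.equivFin γ j : ℕ)) ?_ ?_ ?_
    · intro j hj
      rw [Finset.mem_filter, Fin.ext_iff] at hj
      rw [Finset.mem_filter, Finset.mem_range, Nat.ModEq, Nat.mod_eq_of_lt i.2]
      exact ⟨(Fintype.equivFin γ j).2, hj.2⟩
    · intro j _ j' _ h
      exact (Fintype.equivFin γ).injective (Fin.ext h)
    · intro x hx
      rw [Finset.mem_filter, Finset.mem_range, Nat.ModEq, Nat.mod_eq_of_lt i.2] at hx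
      refine ⟨(Fintype.equivFin γ).symm ⟨x, hx.1⟩, ?_, by simp⟩
      rw [Finset.mem_filter, Fin.ext_iff]
      simpa using hx.2
  rw [h1, Nat.count_modEq_card _ hk]
  split_ifs <;> omega

lemma sum_sum_smallBlock {γ β : Type*} [Fintype γ] [Fintype β] [DecidableEq γ] [DecidableEq β]
    (blk : γ → β) (b : ℝ) (v f : γ → ℝ) :
    ∑ i, ∑ j ∈ smallBlock blk b v i, f j = ∑ j ∈ (largeCoords b v)ᶜ, f j := by
  rw [← Finset.sum_fiberwise (largeCoords b v)ᶜ blk f]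
  refine Finset.sum_congr rfl fun i _ => Finset.sum_congr ?_ fun _ _ => rfl
  ext j
  simp [smallBlock, largeCoords, and_comm]

lemma eight_mul_sq_le_one_sub_cos {x : ℝ} (hx : |x| ≤ 1 / 2) :
    8 * x ^ 2 ≤ 1 - Real.cos (2 * Real.pi * x) := by
  have hpi := Real.pi_pos
  have h3 := Real.cos_le_one_sub_mul_cos_sq (x := 2 * Real.pi * x) (by
    rw [abs_mul, abs_of_pos (by positivity)]; nlinarith)
  have h4 : 2 / Real.pi ^ 2 * (2 * Real.pi * x) ^ 2 = 8 * x ^ 2 := by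
    field_simp; ring
  linarith

/-- An incompressible vector is not structured at the bottom scale: there the dilated coordinates
are at most `1/2` in absolute value, so the nearest integer vector is zero. -/
lemma Regime.not_isStructured_bot {c₁ : ℝ} {q n p N : ℕ} (h : Regime c₁ q n p N) {γ : Type*}
    [Fintype γ] [DecidableEq γ] (blk : γ → Fin (q ^ 2)) {v : γ → ℝ}
    (hv : (1 / (q : ℝ)) ^ 2 < ∑ j ∈ (largeCoords (q / √n) v)ᶜ, v j ^ 2) :
    ¬ IsStructured blk q n (√n / (2 * q)) v := by
  intro hst
  have hq0 : (0 : ℝ) < q := by exact_mod_cast h.q_pos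
  have hq1 : (1 : ℝ) ≤ q := by exact_mod_cast h.q_pos
  have hn0 : (0 : ℝ) < n := by exact_mod_cast h.n_pos
  have hsn : 0 < √(n : ℝ) := Real.sqrt_pos.2 hn0
  set θ := √(n : ℝ) / (2 * q) with hθ
  have h1 : ∀ i, ∑ j ∈ smallBlock blk (q / √n) v i, 8 * θ ^ 2 * v j ^ 2 ≤ (q : ℝ) ^ 2 := by
    intro i
    obtain ⟨t, ht1, ht2, ht⟩ := hst i
    obtain rfl : t = θ := le_antisymm ht2 ht1
    refine le_trans (Finset.sum_le_sum fun j hj => ?_) ht.le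
    have hj' : |v j| ≤ q / √n := (Finset.mem_filter.1 hj).2.2
    have hx : |θ * v j| ≤ 1 / 2 := by
      rw [abs_mul, abs_of_pos (by rw [hθ]; positivity)]
      calc θ * |v j| ≤ θ * (q / √n) := by gcongr
        _ = 1 / 2 := by rw [hθ]; field_simp
    have := eight_mul_sq_le_one_sub_cos hx
    rw [mul_assoc (2 * Real.pi)]
    linarith [show 8 * (θ * v j) ^ 2 = 8 * θ ^ 2 * v j ^ 2 by ring]
  have h2 := Finset.sum_le_sum fun i (_ : i ∈ Finset.univ) => h1 i
  rw [sum_sum_smallBlock blk (q / √n) v fun j => 8 * θ ^ 2 * v j ^ 2, ← Finset.mul_sum,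
    Finset.sum_const, Finset.card_univ, Fintype.card_fin, nsmul_eq_mul] at h2
  push_cast at h2
  have hθ2 : 8 * θ ^ 2 = 2 * n / q ^ 2 := by
    rw [hθ, div_pow, Real.sq_sqrt hn0.le]; field_simp; norm_num
  have h3 : 2 * n / (q : ℝ) ^ 2 * (1 / q) ^ 2 < (q : ℝ) ^ 2 * q ^ 2 := by
    rw [← hθ2]
    exact lt_of_lt_of_le (mul_lt_mul_of_pos_left hv (by rw [hθ]; positivity)) h2
  rw [one_div, inv_pow, ← div_eq_mul_inv, div_div, div_lt_iff₀ (by positivity)] at h3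
  have h4 : (q : ℝ) ^ 8 ≤ q ^ 18 := pow_le_pow_right₀ hq1 (by norm_num)
  have h5 : (q : ℝ) ^ 18 ≤ n := by exact_mod_cast h.pow_le
  linarith [show (q : ℝ) ^ 2 * q ^ 2 * (q ^ 2 * q ^ 2) = q ^ 8 by ring]

/-- An incompressible structured vector belongs to one of the dyadic classes. -/
lemma Regime.exists_mem_structuredClass {c₁ : ℝ} {q n p N : ℕ} (h : Regime c₁ q n p N)
    {γ : Type*} [Fintype γ] [DecidableEq γ] (blk : γ → Fin (q ^ 2)) {v : γ → ℝ}
    (hv1 : euclNorm v = 1)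
    (hv : (1 / (q : ℝ)) ^ 2 < ∑ j ∈ (largeCoords (q / √n) v)ᶜ, v j ^ 2)
    (hst : IsStructured blk q n (4 ^ q * (√n / (2 * q))) v) :
    ∃ t ∈ Finset.range (2 * q), ∃ a b,
      v ∈ structuredClass blk q n (2 ^ (t + 1) * (√n / (2 * q))) a b := by
  classical
  have hq0 : (0 : ℝ) < q := by exact_mod_cast h.q_pos
  -- The class is the one of the smallest dyadic scale at which the vector is structured.
  have hex : ∃ t : ℕ, IsStructured blk q n (2 ^ t * (√n / (2 * q))) v :=
    ⟨2 * q, by rw [pow_mul]; norm_num; exact hst⟩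
  have hle : Nat.find hex ≤ 2 * q := Nat.find_min' hex (by rw [pow_mul]; norm_num; exact hst)
  have hne : Nat.find hex ≠ 0 := fun h0 => by
    have := Nat.find_spec hex
    rw [h0, pow_zero, one_mul] at this
    exact h.not_isStructured_bot blk hv this
  obtain ⟨t, ht⟩ := Nat.exists_eq_succ_of_ne_zero hne
  have hmin : ¬ IsStructured blk q n (2 ^ t * (√n / (2 * q))) v :=
    Nat.find_min hex (by omega)
  have hspec := Nat.find_spec hex
  rw [ht] at hspec
  refine ⟨t, Finset.mem_range.2 (by omega), ?_⟩
  unfold IsStructured at hmin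
  push Not at hmin
  obtain ⟨b, hb⟩ := hmin
  -- By the pigeonhole principle one of the `q ^ 2` blocks carries its share of the mass.
  have ha : ∃ a, (1 / (q : ℝ) ^ 2) ^ 2 ≤ ∑ j ∈ smallBlock blk (q / √n) v a, v j ^ 2 := by
    by_contra! hcon
    have h2 := Finset.sum_le_sum fun i (_ : i ∈ Finset.univ) => (hcon i).le
    rw [sum_sum_smallBlock blk (q / √n) v fun j => v j ^ 2, Finset.sum_const, Finset.card_univ,
      Fintype.card_fin, nsmul_eq_mul] at h2
    refine absurd (hv.trans_le h2) (not_lt.2 (le_of_eq ?_))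
    push_cast
    field_simp
  obtain ⟨a, ha⟩ := ha
  refine ⟨a, b, hv1, hspec, ha, fun θ h1 h2 => hb θ h1 (h2.trans (le_of_eq ?_))⟩
  rw [pow_succ]; ring

lemma Regime.le_exp {c₁ : ℝ} {q n p N : ℕ} (h : Regime c₁ q n p N) :
    (n : ℝ) ≤ Real.exp (36 * q) := by
  have hn0 : (0 : ℝ) < n := by exact_mod_cast h.n_pos
  calc (n : ℝ) = Real.exp (Real.log n) := (Real.exp_log hn0).symm
    _ ≤ _ := Real.exp_le_exp.2 h.log_le

open Matrix in
/-- Incompressible structured eigenvectors are rare. -/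
theorem exists_measure_structured_le {q₀ K₀ c c₁ ℓ K : ℝ} (hq₀ : 0 < q₀) (hK₀ : 1 ≤ K₀)
    (hc : 0 < c) (hc₁ : 0 < c₁) (hℓ : 0 < ℓ) (hK : 1 ≤ K) :
    ∃ q₁ : ℕ, ∀ q n : ℕ, q₁ ≤ q → ∀ (γ ρ : Type) [Fintype γ] [Fintype ρ]
      [DecidableEq γ] [DecidableEq ρ], Regime c₁ q n (Fintype.card γ) (Fintype.card ρ) →
      ∀ blk : γ → Fin (q ^ 2),
      (∀ i, c₁ * n / (2 * q ^ 2) ≤ (Finset.univ.filter fun j => blk j = i).card) →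
      (∀ i, ((Finset.univ.filter fun j => blk j = i).card : ℝ) ≤ 2 * n / q ^ 2) →
      ∀ (σ : ℝ) (μ : Measure ℝ) [IsProbabilityMeasure μ], SpreadLaw σ q₀ K₀ μ →
      IsAntiConcentrated c μ → ∀ S : Matrix ρ ρ ℝ, SpectralBounds ℓ S →
      (iidLaw γ ρ μ).real {X | opNorm (of X) ≤ K * √n ∧ ∃ (lam : ℝ) (v : γ → ℝ),
        euclNorm v = 1 ∧ rowGram S X *ᵥ v = lam • v ∧
        (1 / (q : ℝ)) ^ 2 < ∑ j ∈ (largeCoords (q / √n) v)ᶜ, v j ^ 2 ∧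
        IsStructured blk q n (4 ^ q * (√n / (2 * q))) v} ≤ Real.exp (-q) := by
  obtain ⟨q₂, κ, hκ, hmain⟩ := exists_measure_structuredClass_le hq₀ hK₀ hc hc₁ hℓ hK
  set κ' := min κ 1 with hκ'
  have hκ'0 : 0 < κ' := by positivity
  obtain ⟨q₁, hq₁⟩ := exists_nat_ge (max (q₂ : ℝ) (max 4 (43 / κ')))
  refine ⟨q₁, ?_⟩
  intro q n hq γ ρ _ _ _ _ hR blk hlo hhi σ μ _ hμ hμa S hS
  have hqR : max (q₂ : ℝ) (max 4 (43 / κ')) ≤ (q : ℝ) := hq₁.trans (by exact_mod_cast hq)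
  simp only [max_le_iff] at hqR
  obtain ⟨hqq₂, hq4, hqκ⟩ := hqR
  have hq0 : (0 : ℝ) < q := by linarith
  have hn0 : (0 : ℝ) < n := by exact_mod_cast hR.n_pos
  have hsn : 0 < √(n : ℝ) := Real.sqrt_pos.2 hn0
  have hθ : 0 < √(n : ℝ) / (2 * q) := by positivity
  have hq18 : (q : ℝ) ^ 18 ≤ n := by exact_mod_cast hR.pow_le
  have hnq : (q : ℝ) ^ 2 ≤ n / q ^ 2 := by
    rw [le_div_iff₀ (by positivity), ← pow_add]
    exact (pow_le_pow_right₀ (by linarith) (by norm_num)).trans hq18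
  have hone : ∀ z ∈ (Finset.range (2 * q)) ×ˢ (Finset.univ : Finset (Fin (q ^ 2) × Fin (q ^ 2))),
      (iidLaw γ ρ μ).real {X | opNorm (of X) ≤ K * √n ∧ ∃ lam : ℝ,
        ∃ v ∈ structuredClass blk q n (2 ^ (z.1 + 1) * (√n / (2 * q))) z.2.1 z.2.2,
          rowGram S X *ᵥ v = lam • v} ≤ 2 * Real.exp (36 * q - κ' * q ^ 2) := by
    rintro ⟨t, a, b⟩ hz
    have ht := Finset.mem_range.1 (Finset.mem_product.1 hz).1
    dsimp only at ht ⊢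
    refine (hmain q n (by exact_mod_cast hqq₂) γ ρ hR blk hlo hhi σ μ hμ hμa S hS _ ?_ ?_ a b).trans
      ?_
    · exact le_mul_of_one_le_left hθ.le (one_le_pow₀ (by norm_num))
    · gcongr
      calc (2 : ℝ) ^ (t + 1) ≤ 2 ^ (2 * q) := pow_le_pow_right₀ (by norm_num) (by omega)
        _ = 4 ^ q := by rw [pow_mul]; norm_num
    · have hn1 : (1 : ℝ) ≤ n := by exact_mod_cast hR.n_pos
      have h1 : Real.exp (-(κ * n / q ^ 2)) ≤ Real.exp (-(κ' * q ^ 2)) := by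
        apply Real.exp_le_exp.2
        have : κ' * (q : ℝ) ^ 2 ≤ κ * (n / q ^ 2) := by
          gcongr
          exact min_le_left _ _
        rw [mul_div_assoc]; linarith
      have h2 : Real.exp (-n) ≤ Real.exp (-(κ' * q ^ 2)) := by
        apply Real.exp_le_exp.2
        have h3 : κ' * (q : ℝ) ^ 2 ≤ 1 * (n / q ^ 2) := by
          gcongr
          exact min_le_right _ _
        have h4 : (n : ℝ) / q ^ 2 ≤ n := div_le_self hn0.le (one_le_pow₀ (by linarith))
        linarith
      have h5 := hR.le_exp
      have h6 : Real.exp (36 * q - κ' * q ^ 2) =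
          Real.exp (36 * q) * Real.exp (-(κ' * (q : ℝ) ^ 2)) := by
        rw [← Real.exp_add, sub_eq_add_neg]
      rw [h6]
      have h7 : 1 * Real.exp (-(κ' * (q : ℝ) ^ 2)) ≤
          Real.exp (36 * q) * Real.exp (-(κ' * (q : ℝ) ^ 2)) := by
        gcongr; exact hn1.trans h5
      have h8 : (n : ℝ) * Real.exp (-(κ * n / q ^ 2)) ≤
          Real.exp (36 * q) * Real.exp (-(κ' * (q : ℝ) ^ 2)) := by gcongr
      linarith
  have hfin : (2 * q * (q ^ 2 * q ^ 2) : ℝ) * (2 * Real.exp (36 * q - κ' * q ^ 2)) ≤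
      Real.exp (-q) := by
    have h1 : (q : ℝ) ≤ Real.exp q := by have := Real.add_one_le_exp (q : ℝ); linarith
    have h2 : (4 : ℝ) ≤ Real.exp q := hq4.trans h1
    calc (2 * q * (q ^ 2 * q ^ 2) : ℝ) * (2 * Real.exp (36 * q - κ' * q ^ 2))
        = 4 * (q : ℝ) ^ 5 * Real.exp (36 * q - κ' * q ^ 2) := by ring
      _ ≤ Real.exp q * Real.exp q ^ 5 * Real.exp (36 * q - κ' * q ^ 2) := by gcongr
      _ = Real.exp (42 * q - κ' * q ^ 2) := by
          rw [← Real.exp_nat_mul, ← Real.exp_add, ← Real.exp_add]; congr 1; push_cast; ring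
      _ ≤ Real.exp (-q) := by
          apply Real.exp_le_exp.2
          rw [div_le_iff₀ hκ'0] at hqκ
          have := mul_le_mul_of_nonneg_right hqκ hq0.le
          linarith [show (q : ℝ) * κ' * q = κ' * q ^ 2 by ring]
  refine le_trans ?_ hfin
  calc _ ≤ (iidLaw γ ρ μ).real (⋃ z ∈ (Finset.range (2 * q)) ×ˢ
        (Finset.univ : Finset (Fin (q ^ 2) × Fin (q ^ 2))),
        {X | opNorm (of X) ≤ K * √n ∧ ∃ lam : ℝ,
        ∃ v ∈ structuredClass blk q n (2 ^ (z.1 + 1) * (√n / (2 * q))) z.2.1 z.2.2,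
          rowGram S X *ᵥ v = lam • v}) := by
        refine measureReal_mono ?_ (measure_ne_top _ _)
        rintro X ⟨hX, lam, v, hv1, hev, hv, hst⟩
        obtain ⟨t, ht, a, b, hab⟩ := hR.exists_mem_structuredClass blk hv1 hv hst
        refine Set.mem_biUnion (x := (t, a, b))
          (Finset.mem_coe.2 (Finset.mk_mem_product ht (Finset.mem_univ _))) ?_
        exact ⟨hX, lam, v, hab, hev⟩
    _ ≤ _ := measureReal_biUnion_finset_le _ _
    _ ≤ _ := Finset.sum_le_sum hone
    _ = _ := by
        rw [Finset.sum_const, Finset.card_product, Finset.card_range, Finset.card_univ,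
          Fintype.card_prod, Fintype.card_fin, nsmul_eq_mul]
        push_cast; ring

/-- Unstructured vectors give linear forms with only tiny atoms. -/
lemma exists_measure_linear_eq_le {q₀ K₀ : ℝ} (hq₀ : 0 < q₀) (hK₀ : 1 ≤ K₀) :
    ∃ q₁ : ℕ, ∀ (q n p N : ℕ) (c₁ : ℝ), q₁ ≤ q → Regime c₁ q n p N →
      ∀ (σ : ℝ) (μ : Measure ℝ) [IsProbabilityMeasure μ], SpreadLaw σ q₀ K₀ μ →
      ∀ (γ : Type) [Fintype γ] [DecidableEq γ] (blk : γ → Fin (q ^ 2)) (v : γ → ℝ),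
        (1 / (q : ℝ)) ^ 2 < ∑ j ∈ (largeCoords (q / √n) v)ᶜ, v j ^ 2 →
        ¬ IsStructured blk q n (4 ^ q * (√n / (2 * q))) v →
        ∀ b : ℝ, (Measure.pi fun _ : γ => μ).real {x | ∑ j, x j * v j = b} ≤ Real.exp (-q) := by
  obtain ⟨Γ₀, q₂, hΓ₀, hsmall⟩ := exists_small_ball_power hq₀ hK₀
  obtain ⟨q₁, hq₁⟩ := exists_nat_ge (max (q₂ : ℝ) (2 * Γ₀ * K₀))
  refine ⟨q₁, ?_⟩
  intro q n p N c₁ hq hR σ μ _ hμ γ _ _ blk v hv hst b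
  have hqR : max (q₂ : ℝ) (2 * Γ₀ * K₀) ≤ (q : ℝ) := hq₁.trans (by exact_mod_cast hq)
  simp only [max_le_iff] at hqR
  obtain ⟨hqq₂, hqΓ⟩ := hqR
  have hq0 : (0 : ℝ) < q := by exact_mod_cast hR.q_pos
  have hq1 : (1 : ℝ) ≤ q := by exact_mod_cast hR.q_pos
  have hn0 : (0 : ℝ) < n := by exact_mod_cast hR.n_pos
  have hsn : 0 < √(n : ℝ) := Real.sqrt_pos.2 hn0
  have hK0 : 0 < K₀ := by linarith
  set D : ℝ := 4 ^ q * (√n / (2 * q)) with hD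
  have hD0 : 0 < D := by positivity
  unfold IsStructured at hst
  push Not at hst
  obtain ⟨i, hi⟩ := hst
  have hA : ∃ a, (1 / (q : ℝ) ^ 2) ^ 2 ≤ ∑ j ∈ smallBlock blk (q / √n) v a, v j ^ 2 := by
    by_contra! hcon
    have h2 := Finset.sum_le_sum fun i (_ : i ∈ Finset.univ) => (hcon i).le
    rw [sum_sum_smallBlock blk (q / √n) v fun j => v j ^ 2, Finset.sum_const, Finset.card_univ,
      Fintype.card_fin, nsmul_eq_mul] at h2
    refine absurd (hv.trans_le h2) (not_lt.2 (le_of_eq ?_))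
    push_cast
    field_simp
  obtain ⟨i', hi'⟩ := hA
  -- The finest scale that the small-ball estimate allows.
  set a : ℝ := (D / (q * K₀)) ^ 2 with ha
  have ha0 : 0 < a := by positivity
  have h1 := hsmall q n p N c₁ (by exact_mod_cast hqq₂) hR σ μ hμ γ v _ _ D hD0 le_rfl
    (fun j hj => (Finset.mem_filter.1 hj).2.2) hi' hi a b ha0 le_rfl
  have h2 := measure_le_exp_mul_integral (Measure.pi fun _ : γ => μ)
    (f := fun x => (∑ j, x j * v j - b) ^ 2) (by fun_prop) (fun x => sq_nonneg _) a ha0.le 0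
  rw [mul_zero, Real.exp_zero, one_mul] at h2
  have h3 : {x : γ → ℝ | ∑ j, x j * v j = b} ⊆ {x | (∑ j, x j * v j - b) ^ 2 ≤ 0} := by
    intro x hx
    rw [Set.mem_ofPred_eq] at hx ⊢
    rw [hx]; simp
  refine (measureReal_mono h3 (measure_ne_top _ _)).trans (h2.trans (h1.trans ?_))
  have h4 : a ^ (-(1 / 2 : ℝ)) = q * K₀ / D := by
    rw [Real.rpow_neg ha0.le, ← Real.sqrt_eq_rpow, ha, Real.sqrt_sq (by positivity), inv_div]
  have h5 : Γ₀ * q ^ 2 * (q * K₀ / D) = (2 * Γ₀ * K₀) * (q ^ 4 / √n) * (1 / 4 ^ q) := by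
    rw [hD]; field_simp
  rw [h4, h5]
  have h6 : (q : ℝ) ^ 5 ≤ √n :=
    (pow_le_pow_right₀ hq1 (by norm_num)).trans hR.pow_nine_le_sqrt
  have h7 : (2 * Γ₀ * K₀) * ((q : ℝ) ^ 4 / √n) ≤ 1 := by
    calc (2 * Γ₀ * K₀) * ((q : ℝ) ^ 4 / √n) ≤ q * ((q : ℝ) ^ 4 / √n) := by gcongr
      _ = q ^ 5 / √n := by ring
      _ ≤ 1 := by rw [div_le_one hsn]; exact h6
  have h9 : Real.exp q ≤ 4 ^ q := by
    have : Real.exp 1 ≤ 4 := by have := Real.exp_one_lt_d9; linarith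
    rw [← mul_one (q : ℝ), Real.exp_nat_mul]
    gcongr
  calc _ ≤ 1 * (1 / Real.exp q) := by gcongr
    _ = Real.exp (-q) := by rw [Real.exp_neg, one_mul, one_div]

open Matrix in
/-- With overwhelming probability every eigenvector of `X S Xᵀ` is so unstructured that no linear
form with these coefficients has a noticeable atom. -/
theorem exists_measure_eigenvector_atom_le {σ q₀ K₀ c₁ ℓ : ℝ} (hσ : 0 < σ) (hq₀ : 0 < q₀)
    (hK₀ : 1 ≤ K₀) (hc₁ : 0 < c₁) (hℓ : 0 < ℓ) :
    ∃ q₁ : ℕ, ∀ q n : ℕ, q₁ ≤ q → ∀ (γ ρ : Type) [Fintype γ] [Fintype ρ]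
      [DecidableEq γ] [DecidableEq ρ], Regime c₁ q n (Fintype.card γ) (Fintype.card ρ) →
      ∀ (μ : Measure ℝ) [IsProbabilityMeasure μ], SpreadLaw σ q₀ K₀ μ →
      ∀ S : Matrix ρ ρ ℝ, SpectralBounds ℓ S →
      (iidLaw γ ρ μ).real {X | ∃ (lam : ℝ) (v : γ → ℝ) (b : ℝ),
        euclNorm v = 1 ∧ rowGram S X *ᵥ v = lam • v ∧
        Real.exp (-q) < (Measure.pi fun _ : γ => μ).real {x | ∑ j, x j * v j = b}} ≤
          3 * Real.exp (-q) := by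
  obtain ⟨c, hc, hc1, hanti⟩ := exists_anticoncentration hq₀ hK₀
  set K : ℝ := 45 + 9 * σ with hK
  have hK1 : 1 ≤ K := by linarith
  obtain ⟨q₂, hcomp⟩ := exists_measure_compressible_le (K := K) hc hc₁ hℓ (by linarith)
  obtain ⟨q₃, hstr⟩ := exists_measure_structured_le hq₀ hK₀ hc hc₁ hℓ hK1
  obtain ⟨q₄, hatom⟩ := exists_measure_linear_eq_le hq₀ hK₀
  obtain ⟨q₁, hq₁⟩ := exists_nat_ge (max (q₂ : ℝ) (max q₃ (max q₄ (max (8 / (c * c₁))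
    (max (2 / c₁) 1)))))
  refine ⟨q₁, ?_⟩
  intro q n hq γ ρ _ _ _ _ hR μ _ hμ S hS
  have hqR : max (q₂ : ℝ) (max q₃ (max q₄ (max (8 / (c * c₁)) (max (2 / c₁) 1)))) ≤ (q : ℝ) :=
    hq₁.trans (by exact_mod_cast hq)
  simp only [max_le_iff] at hqR
  obtain ⟨hqq₂, hqq₃, hqq₄, hqc, hqc₁, hq1⟩ := hqR
  have hq0 : (0 : ℝ) < q := by linarith
  have hn0 : (0 : ℝ) < n := by exact_mod_cast hR.n_pos
  have hq18 : (q : ℝ) ^ 18 ≤ n := by exact_mod_cast hR.pow_le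
  have hpn : (Fintype.card γ : ℝ) ≤ n := by exact_mod_cast hR.p_le
  have hnq : (q : ℝ) ≤ n / q ^ 2 := by
    rw [le_div_iff₀ (by positivity), ← pow_succ']
    exact (pow_le_pow_right₀ hq1 (by norm_num)).trans hq18
  obtain ⟨blk, hblk⟩ := exists_balanced_blocks γ (k := q ^ 2) (pow_pos hR.q_pos 2)
  have hqc₁' : 2 ≤ (q : ℝ) * c₁ := by rwa [div_le_iff₀ hc₁] at hqc₁
  have hlo : ∀ i, c₁ * n / (2 * q ^ 2) ≤ (Finset.univ.filter fun j => blk j = i).card := by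
    intro i
    have h1 : ((Fintype.card γ / q ^ 2 : ℕ) : ℝ) ≤
        (Finset.univ.filter fun j => blk j = i).card := by exact_mod_cast (hblk i).1
    have h2 : (Fintype.card γ : ℝ) / q ^ 2 ≤ ((Fintype.card γ / q ^ 2 : ℕ) : ℝ) + 1 := by
      rw [div_le_iff₀ (by positivity)]
      exact_mod_cast (Nat.lt_mul_of_div_lt (Nat.lt_succ_self _) (pow_pos hR.q_pos 2)).le
    have h3 : c₁ * (n / q ^ 2) ≤ (Fintype.card γ : ℝ) / q ^ 2 := by
      rw [← mul_div_assoc]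
      have := hR.aspect
      gcongr
    have h4 : c₁ * n / (2 * (q : ℝ) ^ 2) = c₁ * (n / q ^ 2) / 2 := by field_simp
    have h5 : c₁ * q ≤ c₁ * (n / q ^ 2) := by gcongr
    rw [h4]
    linarith
  have hhi : ∀ i, ((Finset.univ.filter fun j => blk j = i).card : ℝ) ≤ 2 * n / q ^ 2 := by
    intro i
    have h1 : ((Finset.univ.filter fun j => blk j = i).card : ℝ) ≤
        ((Fintype.card γ / q ^ 2 : ℕ) : ℝ) + 1 := by exact_mod_cast (hblk i).2
    have h2 : ((Fintype.card γ / q ^ 2 : ℕ) : ℝ) ≤ (Fintype.card γ : ℝ) / q ^ 2 := by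
      have := Nat.cast_div_le (α := ℝ) (m := Fintype.card γ) (n := q ^ 2)
      exact_mod_cast this
    have h3 : (Fintype.card γ : ℝ) / q ^ 2 ≤ n / q ^ 2 := by gcongr
    rw [mul_div_assoc]
    linarith
  have hμa : IsAntiConcentrated c μ := hanti σ μ hμ
  have h1 := hcomp q n (by exact_mod_cast hqq₂) γ ρ hR μ hμa S hS
  have h2 := hstr q n (by exact_mod_cast hqq₃) γ ρ hR blk hlo hhi σ μ hμ hμa S hS
  have h3 := measure_opNorm_gt_le hσ hμ hR.n_pos hR.p_le hR.N_le
  have h4 : Real.exp (-(c * c₁ / 8) * n) ≤ Real.exp (-q) := by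
    apply Real.exp_le_exp.2
    rw [div_le_iff₀ (by positivity)] at hqc
    have h5 : (q : ℝ) ^ 2 ≤ n := (pow_le_pow_right₀ hq1 (by norm_num)).trans hq18
    have h6 : c * c₁ / 8 * q ^ 2 ≤ c * c₁ / 8 * n := by gcongr
    have h7 := mul_le_mul_of_nonneg_right hqc hq0.le
    linarith [show (q : ℝ) * (c * c₁) * q = 8 * (c * c₁ / 8 * q ^ 2) by ring]
  have h5 : Real.exp (-n) ≤ Real.exp (-q) := by
    apply Real.exp_le_exp.2
    have h5 : (q : ℝ) ≤ n := (le_self_pow₀ hq1 (by norm_num)).trans hq18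
    linarith
  refine (measureReal_mono (s₂ := _ ∪ (_ ∪ _)) ?_ (measure_ne_top _ _)).trans
    ((measureReal_union_le _ _).trans (add_le_add h3 ((measureReal_union_le _ _).trans
      (add_le_add h1 h2))) |>.trans (by linarith))
  rintro X ⟨lam, v, b, hv1, hev, hb⟩
  by_cases hX : opNorm (of X) ≤ K * √n
  · right
    by_cases hv : (1 / (q : ℝ)) ^ 2 < ∑ j ∈ (largeCoords (q / √n) v)ᶜ, v j ^ 2
    · right
      refine ⟨hX, lam, v, hv1, hev, hv, ?_⟩
      by_contra hst
      exact absurd (hatom q n _ _ c₁ (by exact_mod_cast hqq₄) hR σ μ hμ γ blk v hv hst b)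
        (not_le.2 hb)
    · exact Or.inl ⟨hX, lam, v, hv1, hev, not_lt.1 hv⟩
  · exact Or.inl (not_le.1 hX)

/-! ### Removing a row -/

open Matrix in
/-- The matrix `W` has an eigenvalue `lam` such that `g` lies in the range of `W - lam`. For
symmetric `W` the vector `g` is then orthogonal to the whole eigenspace of `lam`, and this is how
`W + σ g gᵀ` can inherit the eigenvalue `lam` from `W`. -/
def IsResonant {γ : Type*} [Fintype γ] (W : Matrix γ γ ℝ) (g : γ → ℝ) : Prop :=
  ∃ (lam : ℝ) (u x : γ → ℝ), euclNorm u = 1 ∧ W *ᵥ u = lam • u ∧ W *ᵥ x - lam • x = g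

section IsResonant

variable {γ : Type*} [Fintype γ]

open Matrix in
lemma dotProduct_mulVec_comm {W : Matrix γ γ ℝ} (hW : Wᵀ = W) (x y : γ → ℝ) :
    x ⬝ᵥ W *ᵥ y = (W *ᵥ x) ⬝ᵥ y := by
  rw [dotProduct_mulVec, ← mulVec_transpose, hW]

open Matrix in
/-- A symmetric matrix has finitely many unit eigenvectors one of which is orthogonal to `g`
whenever `g` is resonant: an orthonormal eigenbasis. -/
lemma exists_eigenvectors_dotProduct_eq_zero [DecidableEq γ] {W : Matrix γ γ ℝ} (hW : Wᵀ = W) :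
    ∃ (lam : γ → ℝ) (v : γ → γ → ℝ), (∀ k, euclNorm (v k) = 1) ∧
      (∀ k, W *ᵥ v k = lam k • v k) ∧ ∀ g, IsResonant W g → ∃ k, g ⬝ᵥ v k = 0 := by
  have hH : W.IsHermitian := by rw [IsHermitian, conjTranspose_eq_transpose_of_trivial, hW]
  have hev : ∀ k, W *ᵥ (hH.eigenvectorBasis k).ofLp =
      hH.eigenvalues k • (hH.eigenvectorBasis k).ofLp := fun k => hH.mulVec_eigenvectorBasis k
  refine ⟨hH.eigenvalues, fun k => (hH.eigenvectorBasis k).ofLp, fun k => ?_, hev, ?_⟩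
  · have h1 := hH.eigenvectorBasis.orthonormal.1 k
    rw [EuclideanSpace.norm_eq] at h1
    have h2 := euclNorm_sq (hH.eigenvectorBasis k).ofLp
    have h3 : √(∑ i, ‖(hH.eigenvectorBasis k).ofLp i‖ ^ 2) ^ 2 = 1 := by rw [h1]; norm_num
    rw [Real.sq_sqrt (by positivity)] at h3
    simp only [Real.norm_eq_abs, sq_abs] at h3
    rw [h3] at h2
    exact (pow_eq_one_iff_of_nonneg (euclNorm_nonneg _) two_ne_zero).1 h2
  · rintro g ⟨lam, u, x, hu, hWu, rfl⟩
    -- A member of the eigenbasis not orthogonal to `u` has the same eigenvalue as `u`.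
    have hk : ∃ k, u ⬝ᵥ (hH.eigenvectorBasis k).ofLp ≠ 0 := by
      by_contra! hcon
      have : WithLp.toLp 2 u = 0 := by
        rw [← hH.eigenvectorBasis.repr.map_eq_zero_iff]
        ext k
        rw [OrthonormalBasis.repr_apply_apply, EuclideanSpace.inner_eq_star_dotProduct]
        simpa using hcon k
      have hu0 : u = 0 := by simpa using this
      rw [hu0] at hu
      have := (euclNorm_eq_zero (x := (0 : γ → ℝ))).2 rfl
      linarith
    obtain ⟨k, hk⟩ := hk
    have h1 : (hH.eigenvalues k - lam) * (u ⬝ᵥ (hH.eigenvectorBasis k).ofLp) = 0 := by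
      have := dotProduct_mulVec_comm hW u (hH.eigenvectorBasis k).ofLp
      rw [hev, hWu, dotProduct_smul, smul_dotProduct, smul_eq_mul, smul_eq_mul] at this
      linarith
    have h2 : hH.eigenvalues k = lam := by
      have := (mul_eq_zero.1 h1).resolve_right hk
      linarith
    refine ⟨k, ?_⟩
    rw [sub_dotProduct, ← dotProduct_mulVec_comm hW, hev, h2, dotProduct_smul, smul_dotProduct,
      sub_self]

open Matrix in
/-- If a rank one perturbation has a multiple eigenvalue and one of its eigenvectors is not
orthogonal to the perturbing vector, then that vector is resonant. -/
lemma isResonant_of_eigenvectors {W : Matrix γ γ ℝ} {g x y : γ → ℝ} {s lam : ℝ} (hs : s ≠ 0)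
    (hxy : x ⬝ᵥ y = 0) (hy : euclNorm y = 1)
    (hWx : W *ᵥ x + (s * (g ⬝ᵥ x)) • g = lam • x) (hWy : W *ᵥ y + (s * (g ⬝ᵥ y)) • g = lam • y)
    (hgx : g ⬝ᵥ x ≠ 0) : IsResonant W g := by
  set u : γ → ℝ := y - ((g ⬝ᵥ y) / (g ⬝ᵥ x)) • x with hu
  have hgu : g ⬝ᵥ u = 0 := by
    rw [hu, dotProduct_sub, dotProduct_smul, smul_eq_mul, div_mul_cancel₀ _ hgx, sub_self]
  have hWu : W *ᵥ u = lam • u := by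
    have h1 : W *ᵥ x = lam • x - (s * (g ⬝ᵥ x)) • g := by rw [← hWx]; abel
    have h2 : W *ᵥ y = lam • y - (s * (g ⬝ᵥ y)) • g := by rw [← hWy]; abel
    rw [hu, mulVec_sub, mulVec_smul, h1, h2]
    ext k
    simp only [Pi.sub_apply, Pi.smul_apply, smul_eq_mul]
    field_simp
    ring
  have hu0 : u ≠ 0 := by
    intro h0
    have h1 : u ⬝ᵥ y = 1 := by
      rw [hu, sub_dotProduct, smul_dotProduct, hxy, dotProduct_self_eq_euclNorm_sq, hy]
      simp
    rw [h0, zero_dotProduct] at h1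
    exact zero_ne_one h1
  have hun : euclNorm u ≠ 0 := fun h => hu0 (euclNorm_eq_zero.1 h)
  refine ⟨lam, (euclNorm u)⁻¹ • u, (-(s * (g ⬝ᵥ x))⁻¹) • x, ?_, ?_, ?_⟩
  · rw [euclNorm_smul, abs_of_nonneg (inv_nonneg.2 (euclNorm_nonneg _)), inv_mul_cancel₀ hun]
  · rw [mulVec_smul, hWu, smul_comm]
  · have h1 : W *ᵥ x = lam • x - (s * (g ⬝ᵥ x)) • g := by rw [← hWx]; abel
    rw [mulVec_smul, h1]
    ext k
    simp only [Pi.sub_apply, Pi.smul_apply, smul_eq_mul]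
    field_simp
    ring

open Matrix in
/-- The range of a symmetric matrix contains the vectors orthogonal to its kernel. -/
lemma exists_mulVec_eq_of_orthogonal_ker [DecidableEq γ] {W : Matrix γ γ ℝ} (hW : Wᵀ = W)
    {g : γ → ℝ} (hg : ∀ z, W *ᵥ z = 0 → g ⬝ᵥ z = 0) : ∃ x, W *ᵥ x = g := by
  have hH : W.IsHermitian := by rw [IsHermitian, conjTranspose_eq_transpose_of_trivial, hW]
  have hsym := isSymmetric_toEuclideanLin_iff.2 hH
  have hmem : WithLp.toLp 2 g ∈ (LinearMap.ker (toEuclideanLin W))ᗮ := by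
    rw [Submodule.mem_orthogonal]
    intro z hz
    rw [LinearMap.mem_ker, toLpLin_apply] at hz
    rw [EuclideanSpace.inner_eq_star_dotProduct]
    have := hg z.ofLp (by simpa using hz)
    simpa using this
  rw [← hsym.orthogonal_range, Submodule.orthogonal_orthogonal] at hmem
  obtain ⟨x, hx⟩ := hmem
  refine ⟨x.ofLp, ?_⟩
  rw [toLpLin_apply] at hx
  simpa using hx

open Matrix in
/-- Being resonant is a countable union of closed conditions, since the unknowns can be confined to
balls. -/
lemma measurableSet_isResonant {T : Type*} [TopologicalSpace T] [MeasurableSpace T]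
    [OpensMeasurableSpace T] {W : T → Matrix γ γ ℝ} {g : T → γ → ℝ} (hW : Continuous W)
    (hg : Continuous g) : MeasurableSet {t | IsResonant (W t) (g t)} := by
  have hset : {t | IsResonant (W t) (g t)} = ⋃ R : ℕ, Prod.fst ''
      {z : T × Metric.closedBall (0 : ℝ × (γ → ℝ) × (γ → ℝ)) R |
        euclNorm z.2.1.2.1 = 1 ∧ W z.1 *ᵥ z.2.1.2.1 = z.2.1.1 • z.2.1.2.1 ∧
          W z.1 *ᵥ z.2.1.2.2 - z.2.1.1 • z.2.1.2.2 = g z.1} := by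
    ext t
    simp only [Set.mem_ofPred_eq, Set.mem_iUnion, Set.mem_image]
    constructor
    · rintro ⟨lam, u, x, h⟩
      obtain ⟨R, hR⟩ := exists_nat_ge ‖(lam, u, x)‖
      exact ⟨R, ⟨t, ⟨(lam, u, x), by simpa using hR⟩⟩, h, rfl⟩
    · rintro ⟨R, ⟨t', ⟨⟨lam, u, x⟩, hR⟩⟩, h, rfl⟩
      exact ⟨lam, u, x, h⟩
  rw [hset]
  refine MeasurableSet.iUnion fun R => IsClosed.measurableSet ?_
  have : CompactSpace (Metric.closedBall (0 : ℝ × (γ → ℝ) × (γ → ℝ)) R) :=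
    isCompact_iff_compactSpace.1 (isCompact_closedBall _ _)
  refine isClosedMap_fst_of_compactSpace _ ?_
  have hne := continuous_euclNorm (ι := γ)
  refine IsClosed.and ?_ (IsClosed.and ?_ ?_)
  · exact isClosed_eq (hne.comp (by fun_prop)) continuous_const
  · exact isClosed_eq ((hW.comp continuous_fst).matrix_mulVec (by fun_prop)) (by fun_prop)
  · exact isClosed_eq (((hW.comp continuous_fst).matrix_mulVec (by fun_prop)).sub (by fun_prop))
      (hg.comp continuous_fst)

end IsResonant

/-- The Schur complement of the diagonal entry `i` in `S`. -/
noncomputable def schurCompl {ρ : Type*} (S : Matrix ρ ρ ℝ) (i : ρ) :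
    Matrix {j // j ≠ i} {j // j ≠ i} ℝ :=
  Matrix.of fun a b => S a b - S a i * S i b / S i i

section schurCompl

variable {ρ : Type*} [Fintype ρ] [DecidableEq ρ] {S : Matrix ρ ρ ℝ} {ℓ : ℝ}

lemma SpectralBounds.apply_self_pos (hS : SpectralBounds ℓ S) (i : ρ) : 0 < ℓ * S i i := by
  have h := hS.le_form (Pi.single i 1)
  have h1 : euclNorm (Pi.single i (1 : ℝ)) ^ 2 = 1 := by
    rw [euclNorm_sq, Finset.sum_eq_single i]
    · simp
    · intro j _ hj; simp [hj]
    · simp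
  rw [h1] at h
  simp at h
  linarith

open Matrix in
/-- The quadratic form of the Schur complement is the minimum of that of `S` over the removed
variable, here evaluated at the minimizer. -/
lemma dotProduct_schurCompl_mulVec (hS : Sᵀ = S) (i : ρ) (hi : S i i ≠ 0) (x : {j // j ≠ i} → ℝ)
    (y : ρ → ℝ) (hyi : y i = -(∑ a : {j // j ≠ i}, S i a * x a) / S i i)
        (hy : ∀ a : {j // j ≠ i}, y a = x a) :
    y ⬝ᵥ S *ᵥ y = x ⬝ᵥ schurCompl S i *ᵥ x := by
  have hsum : ∀ f : ρ → ℝ, ∑ j, f j = f i + ∑ a : {j // j ≠ i}, f a := fun f =>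
    Fintype.sum_eq_add_sum_subtype_ne f i
  have hsym : ∀ a b, S a b = S b a := fun a b => by conv_lhs => rw [← hS, transpose_apply]
  have h0 : (S *ᵥ y) i = 0 := by
    rw [mulVec, dotProduct, hsum]
    simp only [hy]
    rw [hyi]; field_simp; ring
  have h1 : ∀ a : {j // j ≠ i}, (S *ᵥ y) a = (schurCompl S i *ᵥ x) a := by
    intro a
    simp only [mulVec, dotProduct, schurCompl, of_apply]
    rw [hsum]
    simp only [hy, hyi, sub_mul, Finset.sum_sub_distrib]
    have : ∑ b : {j // j ≠ i}, S a i * S i b / S i i * x b =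
        S a i / S i i * ∑ b : {j // j ≠ i}, S i b * x b := by
      rw [Finset.mul_sum]; exact Finset.sum_congr rfl fun b _ => by ring
    rw [this]; ring
  rw [dotProduct, hsum, h0, mul_zero, zero_add, dotProduct]
  exact Finset.sum_congr rfl fun a _ => by rw [h1, hy]

lemma euclNorm_sq_eq_add (i : ρ) (y : ρ → ℝ) :
    euclNorm y ^ 2 = y i ^ 2 + euclNorm (fun a : {j // j ≠ i} => y a) ^ 2 := by
  rw [euclNorm_sq, euclNorm_sq, Fintype.sum_eq_add_sum_subtype_ne _ i]

open Matrix in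
lemma SpectralBounds.schurCompl (hℓ : 0 < ℓ) (hS : SpectralBounds ℓ S) (i : ρ) :
    SpectralBounds ℓ (schurCompl S i) := by
  have hi : 0 < S i i := pos_of_mul_pos_right (hS.apply_self_pos i) hℓ.le
  have hsym : ∀ a b, S a b = S b a := fun a b => by conv_lhs => rw [← hS.symm, transpose_apply]
  refine ⟨?_, fun x => ?_, fun x => ?_⟩
  · ext a b
    simp only [transpose_apply, _root_.schurCompl, of_apply]
    rw [hsym b a, hsym b i, hsym i a]; ring
  · set y : ρ → ℝ := fun j => if h : j = i then -(∑ a : {j // j ≠ i}, S i a * x a) / S i i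
      else x ⟨j, h⟩ with hy
    have hyi : y i = -(∑ a : {j // j ≠ i}, S i a * x a) / S i i := by simp [hy]
    have hya : ∀ a : {j // j ≠ i}, y a = x a := fun a => by simp [hy, a.2]
    rw [← dotProduct_schurCompl_mulVec hS.symm i hi.ne' x y hyi hya]
    refine le_trans ?_ (hS.le_form y)
    rw [euclNorm_sq_eq_add i y]
    simp only [hya]
    linarith [sq_nonneg (y i)]
  · set y : ρ → ℝ := fun j => if h : j = i then 0 else x ⟨j, h⟩ with hy
    have hyi : y i = 0 := by simp [hy]
    have hya : ∀ a : {j // j ≠ i}, y a = x a := fun a => by simp [hy, a.2]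
    have h1 := hS.form_le y
    rw [euclNorm_sq_eq_add i y, hyi] at h1
    simp only [hya] at h1
    have hsum : ∀ f : ρ → ℝ, ∑ j, f j = f i + ∑ a : {j // j ≠ i}, f a := fun f =>
      Fintype.sum_eq_add_sum_subtype_ne f i
    have h2 : y ⬝ᵥ S *ᵥ y = x ⬝ᵥ _root_.schurCompl S i *ᵥ x +
        (∑ a : {j // j ≠ i}, S i a * x a) ^ 2 / S i i := by
      rw [dotProduct, hsum, hyi, zero_mul, zero_add]
      have h3 : ∀ a : {j // j ≠ i}, y a * (S *ᵥ y) a = x a * (_root_.schurCompl S i *ᵥ x) a +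
          S i a * x a * ((∑ a : {j // j ≠ i}, S i a * x a) / S i i) := by
        intro a
        simp only [mulVec, dotProduct, _root_.schurCompl, of_apply]
        rw [hsum]
        simp only [hya, hyi, sub_mul, Finset.sum_sub_distrib]
        have : ∑ b : {j // j ≠ i}, S a i * S i b / S i i * x b =
            S a i / S i i * ∑ b : {j // j ≠ i}, S i b * x b := by
          rw [Finset.mul_sum]; exact Finset.sum_congr rfl fun b _ => by ring
        rw [this, hsym a i]; ring
      rw [Finset.sum_congr rfl fun a _ => h3 a, Finset.sum_add_distrib, ← Finset.sum_mul,
        dotProduct]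
      ring
    have h4 : 0 ≤ (∑ a : {j // j ≠ i}, S i a * x a) ^ 2 / S i i := by positivity
    linarith

end schurCompl

open Matrix in
/-- If there are at least as many rows as columns, dependent columns entail dependent rows. -/
lemma exists_vecMul_eq_zero_of_mulVec_eq_zero {γ ρ : Type*} [Fintype γ] [Fintype ρ]
    (A : ρ → γ → ℝ)
    (hcard : Fintype.card γ ≤ Fintype.card ρ) {x : γ → ℝ} (hx : x ≠ 0) (hAx : of A *ᵥ x = 0) :
    ∃ c : ρ → ℝ, c ≠ 0 ∧ c ᵥ* of A = 0 := by
  classical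
  by_contra! hcon
  have hinj : Function.Injective (of A)ᵀ.mulVecLin := by
    rw [← LinearMap.ker_eq_bot, LinearMap.ker_eq_bot']
    intro c hc
    by_contra hc0
    exact hcon c hc0 (by rw [← mulVec_transpose]; exact hc)
  have h1 := LinearMap.finrank_range_of_inj hinj
  have h2 : (of A).rank = Fintype.card ρ := by
    rw [← rank_transpose, rank, h1, Module.finrank_fintype_fun_eq_card]
  have h3 := (of A).mulVecLin.finrank_range_add_finrank_ker
  rw [Module.finrank_fintype_fun_eq_card] at h3
  have h4 : 0 < Module.finrank ℝ (LinearMap.ker (of A).mulVecLin) := by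
    rw [Module.finrank_pos_iff_exists_ne_zero]
    exact ⟨⟨x, hAx⟩, fun h => hx (congrArg Subtype.val h)⟩
  rw [rank] at h2
  omega

section RowRemoval

variable {γ ρ : Type*} [Fintype γ] [Fintype ρ] [DecidableEq ρ]

/-- The combination of the rows `B` that enters, together with row `i`, the rank one difference
between `Aᵀ S A` and its analogue with row `i` removed. -/
noncomputable def rowShift (S : Matrix ρ ρ ℝ) (i : ρ) (B : {j // j ≠ i} → γ → ℝ) (k : γ) : ℝ :=
  ∑ a, B a k * (S a i / S i i)

open Matrix in
/-- The entry of `S A x` at `i` is a multiple of the product of `x` with row `i` of `A` shifted by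
the other rows. -/
lemma mulVec_apply_eq_mul_dotProduct {S : Matrix ρ ρ ℝ} (hS : Sᵀ = S) {i : ρ} (hi : S i i ≠ 0)
    (A : ρ → γ → ℝ) (x : γ → ℝ) :
    (S *ᵥ (of A *ᵥ x)) i = S i i * ((A i + rowShift S i fun a => A a) ⬝ᵥ x) := by
  have hsym : ∀ a b, S a b = S b a := fun a b => by conv_lhs => rw [← hS, transpose_apply]
  have h1 : rowShift S i (fun a => A a) ⬝ᵥ x =
      ∑ a : {j // j ≠ i}, S a i / S i i * (of A *ᵥ x) a := by
    simp only [rowShift, dotProduct, mulVec, of_apply, Finset.sum_mul, Finset.mul_sum]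
    rw [Finset.sum_comm]
    exact Finset.sum_congr rfl fun a _ => Finset.sum_congr rfl fun k _ => by ring
  rw [add_dotProduct, h1]
  conv_lhs => rw [mulVec, dotProduct, Fintype.sum_eq_add_sum_subtype_ne _ i]
  rw [mul_add, Finset.mul_sum]
  congr 1
  exact Finset.sum_congr rfl fun a _ => by rw [hsym i a]; field_simp

open Matrix in
/-- Removing row `i` of `A` changes `Aᵀ S A` by a matrix of rank one. -/
lemma rowGram_mulVec_eq_add {S : Matrix ρ ρ ℝ} (hS : Sᵀ = S) {i : ρ} (hi : S i i ≠ 0)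
    (A : ρ → γ → ℝ) (x : γ → ℝ) :
    rowGram S (fun k j => A j k) *ᵥ x =
      rowGram (schurCompl S i) (fun k (a : {j // j ≠ i}) => A a k) *ᵥ x +
        (S i i * ((A i + rowShift S i fun a => A a) ⬝ᵥ x)) • (A i + rowShift S i fun a => A a) := by
  rw [← mulVec_apply_eq_mul_dotProduct hS hi, rowGram_mulVec, rowGram_mulVec]
  have e1 : x ᵥ* of (fun k j => A j k) = of A *ᵥ x := by
    ext j; simp [vecMul, mulVec, dotProduct, mul_comm]
  have e2 : x ᵥ* of (fun k (a : {j // j ≠ i}) => A a k) =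
      fun a : {j // j ≠ i} => (of A *ᵥ x) a := by
    ext j; simp [vecMul, mulVec, dotProduct, mul_comm]
  rw [e1, e2]
  set y := of A *ᵥ x with hy
  have h1 : ∀ a : {j // j ≠ i}, (S *ᵥ y) a =
      (schurCompl S i *ᵥ fun a : {j // j ≠ i} => y a) a + S a i / S i i * (S *ᵥ y) i := by
    intro a
    simp only [mulVec, dotProduct, schurCompl, of_apply]
    rw [Fintype.sum_eq_add_sum_subtype_ne _ i,
      Fintype.sum_eq_add_sum_subtype_ne (fun j => S i j * y j) i]
    simp only [sub_mul, Finset.sum_sub_distrib]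
    have : ∑ b : {j // j ≠ i}, S a i * S i b / S i i * y b =
        S a i / S i i * ∑ b : {j // j ≠ i}, S i b * y b := by
      rw [Finset.mul_sum]; exact Finset.sum_congr rfl fun b _ => by ring
    rw [this]; field_simp; ring
  ext k
  rw [mulVec, dotProduct, Fintype.sum_eq_add_sum_subtype_ne _ i]
  simp only [Pi.add_apply, Pi.smul_apply, smul_eq_mul, of_apply, h1, mul_add,
    Finset.sum_add_distrib]
  have h2 : (of (fun k (a : {j // j ≠ i}) => A a k) *ᵥ
      (schurCompl S i *ᵥ fun a : {j // j ≠ i} => y a)) k =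
      ∑ a : {j // j ≠ i}, A a k * (schurCompl S i *ᵥ fun a : {j // j ≠ i} => y a) a := rfl
  have h3 : ∑ a : {j // j ≠ i}, A a k * (S a i / S i i * (S *ᵥ y) i) =
      (S *ᵥ y) i * rowShift S i (fun a => A a) k := by
    rw [rowShift, Finset.mul_sum]
    exact Finset.sum_congr rfl fun a _ => by ring
  rw [h2, h3]; ring

open Matrix in
/-- A multiple eigenvalue of `Aᵀ S A` makes some row of `A` resonant for the matrix obtained by
removing this row. For a nonzero eigenvalue a row seen by an eigenvector is chosen, and for the
eigenvalue zero a row depending linearly on the other ones. -/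
theorem exists_isResonant [DecidableEq γ] {ℓ : ℝ} (hℓ : 0 < ℓ) {S : Matrix ρ ρ ℝ}
    (hS : SpectralBounds ℓ S) (A : ρ → γ → ℝ) (hcard : Fintype.card γ ≤ Fintype.card ρ)
    {lam : ℝ} {x y : γ → ℝ} (hx : euclNorm x = 1) (hy : euclNorm y = 1) (hxy : x ⬝ᵥ y = 0)
    (hWx : rowGram S (fun k j => A j k) *ᵥ x = lam • x)
    (hWy : rowGram S (fun k j => A j k) *ᵥ y = lam • y) :
    ∃ i, IsResonant (rowGram (schurCompl S i) fun k (a : {j // j ≠ i}) => A a k)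
      (A i + rowShift S i fun a => A a) := by
  have hii : ∀ i, 0 < S i i := fun i => pos_of_mul_pos_right (hS.apply_self_pos i) hℓ.le
  have hx0 : x ≠ 0 := fun h => by
    rw [euclNorm_eq_zero.2 h] at hx; exact zero_ne_one hx
  have hAt : ∀ z, rowGram S (fun k j => A j k) *ᵥ z = (of A)ᵀ *ᵥ (S *ᵥ (of A *ᵥ z)) := by
    intro z
    rw [rowGram, ← mulVec_mulVec, ← mulVec_mulVec]
    rfl
  -- In the first case `A x = 0`, and the removed row is one that depends on the other rows.
  by_cases hSA : S *ᵥ (of A *ᵥ x) = 0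
  · have hA0 : of A *ᵥ x = 0 := by
      have h1 := hS.le_form (of A *ᵥ x)
      rw [hSA, dotProduct_zero, mul_zero] at h1
      exact euclNorm_eq_zero.1 (pow_eq_zero_iff two_ne_zero |>.1 (le_antisymm h1 (sq_nonneg _)))
    obtain ⟨c, hc0, hc⟩ := exists_vecMul_eq_zero_of_mulVec_eq_zero A hcard hx0 hA0
    obtain ⟨i, hci⟩ := Function.ne_iff.1 hc0
    refine ⟨i, 0, x, ?_⟩
    set S' := schurCompl S i with hS'
    have hSB : SpectralBounds ℓ S' := hS.schurCompl hℓ i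
    set X : γ → {j // j ≠ i} → ℝ := fun k a => A a k with hX
    have hvm : ∀ z, z ᵥ* of X = fun a : {j // j ≠ i} => (of A *ᵥ z) a := by
      intro z
      ext a; simp [hX, vecMul, mulVec, dotProduct, mul_comm]
    have hWx0 : rowGram S' X *ᵥ x = 0 := by
      rw [rowGram_mulVec, hvm, hA0]
      have : (fun a : {j // j ≠ i} => (0 : ρ → ℝ) a) = 0 := rfl
      rw [this, mulVec_zero, mulVec_zero]
    have hsymW : (rowGram S' X)ᵀ = rowGram S' X := by
      rw [rowGram, transpose_mul, transpose_mul, transpose_transpose, hSB.symm, Matrix.mul_assoc]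
    obtain ⟨x', hx'⟩ := exists_mulVec_eq_of_orthogonal_ker hsymW
      (g := A i + rowShift S i fun a => A a) (by
        intro z hz
        have h1 : z ᵥ* of X = 0 := by
          have h2 := hSB.le_form (z ᵥ* of X)
          have h3 : (z ᵥ* of X) ⬝ᵥ S' *ᵥ (z ᵥ* of X) = z ⬝ᵥ rowGram S' X *ᵥ z := by
            rw [rowGram_mulVec, dotProduct_mulVec z]
          rw [h3, hz, dotProduct_zero, mul_zero] at h2
          exact euclNorm_eq_zero.1
            (pow_eq_zero_iff two_ne_zero |>.1 (le_antisymm h2 (sq_nonneg _)))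
        have h4 : ∀ a : {j // j ≠ i}, (of A *ᵥ z) a = 0 := fun a => by
          have := congrFun h1 a
          rwa [hvm] at this
        have h5 : (of A *ᵥ z) i = 0 := by
          have h6 : c ⬝ᵥ (of A *ᵥ z) = 0 := by rw [dotProduct_mulVec, hc, zero_dotProduct]
          rw [dotProduct, Fintype.sum_eq_add_sum_subtype_ne _ i] at h6
          simp only [h4, mul_zero, Finset.sum_const_zero, add_zero] at h6
          exact (mul_eq_zero.1 h6).resolve_left hci
        have h7 : of A *ᵥ z = 0 := by
          ext j
          by_cases hj : j = i
          · rw [hj]; exact h5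
          · exact h4 ⟨j, hj⟩
        have h8 := mulVec_apply_eq_mul_dotProduct hS.symm (hii i).ne' A z
        rw [h7, mulVec_zero] at h8
        exact (mul_eq_zero.1 h8.symm).resolve_left (hii i).ne')
    exact ⟨x', hx, by rw [hWx0, zero_smul], by rw [hx', zero_smul, sub_zero]⟩
  · obtain ⟨i, hi⟩ := Function.ne_iff.1 hSA
    rw [mulVec_apply_eq_mul_dotProduct hS.symm (hii i).ne' A x] at hi
    refine ⟨i, isResonant_of_eigenvectors (lam := lam) (hii i).ne' hxy hy ?_ ?_ (right_ne_zero_of_mul hi)⟩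
    · rw [← rowGram_mulVec_eq_add hS.symm (hii i).ne', hWx]
    · rw [← rowGram_mulVec_eq_add hS.symm (hii i).ne', hWy]

end RowRemoval

/-! ### Simplicity of the spectrum -/

/-- An event of a product space is unlikely if most of its sections are. -/
lemma measureReal_prod_le_add {α β : Type*} [MeasurableSpace α] [MeasurableSpace β]
    (μ : Measure α) (ν : Measure β) [IsProbabilityMeasure μ] [IsProbabilityMeasure ν]
    {Z : Set (α × β)} (hZ : MeasurableSet Z) (bad : Set β) {ε : ℝ} (hε : 0 ≤ ε)
    (h : ∀ y ∉ bad, μ.real {x | (x, y) ∈ Z} ≤ ε) : (μ.prod ν).real Z ≤ ν.real bad + ε := by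
  have h1 : (μ.prod ν) Z ≤ ν bad + ENNReal.ofReal ε := by
    rw [Measure.prod_apply_symm hZ, ← measure_toMeasurable bad]
    calc ∫⁻ y, μ ((fun x => (x, y)) ⁻¹' Z) ∂ν
        ≤ ∫⁻ y, ((toMeasurable ν bad).indicator 1 y + ENNReal.ofReal ε) ∂ν := by
          refine lintegral_mono fun y => ?_
          by_cases hy : y ∈ toMeasurable ν bad
          · rw [Set.indicator_of_mem hy, Pi.one_apply]
            exact prob_le_one.trans le_self_add
          · have hy' : y ∉ bad := fun h' => hy (subset_toMeasurable _ _ h')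
            refine le_trans ?_ le_add_self
            rw [ENNReal.le_ofReal_iff_toReal_le (measure_ne_top _ _) hε]
            exact h y hy'
      _ = ν (toMeasurable ν bad) + ENNReal.ofReal ε := by
          rw [lintegral_add_right _ measurable_const,
            lintegral_indicator_one (measurableSet_toMeasurable _ _), lintegral_const, measure_univ,
            mul_one]
  have h2 := ENNReal.toReal_mono (by finiteness) h1
  rwa [ENNReal.toReal_add (measure_ne_top _ _) ENNReal.ofReal_ne_top,
    ENNReal.toReal_ofReal hε] at h2

/-- Row `i` of a random matrix is independent of the other rows. -/
lemma measurePreserving_row_and_rest {ρ E : Type*} [Fintype ρ] [DecidableEq ρ] [MeasurableSpace E]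
    (m : Measure E) [SigmaFinite m] (i : ρ) :
    MeasurePreserving (fun A : ρ → E => (A i, fun a : {j // j ≠ i} => A a))
      (Measure.pi fun _ => m) (m.prod (Measure.pi fun _ => m)) := by
  have h1 := measurePreserving_split m (Equiv.sumCompl fun j : ρ => j = i)
  have h2 := (measurePreserving_funUnique m {j // j = i}).prod
    (MeasurePreserving.id (Measure.pi fun _ : {j // ¬ j = i} => m))
  exact h2.comp h1

open Matrix in
/-- If eigenvectors of the reduced matrix only give linear forms with small atoms, then the removed
row is unlikely to be resonant: it would have to be orthogonal, up to the shift by an independent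
vector, to one of finitely many such eigenvectors. -/
lemma measure_isResonant_le {γ ρ : Type*} [Fintype γ] [Fintype ρ] [DecidableEq γ] [DecidableEq ρ]
    (μ : Measure ℝ) [IsProbabilityMeasure μ] (S : Matrix ρ ρ ℝ) (i : ρ)
    (hS : (schurCompl S i)ᵀ = schurCompl S i) {ε : ℝ} (hε : 0 ≤ ε) :
    (iidLaw ρ γ μ).real {A | IsResonant
        (rowGram (schurCompl S i) fun k (a : {j // j ≠ i}) => A a k)
        (A i + rowShift S i fun a => A a)} ≤
      (iidLaw γ {j // j ≠ i} μ).real {X | ∃ (lam : ℝ) (v : γ → ℝ) (b : ℝ),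
        euclNorm v = 1 ∧ rowGram (schurCompl S i) X *ᵥ v = lam • v ∧
        ε < (Measure.pi fun _ : γ => μ).real {x | ∑ j, x j * v j = b}} +
      Fintype.card γ * ε := by
  set bad : Set (γ → {j // j ≠ i} → ℝ) := {X | ∃ (lam : ℝ) (v : γ → ℝ) (b : ℝ),
        euclNorm v = 1 ∧ rowGram (schurCompl S i) X *ᵥ v = lam • v ∧
        ε < (Measure.pi fun _ : γ => μ).real {x | ∑ j, x j * v j = b}} with hbad
  set Z : Set ((γ → ℝ) × ({j // j ≠ i} → γ → ℝ)) := {z | IsResonant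
    (rowGram (schurCompl S i) fun k a => z.2 a k) (z.1 + rowShift S i z.2)} with hZdef
  have hZ : MeasurableSet Z := by
    refine measurableSet_isResonant ?_ ?_
    · exact (continuous_rowGram (schurCompl S i)).comp (by fun_prop)
    · refine continuous_fst.add (continuous_pi fun k => ?_)
      unfold rowShift
      fun_prop
  have hmp := measurePreserving_row_and_rest (Measure.pi fun _ : γ => μ) i
  have h1 : (iidLaw ρ γ μ).real {A | IsResonant
        (rowGram (schurCompl S i) fun k (a : {j // j ≠ i}) => A a k)
        (A i + rowShift S i fun a => A a)} =
      ((Measure.pi fun _ : γ => μ).prod (iidLaw {j // j ≠ i} γ μ)).real Z := by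
    rw [measureReal_def, measureReal_def, ← hmp.measure_preimage hZ.nullMeasurableSet]
    rfl
  rw [h1]
  have h2 := measureReal_prod_le_add (Measure.pi fun _ : γ => μ) (iidLaw {j // j ≠ i} γ μ) hZ
    ((fun (B : {j // j ≠ i} → γ → ℝ) k a => B a k) ⁻¹' bad) (ε := Fintype.card γ * ε)
    (by positivity) ?_
  · refine h2.trans (add_le_add_left ?_ _)
    have hsw := measurePreserving_swap_iidLaw {j // j ≠ i} γ μ
    rw [measureReal_def, measureReal_def]
    refine ENNReal.toReal_mono (measure_ne_top _ _) ?_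
    conv_rhs => rw [← hsw.map_eq]
    exact Measure.le_map_apply hsw.measurable.aemeasurable _
  · intro B hB
    set W := rowGram (schurCompl S i) fun k (a : {j // j ≠ i}) => B a k with hW
    have hsymW : Wᵀ = W := by
      rw [hW, rowGram, transpose_mul, transpose_mul, transpose_transpose, hS, Matrix.mul_assoc]
    obtain ⟨lam, v, hv1, hev, hv⟩ := exists_eigenvectors_dotProduct_eq_zero hsymW
    calc (Measure.pi fun _ : γ => μ).real {x | (x, B) ∈ Z}
        ≤ (Measure.pi fun _ : γ => μ).real
          (⋃ k ∈ Finset.univ, {x | ∑ j, x j * v k j = -(rowShift S i B ⬝ᵥ v k)}) := by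
          refine measureReal_mono ?_ (measure_ne_top _ _)
          intro x hx
          obtain ⟨k, hk⟩ := hv _ hx
          refine Set.mem_biUnion (Finset.mem_coe.2 (Finset.mem_univ k)) ?_
          rw [add_dotProduct] at hk
          exact eq_neg_of_add_eq_zero_left hk
      _ ≤ ∑ k, (Measure.pi fun _ : γ => μ).real
          {x | ∑ j, x j * v k j = -(rowShift S i B ⬝ᵥ v k)} := measureReal_biUnion_finset_le _ _
      _ ≤ ∑ _k : γ, ε := by
          refine Finset.sum_le_sum fun k _ => ?_
          by_contra! hcon
          exact hB ⟨lam k, v k, _, hv1 k, hev k, hcon⟩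
      _ = _ := by rw [Finset.sum_const, Finset.card_univ, nsmul_eq_mul]

open Matrix in
/-- With overwhelming probability `Aᵀ S A` has no multiple eigenvalue. -/
theorem exists_measure_multiple_eigenvalue_le {σ q₀ K₀ c₁ ℓ : ℝ} (hσ : 0 < σ) (hq₀ : 0 < q₀)
    (hK₀ : 1 ≤ K₀) (hc₁ : 0 < c₁) (hℓ : 0 < ℓ) :
    ∃ q₁ : ℕ, ∀ q n : ℕ, q₁ ≤ q → q ^ 18 ≤ n → n ≤ (2 * q) ^ 18 →
      ∀ (γ ρ : Type) [Fintype γ] [Fintype ρ] [DecidableEq γ] [DecidableEq ρ],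
      Fintype.card ρ = n → c₁ * n ≤ Fintype.card γ → Fintype.card γ ≤ n →
      ∀ (μ : Measure ℝ) [IsProbabilityMeasure μ], SpreadLaw σ q₀ K₀ μ →
      ∀ S : Matrix ρ ρ ℝ, SpectralBounds ℓ S →
      (iidLaw ρ γ μ).real {A | ∃ (lam : ℝ) (x y : γ → ℝ), euclNorm x = 1 ∧ euclNorm y = 1 ∧
        x ⬝ᵥ y = 0 ∧ rowGram S (fun k j => A j k) *ᵥ x = lam • x ∧
        rowGram S (fun k j => A j k) *ᵥ y = lam • y} ≤ n * ((n + 3) * Real.exp (-q)) := by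
  obtain ⟨q₁, hmain⟩ := exists_measure_eigenvector_atom_le hσ hq₀ hK₀ hc₁ hℓ
  refine ⟨q₁ + 1, ?_⟩
  intro q n hq hqn hnq γ ρ _ _ _ _ hρ hasp hle μ _ hμ S hS
  have hone : ∀ i : ρ, (iidLaw ρ γ μ).real {A | IsResonant
        (rowGram (schurCompl S i) fun k (a : {j // j ≠ i}) => A a k)
        (A i + rowShift S i fun a => A a)} ≤ (n + 3) * Real.exp (-q) := by
    intro i
    have hSi := hS.schurCompl hℓ i
    have hcard : Fintype.card {j // j ≠ i} = n - 1 := by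
      rw [Fintype.card_subtype_compl, hρ, Fintype.card_subtype_eq]
    have hR : Regime c₁ q n (Fintype.card γ) (Fintype.card {j // j ≠ i}) :=
      ⟨by omega, hqn, hnq, hasp, hle, by omega, by omega⟩
    have h1 := measure_isResonant_le (γ := γ) μ S i hSi.symm (Real.exp_pos (-q : ℝ)).le
    have h2 := hmain q n (by omega) γ {j // j ≠ i} hR μ hμ _ hSi
    have h3 : (Fintype.card γ : ℝ) * Real.exp (-q) ≤ n * Real.exp (-q) := by
      gcongr
    linarith
  calc _ ≤ (iidLaw ρ γ μ).real (⋃ i ∈ (Finset.univ : Finset ρ), {A | IsResonant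
        (rowGram (schurCompl S i) fun k (a : {j // j ≠ i}) => A a k)
        (A i + rowShift S i fun a => A a)}) := by
        refine measureReal_mono ?_ (measure_ne_top _ _)
        rintro A ⟨lam, x, y, hx, hy, hxy, hWx, hWy⟩
        obtain ⟨i, hi⟩ := exists_isResonant hℓ hS A (hρ ▸ hle) hx hy hxy hWx hWy
        exact Set.mem_biUnion (Finset.mem_coe.2 (Finset.mem_univ i)) hi
    _ ≤ _ := measureReal_biUnion_finset_le _ _
    _ ≤ _ := Finset.sum_le_sum fun i _ => hone i
    _ = _ := by rw [Finset.sum_const, Finset.card_univ, hρ, nsmul_eq_mul]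

open Matrix in
/-- Coinciding singular values give a multiple eigenvalue of `Aᵀ A`. -/
lemma exists_eigenvectors_of_not_injective_singVal {n p : ℕ} (A : Matrix (Fin n) (Fin p) ℝ)
    (h : ¬ Function.Injective (singVal A)) :
    ∃ (lam : ℝ) (x y : Fin p → ℝ), euclNorm x = 1 ∧ euclNorm y = 1 ∧ x ⬝ᵥ y = 0 ∧
      (Aᵀ * A) *ᵥ x = lam • x ∧ (Aᵀ * A) *ᵥ y = lam • y := by
  unfold Function.Injective at h
  push Not at h
  obtain ⟨i, j, hij, hne⟩ := h
  set T := Matrix.toEuclideanLin A with hT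
  have hfr : Module.finrank ℝ (EuclideanSpace ℝ (Fin p)) = p := finrank_euclideanSpace_fin
  set f := T.isSymmetric_adjoint_comp_self with hf
  have hlam : f.eigenvalues hfr i = f.eigenvalues hfr j := by
    rw [← T.sq_singularValues_fin hfr i, ← T.sq_singularValues_fin hfr j]
    unfold singVal at hij
    rw [hij]
  set b := f.eigenvectorBasis hfr with hb
  have hnorm : ∀ k, euclNorm (b k).ofLp = 1 := by
    intro k
    have h1 := b.orthonormal.1 k
    have h2 := EuclideanSpace.real_norm_sq_eq (b k)
    rw [h1, one_pow, ← euclNorm_sq] at h2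
    exact (pow_eq_one_iff_of_nonneg (euclNorm_nonneg _) two_ne_zero).1 h2.symm
  have hev : ∀ k, (Aᵀ * A) *ᵥ (b k).ofLp = f.eigenvalues hfr k • (b k).ofLp := by
    intro k
    have e : Matrix.toEuclideanLin Aᵀ = LinearMap.adjoint T := by
      rw [hT, ← Matrix.toEuclideanLin_conjTranspose_eq_adjoint,
        conjTranspose_eq_transpose_of_trivial]
    have h1 : Matrix.toEuclideanLin Aᵀ (T (b k)) = f.eigenvalues hfr k • b k := by
      rw [e]; exact f.apply_eigenvectorBasis hfr k
    have h2 := congrArg WithLp.ofLp h1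
    rw [← mulVec_mulVec]
    exact h2
  refine ⟨f.eigenvalues hfr i, (b i).ofLp, (b j).ofLp, hnorm i, hnorm j, ?_, hev i, ?_⟩
  · have : inner ℝ (b j) (b i) = 0 := b.orthonormal.2 hne.symm
    rw [EuclideanSpace.inner_eq_star_dotProduct] at this
    simpa using this
  · rw [hlam]; exact hev j

lemma euclNorm_mulVec_le_specNorm_mul {n : ℕ} (S : Matrix (Fin n) (Fin n) ℝ) (x : Fin n → ℝ) :
    euclNorm (S.mulVec x) ≤ specNorm S * euclNorm x := by
  have h1 := (Matrix.toEuclideanCLM (n := Fin n) (𝕜 := ℝ) S).le_opNorm (WithLp.toLp 2 x)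
  have h2 : ∀ y : Fin n → ℝ, ‖WithLp.toLp 2 y‖ = euclNorm y := by
    intro y
    have h3 := EuclideanSpace.real_norm_sq_eq (WithLp.toLp 2 y)
    rw [← euclNorm_sq] at h3
    exact (sq_eq_sq₀ (norm_nonneg _) (euclNorm_nonneg _)).1 h3
  rw [h2] at h1
  refine le_trans (le_of_eq ?_) h1
  rw [← h2]
  rfl

open Matrix in
lemma transpose_cfcSqrt_mul_cfcSqrt {n : ℕ} {S : Matrix (Fin n) (Fin n) ℝ} (hS : S.PosSemidef) :
    (CFC.sqrt S)ᵀ = CFC.sqrt S ∧ CFC.sqrt S * CFC.sqrt S = S := by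
  have h0 : 0 ≤ S := hS.nonneg
  refine ⟨?_, CFC.sqrt_mul_sqrt_self S h0⟩
  have h1 := (Matrix.nonneg_iff_posSemidef.1 (CFC.sqrt_nonneg S)).isHermitian
  rwa [IsHermitian, conjTranspose_eq_transpose_of_trivial] at h1

open Matrix in
/-- The lower bound on the quadratic form comes from the bound on `S⁻¹`. -/
lemma IsBoundedPosDef.spectralBounds {L : ℝ} {n : ℕ} {S : Matrix (Fin n) (Fin n) ℝ}
    (h : IsBoundedPosDef L S) : SpectralBounds (L ^ 2) S := by
  have hdet : IsUnit S.det := h.posDef.det_pos.ne'.isUnit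
  obtain ⟨hRt, hRR⟩ := transpose_cfcSqrt_mul_cfcSqrt h.posDef.posSemidef
  set R := CFC.sqrt S with hR
  have hdR : IsUnit R.det := by
    rw [← hRR, det_mul] at hdet
    exact isUnit_of_mul_isUnit_left hdet
  have hform : ∀ (B : Matrix (Fin n) (Fin n) ℝ), specNorm B ≤ L ^ 2 → ∀ x,
      x ⬝ᵥ B *ᵥ x ≤ L ^ 2 * euclNorm x ^ 2 := by
    intro B hB x
    calc x ⬝ᵥ B *ᵥ x ≤ |x ⬝ᵥ B *ᵥ x| := le_abs_self _
      _ ≤ euclNorm x * euclNorm (B *ᵥ x) := abs_dotProduct_le _ _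
      _ ≤ euclNorm x * (L ^ 2 * euclNorm x) := by
          refine mul_le_mul_of_nonneg_left ((euclNorm_mulVec_le_specNorm_mul B x).trans ?_) (euclNorm_nonneg _)
          exact mul_le_mul_of_nonneg_right hB (euclNorm_nonneg _)
      _ = _ := by ring
  refine ⟨?_, fun x => ?_, hform S h.norm_le⟩
  · have := h.posDef.isHermitian
    rwa [IsHermitian, conjTranspose_eq_transpose_of_trivial] at this
  · -- apply the bound on `S⁻¹` to `S^{1/2} x`
    have h1 := hform S⁻¹ h.norm_inv_le (R *ᵥ x)
    have h2 : (R *ᵥ x) ⬝ᵥ S⁻¹ *ᵥ (R *ᵥ x) = euclNorm x ^ 2 := by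
      have e : R * (S⁻¹ * R) = 1 := by
        rw [← hRR, Matrix.mul_inv_rev, Matrix.mul_assoc, nonsing_inv_mul _ hdR, Matrix.mul_one,
          mul_nonsing_inv _ hdR]
      rw [mulVec_mulVec, ← dotProduct_mulVec_comm hRt, mulVec_mulVec, e, one_mulVec,
        dotProduct_self_eq_euclNorm_sq]
    have h3 : euclNorm (R *ᵥ x) ^ 2 = x ⬝ᵥ S *ᵥ x := by
      rw [← dotProduct_self_eq_euclNorm_sq, ← dotProduct_mulVec_comm hRt, mulVec_mulVec, hRR]
    rwa [h2, h3] at h1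

/-- The joint law of the entries of a matrix with independent entries of law `μ`. -/
lemma map_eq_iidLaw {Ω : Type*} [MeasurableSpace Ω] {P : Measure Ω} [IsProbabilityMeasure P]
    {ρ γ : Type*} [Fintype ρ] [Fintype γ] {M : Ω → ρ → γ → ℝ} {μ : Measure ℝ}
    [IsProbabilityMeasure μ] (hM : ∀ i j, AEMeasurable (fun ω => M ω i j) P)
    (hlaw : ∀ i j, P.map (fun ω => M ω i j) = μ)
    (hind : iIndepFun (fun (ij : ρ × γ) (ω : Ω) => M ω ij.1 ij.2) P) :
    AEMeasurable M P ∧ P.map M = iidLaw ρ γ μ := by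
  have hM' : ∀ ij : ρ × γ, AEMeasurable (fun ω => M ω ij.1 ij.2) P := fun ij => hM ij.1 ij.2
  have h1 := (iIndepFun_iff_map_fun_eq_pi_map hM').1 hind
  simp only [hlaw] at h1
  have h2 := Measure.infinitePi_map_curry (fun (_ : ρ) (_ : γ) => μ)
  simp only [Measure.infinitePi_eq_pi] at h2
  have h3 : AEMeasurable (fun ω (ij : ρ × γ) => M ω ij.1 ij.2) P := aemeasurable_pi_lambda _ hM'
  refine ⟨aemeasurable_pi_lambda _ fun i => aemeasurable_pi_lambda _ fun j => hM i j, ?_⟩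
  refine Eq.trans ?_ h2
  rw [← h1, AEMeasurable.map_map_of_aemeasurable (by fun_prop) h3]
  rfl

/-- Polynomial factors are absorbed by the exponential in `q ≈ n ^ (1 / 18)`. -/
lemma exists_mul_exp_neg_le :
    ∃ q₁ : ℕ, ∀ q n : ℕ, q₁ ≤ q → 0 < n → n ≤ (2 * q) ^ 18 →
      (n : ℝ) * ((n + 3) * Real.exp (-q)) ≤ Real.exp (-(n : ℝ) ^ (1 / 36 : ℝ)) := by
  have h1 := (Real.tendsto_pow_mul_exp_neg_atTop_nhds_zero 36).eventually
    (gt_mem_nhds (show (0 : ℝ) < 1 / 4 ^ 37 by positivity))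
  obtain ⟨t₀, ht₀⟩ := Filter.eventually_atTop.1 h1
  obtain ⟨q₁, hq₁⟩ := exists_nat_ge (max 8 (2 * t₀))
  refine ⟨q₁, fun q n hq hn hnq => ?_⟩
  have hqR : max 8 (2 * t₀) ≤ (q : ℝ) := hq₁.trans (by exact_mod_cast hq)
  rw [max_le_iff] at hqR
  have hq0 : (0 : ℝ) < q := by linarith
  have hn1 : (1 : ℝ) ≤ n := by exact_mod_cast hn
  have hnq' : (n : ℝ) ≤ (2 * q) ^ 18 := by exact_mod_cast hnq
  have h2 := (ht₀ (q / 2) (by linarith)).le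
  have h3 : 4 * (2 * q : ℝ) ^ 36 * Real.exp (-(q / 2)) ≤ 1 := by
    calc 4 * (2 * q : ℝ) ^ 36 * Real.exp (-(q / 2))
        = 4 ^ 37 * ((q / 2 : ℝ) ^ 36 * Real.exp (-(q / 2))) := by ring
      _ ≤ 4 ^ 37 * (1 / 4 ^ 37) := by gcongr
      _ = 1 := by norm_num
  have h4 : (n : ℝ) ^ (1 / 36 : ℝ) ≤ q / 2 := by
    have h5 : (n : ℝ) ≤ (q / 2 : ℝ) ^ 36 := by
      calc (n : ℝ) ≤ (2 * q) ^ 18 := hnq'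
        _ ≤ ((q / 2) ^ 2) ^ 18 := by
            gcongr
            nlinarith
        _ = _ := by rw [← pow_mul]
    calc (n : ℝ) ^ (1 / 36 : ℝ) ≤ ((q / 2 : ℝ) ^ 36) ^ (1 / 36 : ℝ) := by gcongr
      _ = q / 2 := by
          have := Real.pow_rpow_inv_natCast (x := (q / 2 : ℝ)) (n := 36) (by positivity) (by norm_num)
          norm_num at this ⊢
          exact this
  calc (n : ℝ) * ((n + 3) * Real.exp (-q))
      ≤ (2 * q) ^ 18 * ((4 * (2 * q) ^ 18) * Real.exp (-q)) := by
        gcongr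
        linarith
    _ = (4 * (2 * q : ℝ) ^ 36 * Real.exp (-(q / 2))) * Real.exp (-(q / 2)) := by
        rw [mul_assoc _ (Real.exp _), ← Real.exp_add, show -(q / 2 : ℝ) + -(q / 2) = -q by ring]
        ring
    _ ≤ 1 * Real.exp (-(q / 2)) := by gcongr
    _ ≤ _ := by
        rw [one_mul]
        exact Real.exp_le_exp.2 (by linarith)

theorem corollary1p3 (c₁ L Q : ℝ) (hc₁ : 0 < c₁) (hL : 1 ≤ L) (hQ : 0 < Q) :
    ∃ C c : ℝ, 0 < C ∧ 0 < c ∧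
      ∀ (n p : ℕ)
        (Ω : Type*) [MeasurableSpace Ω] (P : Measure Ω) [IsProbabilityMeasure P]
        (Ω' : Type*) [MeasurableSpace Ω'] (P' : Measure Ω') [IsProbabilityMeasure P']
        (ξ : Ω' → ℝ) (M : Ω → Matrix (Fin n) (Fin p) ℝ) (S : Matrix (Fin n) (Fin n) ℝ),
        IsAtomVariable ξ P' → IsSubgaussian Q ξ P' → IsIIDMatrix c₁ M P ξ P' →
        IsBoundedPosDef L S →
          1 - C * Real.exp (-(n : ℝ) ^ c) ≤
            P.real {ω | Function.Injective (singVal (CFC.sqrt S * M ω))} := by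
  obtain ⟨σ, q₀, K₀, hσ, hq₀, hK₀, hspread⟩ := exists_spreadLaw hQ
  have hℓ : 0 < L ^ 2 := by positivity
  obtain ⟨q₁, hprob⟩ := exists_measure_multiple_eigenvalue_le hσ hq₀ hK₀ hc₁ hℓ
  obtain ⟨q₂, hnum⟩ := exists_mul_exp_neg_le
  set q₃ := max (max q₁ q₂) 1 with hq₃
  set n₀ := q₃ ^ 18 with hn₀
  refine ⟨Real.exp n₀, 1 / 36, Real.exp_pos _, by norm_num, ?_⟩
  intro n p Ω _ P _ Ω' _ P' _ ξ M S hξ hsub hM hS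
  rcases lt_or_ge n n₀ with hn | hn
  · -- the constant `exp n₀` makes the bound trivial
    refine le_trans ?_ measureReal_nonneg
    have h1 : (n : ℝ) ^ (1 / 36 : ℝ) ≤ n₀ := by
      have h2 : (1 : ℝ) ≤ n₀ := by
        exact_mod_cast Nat.one_le_pow _ _ (lt_of_lt_of_le one_pos (le_max_right _ _))
      calc (n : ℝ) ^ (1 / 36 : ℝ) ≤ (n₀ : ℝ) ^ (1 / 36 : ℝ) := by gcongr
        _ ≤ (n₀ : ℝ) ^ (1 : ℝ) := Real.rpow_le_rpow_of_exponent_le h2 (by norm_num)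
        _ = n₀ := Real.rpow_one _
    rw [← Real.exp_add, sub_nonpos]
    exact Real.one_le_exp (by linarith)
  have hq₃1 : 1 ≤ q₃ := le_max_right _ _
  -- The scale is the integer part of the 18th root of `n`.
  obtain ⟨q, hq3, hqn, hnq⟩ : ∃ q : ℕ, q₃ ≤ q ∧ q ^ 18 ≤ n ∧ n ≤ (2 * q) ^ 18 := by
    have hmono : StrictMono fun k : ℕ => k ^ 18 := Nat.pow_left_strictMono (by norm_num)
    have hq := Nat.findGreatest_spec (P := fun k => k ^ 18 ≤ n) (m := q₃) (n := n)
      ((Nat.le_self_pow (by norm_num) _).trans hn) hn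
    refine ⟨Nat.findGreatest (fun k => k ^ 18 ≤ n) n, Nat.le_findGreatest
      ((Nat.le_self_pow (by norm_num) _).trans hn) hn, hq, ?_⟩
    set q := Nat.findGreatest (fun k => k ^ 18 ≤ n) n with hqdef
    have hq1 : q₃ ≤ q := Nat.le_findGreatest ((Nat.le_self_pow (by norm_num) _).trans hn) hn
    by_contra! hcon
    have h1 : (q + 1) ^ 18 ≤ n := (Nat.pow_le_pow_left (by omega) 18).trans hcon.le
    have h2 := Nat.le_findGreatest (P := fun k => k ^ 18 ≤ n)
      ((Nat.le_self_pow (by norm_num) _).trans h1) h1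
    omega
  have hn0 : 0 < n := lt_of_lt_of_le (pow_pos (by omega) _) hqn
  -- the law of the entries
  have hξm : AEMeasurable ξ P' := hξ.memLp_four.aestronglyMeasurable.aemeasurable
  set μ := P'.map ξ with hμ
  have : IsProbabilityMeasure μ := Measure.isProbabilityMeasure_map hξm
  have hmean : ∫ x, x ∂μ = 0 := by
    rw [hμ, integral_map hξm (by fun_prop)]; exact hξ.mean_zero
  have hvar : ∫ x, x ^ 2 ∂μ = 1 := by
    rw [hμ, integral_map hξm (by fun_prop), ← hξ.unit_variance, variance_eq_integral hξm]
    simp only [hξ.mean_zero, sub_zero]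
  have htail : ∀ t : ℝ, 0 < t → μ.real {x | t < |x|} ≤ 1 / Q * Real.exp (-Q * t ^ 2) := by
    intro t ht
    have hms : MeasurableSet {x : ℝ | t < |x|} :=
      (isOpen_lt continuous_const continuous_abs).measurableSet
    rw [measureReal_def, hμ, Measure.map_apply_of_aemeasurable hξm hms]
    exact hsub.2 t ht
  have hSL := hspread μ hmean hvar htail
  set M' : Ω → Fin n → Fin p → ℝ := M with hM'
  obtain ⟨hMm, hMlaw⟩ := map_eq_iidLaw (P := P) (M := M') (μ := μ)
    (fun i j => (hM.identDistrib i j).aemeasurable_fst) (fun i j => (hM.identDistrib i j).map_eq)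
    hM.indep
  have hb := hprob q n (by omega) hqn hnq (Fin p) (Fin n) (Fintype.card_fin n)
    (by rw [Fintype.card_fin]; exact hM.aspect_lower)
    (by rw [Fintype.card_fin]; exact hM.aspect_upper) μ hSL S hS.spectralBounds
  rw [← hMlaw] at hb
  set bad : Set (Fin n → Fin p → ℝ) := {A | ∃ (lam : ℝ) (x y : Fin p → ℝ), euclNorm x = 1 ∧
    euclNorm y = 1 ∧ dotProduct x y = 0 ∧
    (rowGram S (fun k j => A j k)).mulVec x = lam • x ∧
    (rowGram S (fun k j => A j k)).mulVec y = lam • y} with hbad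
  obtain ⟨hRt, hRR⟩ := transpose_cfcSqrt_mul_cfcSqrt hS.posDef.posSemidef
  have hcover : (Set.univ : Set Ω) ⊆
      {ω | Function.Injective (singVal (CFC.sqrt S * M ω))} ∪ M' ⁻¹' bad := by
    intro ω _
    by_cases h : Function.Injective (singVal (CFC.sqrt S * M ω))
    · exact Or.inl h
    right
    obtain ⟨lam, x, y, hx, hy, hxy, hex, hey⟩ := exists_eigenvectors_of_not_injective_singVal _ h
    have hW : (CFC.sqrt S * M ω).transpose * (CFC.sqrt S * M ω) =
        rowGram S (fun k j => M ω j k) := by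
      rw [Matrix.transpose_mul, hRt, Matrix.mul_assoc, ← Matrix.mul_assoc (CFC.sqrt S), hRR,
        ← Matrix.mul_assoc]
      rfl
    rw [hW] at hex hey
    exact ⟨lam, x, y, hx, hy, hxy, hex, hey⟩
  have h1 : (1 : ℝ) ≤ P.real {ω | Function.Injective (singVal (CFC.sqrt S * M ω))} +
      P.real (M' ⁻¹' bad) := by
    calc (1 : ℝ) = P.real Set.univ := by simp
      _ ≤ _ := (measureReal_mono hcover (measure_ne_top _ _)).trans (measureReal_union_le _ _)
  have h2 : P.real (M' ⁻¹' bad) ≤ (P.map M').real bad := by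
    have : IsProbabilityMeasure (P.map M') := Measure.isProbabilityMeasure_map hMm
    exact ENNReal.toReal_mono (measure_ne_top _ _) (Measure.le_map_apply hMm _)
  have h3 := hnum q n (by omega) hn0 hnq
  have h4 : 1 * Real.exp (-(n : ℝ) ^ (1 / 36 : ℝ)) ≤
      Real.exp n₀ * Real.exp (-(n : ℝ) ^ (1 / 36 : ℝ)) := by
    gcongr
    exact Real.one_le_exp (Nat.cast_nonneg _)
  linarith
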